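/- Work in subsystems of second order arithmetic; "over a theory $\mathsf{S}$" means: in every (possibly nonstandard) model of $\mathsf{S}$, with general (Henkin) semantics for set quantifiers, equivalently provably in $\mathsf{S}$. A CSCS is a triple $(X,(U_i)_{i\in\mathbb N},k)$ where $X\subseteq\mathbb N$, the $U_i\subseteq X$ cover $X$, and $k:X\times\mathbb N\times\mathbb N\to\mathbb N$ satisfies $x\in U_{k(x,i,j)}\subseteq U_i\cap U_j$ whenever $x\in U_i\cap U_j$. It is scattered if every nonempty $Y\subseteq X$ has a point $y$ with $U_i\cap Y=\{y\}$ for some $i$. A countable metric space is a pair $(X,d)$ with $X\subseteq\mathbb N$ and $d:X\times X\to\mathbb R_{\ge 0}$ a metric; it is complete if every Cauchy sequence in $X$ converges to a point of $X$. For a tree $T\subseteq\mathbb N^{<\mathbb N}$ put $$T^+=\{\tau\in\mathbb N^{<\mathbb N}:\exists\sigma\in T\,(|\sigma|=|\tau|\wedge\forall n<|\tau|\;\sigma(n)\le\tau(n))\},$$ and let $\mathrm{KB}(T^+)$ be $T^+$ with the Kleene–Brouwer order ($\sigma<_{\mathrm{KB}}\tau$ iff $\sigma$ properly extends $\tau$,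 or $\sigma(j)<\tau(j)$ at the first $j$ where they differ). 1. Over $\mathsf{ACA}_0$, for every tree $T$, $T^+$ with the open-interval basis of the order topology of $\mathrm{KB}(T^+)$ exists and is a CSCS, and $T$ is well founded (has no branch) if and only if $\mathrm{KB}(T^+)$ with the order topology is scattered. 2. Over $\mathsf{ACA}_0$, being a complete countable metric space is a $\Pi^1_1$-universal formula: it is expressible over $\mathsf{ACA}_0$ by a $\Pi^1_1$ formula, and for every $\Pi^1_1$ formula $\psi$ (with arbitrary number and set parameters) there is an arithmetical formula which, over $\mathsf{ACA}_0$, defines from the parameters of $\psi$ a countable metric space that is complete if and only if $\psi$ holds. 3. Over $\mathsf{RCA}_0$ the following are equivalent: (a) $\Pi^1_1$ comprehension; (b) for every sequence $(X^i)_{i\in\mathbb N}$ of CSCS the set $\{i\in\mathbb N: X^i\text{ is scattered}\}$ exists; (c) for every sequence $(X^i,d^i)_{i\in\mathbb N}$ of countable metric spaces the set $\{i\in\mathbb N:(X^i,d^i)\text{ is complete}\}$ exists. -/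

import Mathlib

universe u

/-! ## Second order arithmetic: language, structures, satisfaction -/

/-- A structure for the two-sorted language of second order arithmetic (general, i.e. Henkin,
semantics): an arbitrary number domain with its operations, and a nonempty family of subsets of
the domain as the range of the set variables. -/
structure L2Structure where
  Dom : Type u
  zero : Dom
  one : Dom
  add : Dom → Dom → Dom
  mul : Dom → Dom → Dom
  lt : Dom → Dom → Prop
  sets : Set (Set Dom)
  sets_nonempty : sets.Nonempty

namespace L2Structure

variable (𝓜 : L2Structure.{u})

instance : Zero 𝓜.Dom := ⟨𝓜.zero⟩
instance : One 𝓜.Dom := ⟨𝓜.one⟩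
instance : Add 𝓜.Dom := ⟨𝓜.add⟩
instance : Mul 𝓜.Dom := ⟨𝓜.mul⟩
instance : LT 𝓜.Dom := ⟨𝓜.lt⟩
instance : LE 𝓜.Dom := ⟨fun a b => a < b ∨ a = b⟩
instance : Nonempty 𝓜.Dom := ⟨0⟩

end L2Structure

/-- Number terms; variables are de Bruijn indices. -/
inductive L2Term where
  | var : ℕ → L2Term
  | zero : L2Term
  | one : L2Term
  | add : L2Term → L2Term → L2Term
  | mul : L2Term → L2Term → L2Term

/-- Formulas of second order arithmetic. Number variables and set variables are two separate
families of de Bruijn indices; `allN` binds the number variable `0`, `allS` binds the set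
variable `0`. -/
inductive L2Formula where
  | eq : L2Term → L2Term → L2Formula
  | lt : L2Term → L2Term → L2Formula
  | mem : L2Term → ℕ → L2Formula
  | neg : L2Formula → L2Formula
  | and : L2Formula → L2Formula → L2Formula
  | allN : L2Formula → L2Formula
  | allS : L2Formula → L2Formula

/-- Extend a valuation by a new value for variable `0`. -/
def vcons {α : Type*} (x : α) (v : ℕ → α) : ℕ → α
  | 0 => x
  | n + 1 => v n

namespace L2Term

def eval (𝓜 : L2Structure.{u}) (v : ℕ → 𝓜.Dom) : L2Term → 𝓜.Dom
  | var i => v i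
  | zero => 0
  | one => 1
  | add s t => eval 𝓜 v s + eval 𝓜 v t
  | mul s t => eval 𝓜 v s * eval 𝓜 v t

/-- Raise all variables by one (so that the term avoids the variable bound next). -/
def shift : L2Term → L2Term
  | var i => var (i + 1)
  | zero => zero
  | one => one
  | add s t => add (shift s) (shift t)
  | mul s t => mul (shift s) (shift t)

end L2Term

namespace L2Formula

/-- Tarskian satisfaction; set quantifiers range over `𝓜.sets`. -/
def Sat (𝓜 : L2Structure.{u}) : L2Formula → (ℕ → 𝓜.Dom) → (ℕ → 𝓜.sets) → Prop
  | eq s t, v, _ => s.eval 𝓜 v = t.eval 𝓜 v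
  | lt s t, v, _ => s.eval 𝓜 v < t.eval 𝓜 v
  | mem t i, v, V => t.eval 𝓜 v ∈ (V i : Set 𝓜.Dom)
  | neg φ, v, V => ¬ Sat 𝓜 φ v V
  | and φ ψ, v, V => Sat 𝓜 φ v V ∧ Sat 𝓜 ψ v V
  | allN φ, v, V => ∀ x : 𝓜.Dom, Sat 𝓜 φ (vcons x v) V
  | allS φ, v, V => ∀ X : 𝓜.sets, Sat 𝓜 φ v (vcons X V)

def imp (φ ψ : L2Formula) : L2Formula := neg (and φ (neg ψ))

def exN (φ : L2Formula) : L2Formula := neg (allN (neg φ))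

/-- The bounded quantifier `∀ x < t, φ`. -/
def ballN (t : L2Term) (φ : L2Formula) : L2Formula :=
  allN (imp (lt (L2Term.var 0) t.shift) φ)

/-- `Σ⁰₀` formulas: all quantifiers are bounded number quantifiers. -/
inductive IsSigma00 : L2Formula → Prop
  | eq (s t : L2Term) : IsSigma00 (eq s t)
  | lt (s t : L2Term) : IsSigma00 (lt s t)
  | mem (t : L2Term) (i : ℕ) : IsSigma00 (mem t i)
  | neg {φ : L2Formula} : IsSigma00 φ → IsSigma00 (neg φ)
  | and {φ ψ : L2Formula} : IsSigma00 φ → IsSigma00 ψ → IsSigma00 (and φ ψ)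
  | ballN (t : L2Term) {φ : L2Formula} : IsSigma00 φ → IsSigma00 (ballN t φ)

def IsSigma01 (φ : L2Formula) : Prop := ∃ θ, IsSigma00 θ ∧ φ = exN θ

def IsPi01 (φ : L2Formula) : Prop := ∃ θ, IsSigma00 θ ∧ φ = allN θ

/-- Arithmetical formulas: no set quantifiers (set parameters are allowed). -/
def IsArithmetical : L2Formula → Prop
  | eq _ _ => True
  | lt _ _ => True
  | mem _ _ => True
  | neg φ => IsArithmetical φ
  | and φ ψ => IsArithmetical φ ∧ IsArithmetical ψ
  | allN φ => IsArithmetical φ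
  | allS _ => False

def IsPi11 (φ : L2Formula) : Prop := ∃ θ, IsArithmetical θ ∧ φ = allS θ

end L2Formula

namespace L2Structure

variable (𝓜 : L2Structure.{u})

/-! ## The axiom systems -/

structure BasicAxioms : Prop where
  succ_ne_zero : ∀ n : 𝓜.Dom, n + 1 ≠ 0
  succ_inj : ∀ m n : 𝓜.Dom, m + 1 = n + 1 → m = n
  add_zero : ∀ m : 𝓜.Dom, m + 0 = m
  add_succ : ∀ m n : 𝓜.Dom, m + (n + 1) = (m + n) + 1
  mul_zero : ∀ m : 𝓜.Dom, m * 0 = 0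
  mul_succ : ∀ m n : 𝓜.Dom, m * (n + 1) = m * n + m
  not_lt_zero : ∀ m : 𝓜.Dom, ¬ m < 0
  lt_succ : ∀ m n : 𝓜.Dom, m < n + 1 ↔ (m < n ∨ m = n)

/-- The induction axiom for sets. -/
def SetInduction : Prop :=
  ∀ X ∈ 𝓜.sets, (0 : 𝓜.Dom) ∈ X → (∀ n ∈ X, n + 1 ∈ X) → ∀ n, n ∈ X

/-- The scheme of induction for `Σ⁰₁` formulas, with number and set parameters. -/
def Sigma01Induction : Prop :=
  ∀ φ : L2Formula, φ.IsSigma01 → ∀ (v : ℕ → 𝓜.Dom) (V : ℕ → 𝓜.sets),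
    φ.Sat 𝓜 (vcons 0 v) V →
    (∀ n, φ.Sat 𝓜 (vcons n v) V → φ.Sat 𝓜 (vcons (n + 1) v) V) →
    ∀ n, φ.Sat 𝓜 (vcons n v) V

/-- The scheme of `Δ⁰₁` comprehension, with parameters. -/
def Delta01Comprehension : Prop :=
  ∀ φ ψ : L2Formula, φ.IsSigma01 → ψ.IsPi01 → ∀ (v : ℕ → 𝓜.Dom) (V : ℕ → 𝓜.sets),
    (∀ n, φ.Sat 𝓜 (vcons n v) V ↔ ψ.Sat 𝓜 (vcons n v) V) →
    ∃ X ∈ 𝓜.sets, ∀ n, n ∈ X ↔ φ.Sat 𝓜 (vcons n v) V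

/-- The scheme of arithmetical comprehension, with parameters. -/
def ArithmeticalComprehension : Prop :=
  ∀ φ : L2Formula, φ.IsArithmetical → ∀ (v : ℕ → 𝓜.Dom) (V : ℕ → 𝓜.sets),
    ∃ X ∈ 𝓜.sets, ∀ n, n ∈ X ↔ φ.Sat 𝓜 (vcons n v) V

/-- The scheme of `Π¹₁` comprehension, with parameters. -/
def Pi11Comprehension : Prop :=
  ∀ φ : L2Formula, φ.IsPi11 → ∀ (v : ℕ → 𝓜.Dom) (V : ℕ → 𝓜.sets),
    ∃ X ∈ 𝓜.sets, ∀ n, n ∈ X ↔ φ.Sat 𝓜 (vcons n v) V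

/-- `𝓜` is a model of `RCA₀`. -/
structure ModelsRCA0 : Prop where
  basic : 𝓜.BasicAxioms
  induction : 𝓜.Sigma01Induction
  comprehension : 𝓜.Delta01Comprehension

/-- `𝓜` is a model of `ACA₀`. -/
structure ModelsACA0 : Prop where
  basic : 𝓜.BasicAxioms
  induction : 𝓜.SetInduction
  comprehension : 𝓜.ArithmeticalComprehension

variable {𝓜}

/-! ## Pairs, functions and sequences of sets inside a structure -/

/-- The code of the pair `(i, j)`. -/
def pair (i j : 𝓜.Dom) : 𝓜.Dom := (i + j) * (i + j) + i

/-- The set of codes of pairs in `A × B`. -/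
def prodSet (A B : Set 𝓜.Dom) : Set 𝓜.Dom := {p | ∃ a ∈ A, ∃ b ∈ B, p = pair a b}

/-- `F` is (the graph of) a function from `A` to `B`. -/
def IsFun (F A B : Set 𝓜.Dom) : Prop :=
  F ⊆ prodSet A B ∧ ∀ a ∈ A, ∃! b, pair a b ∈ F

/-- The value at `a` of the function with graph `F`. -/
noncomputable def app (F : Set 𝓜.Dom) (a : 𝓜.Dom) : 𝓜.Dom :=
  Classical.epsilon fun b => pair a b ∈ F

/-- The `i`-th member of the sequence of sets coded by `Z`. -/
def sec (Z : Set 𝓜.Dom) (i : 𝓜.Dom) : Set 𝓜.Dom := {x | pair i x ∈ Z}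

/-! ## Countable second countable spaces -/

/-- `(X, (U_i), k)` is a countable second countable space; `U` codes the sequence `(U_i)`. -/
structure IsCSCS (X U K : Set 𝓜.Dom) : Prop where
  subset : ∀ i, sec U i ⊆ X
  isFun : IsFun K (prodSet X (prodSet Set.univ Set.univ)) Set.univ
  cover : ∀ x ∈ X, ∃ i, x ∈ sec U i
  basis : ∀ x i j, x ∈ sec U i → x ∈ sec U j →
    x ∈ sec U (app K (pair x (pair i j))) ∧
      sec U (app K (pair x (pair i j))) ⊆ sec U i ∩ sec U j

/-- Every nonempty subspace `Y ⊆ X` (of the structure) has an isolated point. -/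
def IsScattered (X U : Set 𝓜.Dom) : Prop :=
  ∀ Y ∈ 𝓜.sets, Y ⊆ X → Y.Nonempty → ∃ y ∈ Y, ∃ i, sec U i ∩ Y = {y}

/-! ## Finite sequences, trees, the Kleene–Brouwer order -/

/-- `r` is the remainder of `a` modulo `m`. -/
def IsRem (a m r : 𝓜.Dom) : Prop := r < m ∧ ∃ q, a = m * q + r

/-- Codes of finite sequences are of the form `(l, (a, b))`, where `l` is the length and the
entries are given by Gödel's beta function of `a` and `b`. -/
def HasLength (s l : 𝓜.Dom) : Prop := ∃ a b, s = pair l (pair a b)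

/-- The sequence coded by `s` has `v` as its `i`-th entry. -/
def HasEntry (s i v : 𝓜.Dom) : Prop :=
  ∃ l a b, s = pair l (pair a b) ∧ i < l ∧ IsRem a (b * (i + 1) + 1) v

variable (𝓜) in
/-- `ℕ^{<ℕ}`: each finite sequence is represented by its least code. -/
def finSeqs : Set 𝓜.Dom :=
  {s | ∃ l, HasLength s l ∧
    ∀ s' < s, HasLength s' l → ∃ i v, HasEntry s i v ∧ ¬ HasEntry s' i v}

/-- `σ` is an initial segment of `τ`. -/
def IsInitSeg (σ τ : 𝓜.Dom) : Prop := ∀ i v, HasEntry σ i v → HasEntry τ i v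

def IsTree (T : Set 𝓜.Dom) : Prop :=
  T ⊆ 𝓜.finSeqs ∧ ∀ σ ∈ T, ∀ τ ∈ 𝓜.finSeqs, IsInitSeg τ σ → τ ∈ T

/-- The function `F` is a branch of `T`: all its finite restrictions are in `T`. -/
def IsBranch (F T : Set 𝓜.Dom) : Prop :=
  IsFun F Set.univ Set.univ ∧
    ∀ n, ∃ σ ∈ T, HasLength σ n ∧ ∀ i < n, ∀ v, HasEntry σ i v ↔ pair i v ∈ F

/-- No function of the structure is a branch of `T`. -/
def IsWellFounded (T : Set 𝓜.Dom) : Prop := ¬ ∃ F ∈ 𝓜.sets, IsBranch F T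

/-- `σ <_KB τ`. -/
def ltKB (σ τ : 𝓜.Dom) : Prop :=
  (IsInitSeg τ σ ∧ σ ≠ τ) ∨
    ∃ j a b, HasEntry σ j a ∧ HasEntry τ j b ∧ a < b ∧
      ∀ i < j, ∀ v, HasEntry σ i v ↔ HasEntry τ i v

/-- `T⁺`: the finite sequences which dominate some sequence of `T` of the same length. -/
def plusTree (T : Set 𝓜.Dom) : Set 𝓜.Dom :=
  {τ | τ ∈ 𝓜.finSeqs ∧ ∃ σ ∈ T, (∃ l, HasLength τ l ∧ HasLength σ l) ∧
    ∀ n a b, HasEntry σ n a → HasEntry τ n b → a ≤ b}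

/-- The code of the sequence of open intervals of the order `(L, r)`, a basis of its order
topology. The interval with index `(a, b)` has left end `-∞` if `a = 0` and `a'` if `a = a' + 1`,
and right end `+∞` if `b = 0` and `b'` if `b = b' + 1`. -/
def intervalBasis (L : Set 𝓜.Dom) (r : 𝓜.Dom → 𝓜.Dom → Prop) : Set 𝓜.Dom :=
  {p | ∃ a b x, p = pair (pair a b) x ∧ x ∈ L ∧
    (a = 0 ∨ ∃ a' ∈ L, a = a' + 1 ∧ r a' x) ∧ (b = 0 ∨ ∃ b' ∈ L, b = b' + 1 ∧ r x b')}

/-! ## Rationals, reals, countable metric spaces -/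

variable (𝓜) in
/-- A presentation `(p - n) / d` of a rational number; `d ≠ 0` is required of codes below. -/
structure PreRat where
  p : 𝓜.Dom
  n : 𝓜.Dom
  d : 𝓜.Dom

namespace PreRat

instance : Nonempty 𝓜.PreRat := ⟨⟨0, 0, 1⟩⟩

def code (q : 𝓜.PreRat) : 𝓜.Dom := pair (pair q.p q.n) q.d

def add (q r : 𝓜.PreRat) : 𝓜.PreRat :=
  ⟨q.p * r.d + r.p * q.d, q.n * r.d + r.n * q.d, q.d * r.d⟩

def le (q r : 𝓜.PreRat) : Prop := q.p * r.d + r.n * q.d ≤ r.p * q.d + q.n * r.d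

def zero : 𝓜.PreRat := ⟨0, 0, 1⟩

/-- `1 / (k + 1)` -/
def unitFrac (k : 𝓜.Dom) : 𝓜.PreRat := ⟨1, 0, k + 1⟩

end PreRat

variable (𝓜) in
/-- The set of codes of rational numbers. -/
def ratCodes : Set 𝓜.Dom := {c | ∃ q : 𝓜.PreRat, q.d ≠ 0 ∧ c = q.code}

/-- A real number is a rapidly converging sequence of rationals,
`|x_k - x_l| ≤ 1 / (k + 1)` for `k ≤ l`. -/
def IsReal (x : 𝓜.Dom → 𝓜.PreRat) : Prop :=
  ∀ k l, k ≤ l →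
    (x k).le ((x l).add (PreRat.unitFrac k)) ∧ (x l).le ((x k).add (PreRat.unitFrac k))

/-- The order of the reals: `x ≤ y` iff `x_k ≤ y_k + 2 / (k + 1)` for all `k`. -/
def realLE (x y : 𝓜.Dom → 𝓜.PreRat) : Prop :=
  ∀ k, (x k).le ((y k).add ((PreRat.unitFrac k).add (PreRat.unitFrac k)))

def realLT (x y : 𝓜.Dom → 𝓜.PreRat) : Prop := ¬ realLE y x

/-- Equality of reals. -/
def realEq (x y : 𝓜.Dom → 𝓜.PreRat) : Prop := realLE x y ∧ realLE y x

def realAdd (x y : 𝓜.Dom → 𝓜.PreRat) : 𝓜.Dom → 𝓜.PreRat :=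
  fun k => (x (k + k + 1)).add (y (k + k + 1))

/-- The real `d(x, y)`, where `D` codes the function sending `((x, y), k)` to the code of the
`k`-th rational approximation of `d(x, y)`. -/
noncomputable def dist (D : Set 𝓜.Dom) (x y : 𝓜.Dom) : 𝓜.Dom → 𝓜.PreRat :=
  fun k => Classical.epsilon fun q : 𝓜.PreRat => app D (pair (pair x y) k) = q.code

/-- `(X, d)` is a countable metric space, `d : X × X → ℝ` being coded by `D`. -/
structure IsMetricSpace (X D : Set 𝓜.Dom) : Prop where
  isFun : IsFun D (prodSet (prodSet X X) Set.univ) 𝓜.ratCodes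
  isReal : ∀ x ∈ X, ∀ y ∈ X, IsReal (dist D x y)
  nonneg : ∀ x ∈ X, ∀ y ∈ X, realLE (fun _ => PreRat.zero) (dist D x y)
  eq_zero_iff : ∀ x ∈ X, ∀ y ∈ X, realEq (dist D x y) (fun _ => PreRat.zero) ↔ x = y
  symm : ∀ x ∈ X, ∀ y ∈ X, realEq (dist D x y) (dist D y x)
  triangle : ∀ x ∈ X, ∀ y ∈ X, ∀ z ∈ X,
    realLE (dist D x z) (realAdd (dist D x y) (dist D y z))

/-- The sequence `F` is a Cauchy sequence. -/
def IsCauchy (D F : Set 𝓜.Dom) : Prop :=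
  ∀ k, ∃ N, ∀ m n, N ≤ m → N ≤ n →
    realLT (dist D (app F m) (app F n)) (fun _ => PreRat.unitFrac k)

/-- The sequence `F` converges to `x`. -/
def ConvergesTo (D F : Set 𝓜.Dom) (x : 𝓜.Dom) : Prop :=
  ∀ k, ∃ N, ∀ n, N ≤ n → realLT (dist D (app F n) x) (fun _ => PreRat.unitFrac k)

/-- Every Cauchy sequence of points of `X` (of the structure) converges to a point of `X`. -/
def IsCompleteMetric (X D : Set 𝓜.Dom) : Prop :=
  ∀ F ∈ 𝓜.sets, IsFun F Set.univ X → IsCauchy D F → ∃ x ∈ X, ConvergesTo D F x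

/-- A metric space `(X, d)` coded by a single set `Z`: `X` is member `0` and `d` is member `1` of
the sequence coded by `Z`. -/
def CodesMetricSpace (Z : Set 𝓜.Dom) : Prop := IsMetricSpace (sec Z 0) (sec Z 1)

/-! ## Existence of index sets -/

variable (𝓜)

/-- For any sequence of CSCS the index set of the scattered ones exists. -/
def ScatteredIndexSets : Prop :=
  ∀ X ∈ 𝓜.sets, ∀ U ∈ 𝓜.sets, ∀ K ∈ 𝓜.sets,
    (∀ i, IsCSCS (sec X i) (sec U i) (sec K i)) →
    {i | IsScattered (sec X i) (sec U i)} ∈ 𝓜.sets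

/-- For any sequence of countable metric spaces the index set of the complete ones exists. -/
def CompleteIndexSets : Prop :=
  ∀ X ∈ 𝓜.sets, ∀ D ∈ 𝓜.sets,
    (∀ i, IsMetricSpace (sec X i) (sec D i)) →
    {i | IsCompleteMetric (sec X i) (sec D i)} ∈ 𝓜.sets

end L2Structure

/-- For a property `P` of objects of a class `C` (both given by set codes), "being an object of
`C` with property `P`" is a universal `Π¹₁` formula over `ACA₀`: it is expressed over `ACA₀` by a
`Π¹₁` formula with one free (set) variable, and for every `Π¹₁` formula `ψ`, with any number and
set parameters, there is a code of an object of `C`, defined from the parameters by an arithmetical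
formula `θ`, which has property `P` iff `ψ` holds, provably in `ACA₀`. -/
def IsPi11UniversalOverACA0
    (C P : ∀ 𝓜 : L2Structure.{u}, Set 𝓜.Dom → Prop) : Prop :=
  (∃ φ : L2Formula, φ.IsPi11 ∧
    ∀ 𝓜 : L2Structure.{u}, 𝓜.ModelsACA0 → ∀ (v : ℕ → 𝓜.Dom) (V : ℕ → 𝓜.sets),
      φ.Sat 𝓜 v V ↔ C 𝓜 (V 0) ∧ P 𝓜 (V 0)) ∧
  ∀ ψ : L2Formula, ψ.IsPi11 → ∃ θ : L2Formula, θ.IsArithmetical ∧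
    ∀ 𝓜 : L2Structure.{u}, 𝓜.ModelsACA0 → ∀ (v : ℕ → 𝓜.Dom) (V : ℕ → 𝓜.sets),
      C 𝓜 {m | θ.Sat 𝓜 (vcons m v) V} ∧
        (ψ.Sat 𝓜 v V ↔ P 𝓜 {m | θ.Sat 𝓜 (vcons m v) V})

universe w
set_option linter.unusedSectionVars false
set_option synthInstance.maxSize 10000
set_option synthInstance.maxHeartbeats 200000

/-! ## Substitution and definability by formulas -/

/-! Trees mediate between all the statements. Scatteredness of one space and completeness of another
are each equivalent to well-foundedness of a tree, and every Π¹₁ formula is equivalent to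
well-foundedness of a tree that is arithmetical in its parameters.

Order topology. The entries of a branch of T⁺ bound a finitely branching subtree of T with nodes at
every level, so T has a branch too, by König's lemma (`exists_branch_of_branch_plusTree`). Hence, if
T is well founded, every nonempty Y ⊆ T⁺ has a KB-least element: otherwise the initial segments of
elements of Y with nothing of Y to their left form a tree without end nodes, and its leftmost branch
is a branch of T⁺ (`exists_ltKB_least`). The least element of Y is isolated by the interval ending
at its immediate successor. Conversely, if F is a branch of T, the sequences dominating F entrywise
lie in T⁺, and each of them is the KB-limit from below of its one-entry extensions, whose last entry
may grow freely; so none is isolated. This is why T⁺ replaces T: the KB order of a single infinite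
path is discrete.

Metric. On T let d(σ, τ) = 1/(j + 1), where j is the first place of difference. The restrictions of
a branch form a Cauchy sequence without limit. Conversely, a Cauchy sequence without limit
stabilises on longer and longer prefixes, which trace out a branch
(`isCompleteMetric_iff_isWellFounded`).

Normal form. For arithmetical φ(X) consider a single function coding X together with truth values
and Skolem witnesses for the subformulas. Its correctness is a condition on pairs of its values, so
the finite sequences that meet the condition, and declare φ false, form a tree whose branches
correspond to counterexamples X (`Representable.sat`, `Representable.exists_tree`). With the metric
this gives universality.

Over `RCA₀`, the matrices of scatteredness and completeness are arithmetical, so Π¹₁ comprehension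
gives the index sets. In the other direction each index set principle first yields `ACA₀`, by coding
a Σ⁰₁ projection into very simple spaces; the tree constructions are then available for a whole
sequence of trees at once, and give Π¹₁ comprehension.

Formulas are hardly ever written out. Definability is derived by instance search in an abstract
`DefClass`, with two main examples: `formulaClass` (defined by an arithmetical formula) and
`setClass` (defining a set of the model). Predicates range over a family of structures, so that one
formula serves every member of the family. -/

@[simp] theorem vcons_zero {α : Type*} (x : α) (v : ℕ → α) : vcons x v 0 = x := rfl

@[simp] theorem vcons_succ {α : Type*} (x : α) (v : ℕ → α) (n : ℕ) : vcons x v (n + 1) = v n := rfl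

theorem vcons_comp_succ {α : Type*} (x : α) (v : ℕ → α) :
    (fun n => vcons x v (n + 1)) = v := rfl

theorem vcons_eta {α : Type*} (v : ℕ → α) : vcons (v 0) (fun n => v (n + 1)) = v := by
  funext n; cases n <;> rfl

namespace L2Term

def subst (τ : ℕ → L2Term) : L2Term → L2Term
  | var i => τ i
  | zero => zero
  | one => one
  | add s t => add (subst τ s) (subst τ t)
  | mul s t => mul (subst τ s) (subst τ t)

/-- The substitution `τ` under a number quantifier. -/
def liftSubst (τ : ℕ → L2Term) : ℕ → L2Term
  | 0 => var 0
  | n + 1 => (τ n).shift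

@[simp] theorem eval_shift (𝓜 : L2Structure.{u}) (x : 𝓜.Dom) (v : ℕ → 𝓜.Dom) (t : L2Term) :
    t.shift.eval 𝓜 (vcons x v) = t.eval 𝓜 v := by
  induction t <;> simp_all [shift, eval]

theorem eval_subst (𝓜 : L2Structure.{u}) (τ : ℕ → L2Term) (v : ℕ → 𝓜.Dom) (t : L2Term) :
    (t.subst τ).eval 𝓜 v = t.eval 𝓜 (fun n => (τ n).eval 𝓜 v) := by
  induction t <;> simp_all [subst, eval]

theorem eval_liftSubst (𝓜 : L2Structure.{u}) (τ : ℕ → L2Term) (x : 𝓜.Dom) (v : ℕ → 𝓜.Dom) :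
    (fun n => (liftSubst τ n).eval 𝓜 (vcons x v)) = vcons x (fun n => (τ n).eval 𝓜 v) := by
  funext n; cases n <;> simp [liftSubst, eval]

theorem shift_subst (τ : ℕ → L2Term) (t : L2Term) :
    t.shift.subst (liftSubst τ) = (t.subst τ).shift := by
  induction t <;> simp_all [subst, shift, liftSubst]

end L2Term

namespace L2Formula

def subst : L2Formula → (ℕ → L2Term) → L2Formula
  | eq s t, τ => eq (s.subst τ) (t.subst τ)
  | lt s t, τ => lt (s.subst τ) (t.subst τ)
  | mem t i, τ => mem (t.subst τ) i
  | neg φ, τ => neg (φ.subst τ)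
  | and φ ψ, τ => and (φ.subst τ) (ψ.subst τ)
  | allN φ, τ => allN (φ.subst (L2Term.liftSubst τ))
  | allS φ, τ => allS (φ.subst τ)

theorem sat_subst (𝓜 : L2Structure.{u}) (φ : L2Formula) (τ : ℕ → L2Term) (v : ℕ → 𝓜.Dom)
    (V : ℕ → 𝓜.sets) :
    (φ.subst τ).Sat 𝓜 v V ↔ φ.Sat 𝓜 (fun n => (τ n).eval 𝓜 v) V := by
  induction φ generalizing τ v V with
  | allN φ ih => simp only [subst, Sat, ih, L2Term.eval_liftSubst]
  | _ => simp_all [subst, Sat, L2Term.eval_subst]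

theorem IsArithmetical.subst {φ : L2Formula} (h : φ.IsArithmetical) (τ : ℕ → L2Term) :
    (φ.subst τ).IsArithmetical := by
  induction φ generalizing τ <;> simp_all [L2Formula.subst, IsArithmetical]

theorem IsSigma00.subst {φ : L2Formula} (h : φ.IsSigma00) (τ : ℕ → L2Term) :
    (φ.subst τ).IsSigma00 := by
  induction h generalizing τ with
  | eq s t => exact .eq _ _
  | lt s t => exact .lt _ _
  | mem t i => exact .mem _ _
  | neg _ ih => exact .neg (ih _)
  | and _ _ ih₁ ih₂ => exact .and (ih₁ _) (ih₂ _)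
  | ballN t _ ih =>
    have := IsSigma00.ballN (t.subst τ) (ih (L2Term.liftSubst τ))
    simpa only [L2Formula.ballN, imp, L2Formula.subst, L2Term.shift_subst, L2Term.subst,
      L2Term.liftSubst] using this

theorem IsSigma00.isArithmetical {φ : L2Formula} (h : φ.IsSigma00) : φ.IsArithmetical := by
  induction h with
  | eq | lt | mem => trivial
  | neg _ ih => exact ih
  | and _ _ ih₁ ih₂ => exact ⟨ih₁, ih₂⟩
  | ballN t _ ih => exact ⟨trivial, ih⟩

@[simp] theorem sat_imp (𝓜 : L2Structure.{u}) (φ ψ : L2Formula) (v : ℕ → 𝓜.Dom)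
    (V : ℕ → 𝓜.sets) : (imp φ ψ).Sat 𝓜 v V ↔ (φ.Sat 𝓜 v V → ψ.Sat 𝓜 v V) := by
  simp [imp, Sat]

@[simp] theorem sat_exN (𝓜 : L2Structure.{u}) (φ : L2Formula) (v : ℕ → 𝓜.Dom)
    (V : ℕ → 𝓜.sets) : (exN φ).Sat 𝓜 v V ↔ ∃ x, φ.Sat 𝓜 (vcons x v) V := by
  simp [exN, Sat]

@[simp] theorem sat_ballN (𝓜 : L2Structure.{u}) (t : L2Term) (φ : L2Formula) (v : ℕ → 𝓜.Dom)
    (V : ℕ → 𝓜.sets) :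
    (ballN t φ).Sat 𝓜 v V ↔ ∀ x, x < t.eval 𝓜 v → φ.Sat 𝓜 (vcons x v) V := by
  simp [ballN, Sat, L2Term.eval]

/-- A class of formulas with the closure properties of the `Σ⁰₀` formulas. -/
class BoundedClass (Γ : L2Formula → Prop) : Prop where
  eq : ∀ s t, Γ (.eq s t)
  lt : ∀ s t, Γ (.lt s t)
  mem : ∀ t i, Γ (.mem t i)
  neg : ∀ {φ}, Γ φ → Γ (.neg φ)
  and : ∀ {φ ψ}, Γ φ → Γ ψ → Γ (.and φ ψ)
  ballN : ∀ t {φ}, Γ φ → Γ (.ballN t φ)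
  subst : ∀ {φ}, Γ φ → ∀ τ, Γ (φ.subst τ)

instance : BoundedClass IsSigma00 :=
  ⟨.eq, .lt, .mem, .neg, .and, .ballN, .subst⟩

instance : BoundedClass IsArithmetical :=
  ⟨fun _ _ => trivial, fun _ _ => trivial, fun _ _ => trivial, fun h => h, fun h h' => ⟨h, h'⟩,
    fun _ _ h => by simpa [ballN, imp, IsArithmetical] using h, .subst⟩

end L2Formula

/-! ### Semantic expressibility of predicates by formulas -/

section Expressible

variable {ι : Type w} {𝓜 : ι → L2Structure.{u}}

/-- The function `t` of a valuation is the value of a term. -/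
class IsTerm (𝓜 : ι → L2Structure.{u}) (t : ∀ i, (ℕ → (𝓜 i).Dom) → (𝓜 i).Dom) : Prop where
  exists_term : ∃ τ : L2Term, ∀ i v, τ.eval (𝓜 i) v = t i v

/-- The property `P` of a valuation is expressed by a formula in `Γ`. -/
class Expr (Γ : L2Formula → Prop) (V : ∀ i, ℕ → (𝓜 i).sets)
    (P : ∀ i, (ℕ → (𝓜 i).Dom) → Prop) : Prop where
  exists_formula : ∃ φ : L2Formula, Γ φ ∧ ∀ i v, φ.Sat (𝓜 i) v (V i) ↔ P i v

namespace IsTerm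

instance var (n : ℕ) : IsTerm 𝓜 (fun _ v => v n) := ⟨.var n, fun _ _ => rfl⟩

instance zero : IsTerm 𝓜 (fun _ _ => 0) := ⟨.zero, fun _ _ => rfl⟩

instance one : IsTerm 𝓜 (fun _ _ => 1) := ⟨.one, fun _ _ => rfl⟩

variable {s t : ∀ i, (ℕ → (𝓜 i).Dom) → (𝓜 i).Dom}

instance add [hs : IsTerm 𝓜 s] [ht : IsTerm 𝓜 t] : IsTerm 𝓜 (fun i v => s i v + t i v) := by
  obtain ⟨σ, hσ⟩ := hs
  obtain ⟨τ, hτ⟩ := ht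
  exact ⟨.add σ τ, fun i v => by simp [L2Term.eval, hσ, hτ]⟩

instance mul [hs : IsTerm 𝓜 s] [ht : IsTerm 𝓜 t] : IsTerm 𝓜 (fun i v => s i v * t i v) := by
  obtain ⟨σ, hσ⟩ := hs
  obtain ⟨τ, hτ⟩ := ht
  exact ⟨.mul σ τ, fun i v => by simp [L2Term.eval, hσ, hτ]⟩

instance pair [hs : IsTerm 𝓜 s] [ht : IsTerm 𝓜 t] :
    IsTerm 𝓜 (fun i v => L2Structure.pair (s i v) (t i v)) := by
  unfold L2Structure.pair; infer_instance

end IsTerm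

namespace Expr

variable {Γ : L2Formula → Prop} {V : ∀ i, ℕ → (𝓜 i).sets}
  {s t : ∀ i, (ℕ → (𝓜 i).Dom) → (𝓜 i).Dom} {P Q : ∀ i, (ℕ → (𝓜 i).Dom) → Prop}

theorem congr (h : Expr Γ V P) (hPQ : ∀ i v, P i v ↔ Q i v) : Expr Γ V Q := by
  obtain ⟨φ, hφ, h⟩ := h
  exact ⟨φ, hφ, fun i v => (h i v).trans (hPQ i v)⟩

variable [hΓ : L2Formula.BoundedClass Γ]

instance eq [hs : IsTerm 𝓜 s] [ht : IsTerm 𝓜 t] : Expr Γ V (fun i v => s i v = t i v) := by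
  obtain ⟨σ, hσ⟩ := hs
  obtain ⟨τ, hτ⟩ := ht
  exact ⟨.eq σ τ, hΓ.eq _ _, fun i v => by simp [L2Formula.Sat, hσ, hτ]⟩

instance lt [hs : IsTerm 𝓜 s] [ht : IsTerm 𝓜 t] : Expr Γ V (fun i v => s i v < t i v) := by
  obtain ⟨σ, hσ⟩ := hs
  obtain ⟨τ, hτ⟩ := ht
  exact ⟨.lt σ τ, hΓ.lt _ _, fun i v => by simp [L2Formula.Sat, hσ, hτ]⟩

instance mem [hs : IsTerm 𝓜 s] (n : ℕ) :
    Expr Γ V (fun i v => s i v ∈ (V i n : Set (𝓜 i).Dom)) := by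
  obtain ⟨σ, hσ⟩ := hs
  exact ⟨.mem σ n, hΓ.mem _ _, fun i v => by simp [L2Formula.Sat, hσ]⟩

instance not [hP : Expr Γ V P] : Expr Γ V (fun i v => ¬ P i v) := by
  obtain ⟨φ, hφ, h⟩ := hP
  exact ⟨.neg φ, hΓ.neg hφ, fun i v => by simp [L2Formula.Sat, h]⟩

instance and [hP : Expr Γ V P] [hQ : Expr Γ V Q] : Expr Γ V (fun i v => P i v ∧ Q i v) := by
  obtain ⟨φ, hφ, h⟩ := hP
  obtain ⟨ψ, hψ, h'⟩ := hQ
  exact ⟨.and φ ψ, hΓ.and hφ hψ, fun i v => by simp [L2Formula.Sat, h, h']⟩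

instance imp [Expr Γ V P] [Expr Γ V Q] : Expr Γ V (fun i v => P i v → Q i v) :=
  congr (inferInstance : (Expr Γ V (fun i v => ¬ (P i v ∧ ¬ Q i v)))) fun i v => by tauto

instance or [Expr Γ V P] [Expr Γ V Q] : Expr Γ V (fun i v => P i v ∨ Q i v) :=
  congr (inferInstance : (Expr Γ V (fun i v => ¬ (¬ P i v ∧ ¬ Q i v)))) fun i v => by tauto

instance const (p : Prop) : Expr Γ V (fun _ _ => p) := by
  by_cases hp : p
  · exact congr (inferInstance : (Expr Γ V (fun i _ => (0 : (𝓜 i).Dom) = 0))) (by simp [hp])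
  · exact congr (inferInstance : (Expr Γ V (fun i _ => ¬ (0 : (𝓜 i).Dom) = 0))) (by simp [hp])

/-- The hypothesis reads the bound value as variable 0 and the outer valuation as the shift,
matching de Bruijn indices, so instance search can pass under the quantifier. -/
instance ball {P : ∀ i, (𝓜 i).Dom → (ℕ → (𝓜 i).Dom) → Prop} [ht : IsTerm 𝓜 t]
    [hP : Expr Γ V (fun i v => P i (v 0) (fun n => v (n + 1)))] :
    Expr Γ V (fun i v => ∀ x, x < t i v → P i x v) := by
  obtain ⟨φ, hφ, h⟩ := hP
  obtain ⟨τ, hτ⟩ := ht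
  exact ⟨.ballN τ φ, hΓ.ballN _ hφ, fun i v => by simp [h, hτ]⟩

instance bex {P : ∀ i, (𝓜 i).Dom → (ℕ → (𝓜 i).Dom) → Prop} [IsTerm 𝓜 t]
    [Expr Γ V (fun i v => P i (v 0) (fun n => v (n + 1)))] :
    Expr Γ V (fun i v => ∃ x, x < t i v ∧ P i x v) :=
  congr (inferInstance : (Expr Γ V (fun i v => ¬ ∀ x, x < t i v → ¬ P i x v)))
    fun i v => by push Not; rfl

instance all {P : ∀ i, (𝓜 i).Dom → (ℕ → (𝓜 i).Dom) → Prop}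
    [hP : Expr L2Formula.IsArithmetical V (fun i v => P i (v 0) (fun n => v (n + 1)))] :
    Expr L2Formula.IsArithmetical V (fun i v => ∀ x, P i x v) := by
  obtain ⟨φ, hφ, h⟩ := hP
  exact ⟨.allN φ, hφ, fun i v => by simp [L2Formula.Sat, h]⟩

instance ex {P : ∀ i, (𝓜 i).Dom → (ℕ → (𝓜 i).Dom) → Prop}
    [Expr L2Formula.IsArithmetical V (fun i v => P i (v 0) (fun n => v (n + 1)))] :
    Expr L2Formula.IsArithmetical V (fun i v => ∃ x, P i x v) :=
  congr (inferInstance : (Expr L2Formula.IsArithmetical V (fun i v => ¬ ∀ x, ¬ P i x v)))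
    fun i v => by push Not; rfl

theorem comp [hP : Expr Γ V P] (t : ℕ → ∀ i, (ℕ → (𝓜 i).Dom) → (𝓜 i).Dom)
    (ht : ∀ n, IsTerm 𝓜 (t n)) : Expr Γ V (fun i v => P i (fun n => t n i v)) := by
  obtain ⟨φ, hφ, h⟩ := hP
  choose τ hτ using fun n => (ht n).exists_term
  exact ⟨φ.subst τ, hΓ.subst hφ τ, fun i v => by simp [L2Formula.sat_subst, h, hτ]⟩

end Expr

end Expressible

/-! ### Induction for expressible predicates -/

namespace L2Structure

variable {𝓜 : L2Structure.{u}}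

open L2Formula

/-- Expressibility by a `Σ⁰₀` formula in a single structure. -/
abbrev Expr₀ (V : ℕ → 𝓜.sets) (P : (ℕ → 𝓜.Dom) → Prop) : Prop :=
  Expr (ι := Unit) (𝓜 := fun _ => 𝓜) IsSigma00 (fun _ => V) (fun _ => P)

namespace ModelsRCA0

/-- Inside the matrix the existential witness is variable 0 and the induction variable is variable
1. -/
theorem ind₁ (h : 𝓜.ModelsRCA0) (V : ℕ → 𝓜.sets) (v : ℕ → 𝓜.Dom)
    (P : 𝓜.Dom → (ℕ → 𝓜.Dom) → Prop)
    (hP : Expr₀ V (fun v => P (v 0) (fun n => v (n + 1)))) (h0 : ∃ x, P x (vcons 0 v))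
    (hs : ∀ n, (∃ x, P x (vcons n v)) → ∃ x, P x (vcons (n + 1) v)) (n : 𝓜.Dom) :
    ∃ x, P x (vcons n v) := by
  obtain ⟨φ, hφ, hP⟩ := hP
  have key : ∀ n, (exN φ).Sat 𝓜 (vcons n v) V ↔ ∃ x, P x (vcons n v) := fun n => by
    simp [hP ()]
  simpa [key] using h.induction (exN φ) ⟨φ, hφ, rfl⟩ v V (by simpa [key] using h0)
    (by simpa [key] using hs) n

theorem ind₀ (h : 𝓜.ModelsRCA0) (V : ℕ → 𝓜.sets) (v : ℕ → 𝓜.Dom)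
    (P : (ℕ → 𝓜.Dom) → Prop)
    [hP : Expr₀ V P] (h0 : P (vcons 0 v))
    (hs : ∀ n, P (vcons n v) → P (vcons (n + 1) v)) (n : 𝓜.Dom) : P (vcons n v) := by
  simpa using h.ind₁ V v (fun _ v => P v) (hP.comp (fun n _ v => v (n + 1)) inferInstance)
    (by simpa using h0) (by simpa using hs) n

end ModelsRCA0

end L2Structure

/-! ## Arithmetic in models of `RCA₀` -/

namespace L2Structure

variable {𝓜 : L2Structure.{u}} [hM : Fact 𝓜.ModelsRCA0]

namespace Arith

/-- Induction for `Σ⁰₀` properties without set parameters. -/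
theorem ind (v : ℕ → 𝓜.Dom) (P : (ℕ → 𝓜.Dom) → Prop)
    [∀ V, Expr₀ V P] (h0 : P (vcons 0 v))
    (hs : ∀ n, P (vcons n v) → P (vcons (n + 1) v)) (n : 𝓜.Dom) : P (vcons n v) :=
  hM.out.ind₀ (fun _ => ⟨_, 𝓜.sets_nonempty.choose_spec⟩) v P h0 hs n

theorem add_zero (a : 𝓜.Dom) : a + 0 = a := hM.out.basic.add_zero a

theorem add_succ (a b : 𝓜.Dom) : a + (b + 1) = a + b + 1 := hM.out.basic.add_succ a b

theorem mul_zero (a : 𝓜.Dom) : a * 0 = 0 := hM.out.basic.mul_zero a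

theorem mul_succ (a b : 𝓜.Dom) : a * (b + 1) = a * b + a := hM.out.basic.mul_succ a b

theorem zero_add (a : 𝓜.Dom) : 0 + a = a :=
  ind (fun _ => 0) (fun v => 0 + v 0 = v 0) (add_zero 0)
    (fun n h => by simp only [vcons_zero] at h ⊢; rw [add_succ, h]) a

theorem succ_add (a b : 𝓜.Dom) : a + 1 + b = a + b + 1 :=
  ind (fun _ => a) (fun v => v 1 + 1 + v 0 = v 1 + v 0 + 1) (by simp [add_zero, vcons])
    (fun n h => by simp only [vcons] at h ⊢; rw [add_succ, add_succ, h]) b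

theorem add_comm (a b : 𝓜.Dom) : a + b = b + a :=
  ind (fun _ => a) (fun v => v 1 + v 0 = v 0 + v 1) (by simp [add_zero, zero_add, vcons])
    (fun n h => by simp only [vcons] at h ⊢; rw [add_succ, succ_add, h]) b

theorem add_assoc (a b c : 𝓜.Dom) : a + b + c = a + (b + c) :=
  ind (vcons a fun _ => b) (fun v => v 1 + v 2 + v 0 = v 1 + (v 2 + v 0))
    (by simp [add_zero, vcons])
    (fun n h => by simp only [vcons] at h ⊢; rw [add_succ, add_succ, add_succ, h]) c

theorem zero_mul (a : 𝓜.Dom) : 0 * a = 0 :=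
  ind (fun _ => 0) (fun v => 0 * v 0 = 0) (mul_zero 0)
    (fun n h => by simp only [vcons_zero] at h ⊢; rw [mul_succ, h, add_zero]) a

theorem succ_mul (a b : 𝓜.Dom) : (a + 1) * b = a * b + b :=
  ind (fun _ => a) (fun v => (v 1 + 1) * v 0 = v 1 * v 0 + v 0)
    (by simp [mul_zero, add_zero, vcons])
    (fun n h => by
      simp only [vcons] at h ⊢
      rw [mul_succ, h, mul_succ, add_assoc, add_assoc, ← add_assoc n, ← add_assoc a,
        add_comm n a, add_assoc]) b

theorem mul_comm (a b : 𝓜.Dom) : a * b = b * a :=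
  ind (fun _ => a) (fun v => v 1 * v 0 = v 0 * v 1) (by simp [mul_zero, zero_mul, vcons])
    (fun n h => by simp only [vcons] at h ⊢; rw [mul_succ, succ_mul, h]) b

theorem mul_add (a b c : 𝓜.Dom) : a * (b + c) = a * b + a * c :=
  ind (vcons a fun _ => b) (fun v => v 1 * (v 2 + v 0) = v 1 * v 2 + v 1 * v 0)
    (by simp [add_zero, mul_zero, vcons])
    (fun n h => by simp only [vcons] at h ⊢; rw [add_succ, mul_succ, mul_succ, h, add_assoc]) c

theorem mul_assoc (a b c : 𝓜.Dom) : a * b * c = a * (b * c) :=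
  ind (vcons a fun _ => b) (fun v => v 1 * v 2 * v 0 = v 1 * (v 2 * v 0))
    (by simp [mul_zero, vcons])
    (fun n h => by simp only [vcons] at h ⊢; rw [mul_succ, mul_succ, mul_add, h]) c

theorem mul_one (a : 𝓜.Dom) : a * 1 = a := by
  rw [← zero_add (1 : 𝓜.Dom), mul_succ, mul_zero, zero_add]

theorem add_right_cancel {a b c : 𝓜.Dom} (h : a + c = b + c) : a = b := by
  refine ind (vcons a fun _ => b) (fun v => v 1 + v 0 = v 2 + v 0 → v 1 = v 2) ?_ ?_ c h
  · simp [add_zero, vcons]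
  · intro n ih h
    simp only [vcons, add_succ] at ih h ⊢
    exact ih (hM.out.basic.succ_inj _ _ h)

theorem eq_zero_or_succ (a : 𝓜.Dom) : a = 0 ∨ ∃ b, a = b + 1 := by
  have h := hM.out.ind₁ (fun _ => ⟨_, 𝓜.sets_nonempty.choose_spec⟩) (fun _ => 0)
    (fun x v => v 0 = 0 ∨ v 0 = x + 1) inferInstance ⟨0, .inl rfl⟩
    (fun n _ => ⟨n, .inr rfl⟩) a
  simpa only [vcons_zero, exists_or, exists_const] using h

theorem exists_add (a b : 𝓜.Dom) : ∃ c, a + c = b ∨ b + c = a := by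
  refine hM.out.ind₁ (fun _ => ⟨_, 𝓜.sets_nonempty.choose_spec⟩) (fun _ => b)
    (fun x v => v 0 + x = v 1 ∨ v 1 + x = v 0) inferInstance ⟨b, .inl ?_⟩ ?_ a
  · simp [zero_add, vcons]
  · rintro n ⟨c, h | h⟩ <;> simp only [vcons] at h ⊢
    · obtain rfl | ⟨d, rfl⟩ := eq_zero_or_succ c
      · exact ⟨1, .inr (by rw [← h, add_zero])⟩
      · exact ⟨d, .inl (by rw [succ_add, ← add_succ, h])⟩
    · exact ⟨c + 1, .inr (by rw [add_succ, h])⟩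

/-- The axioms give only a recursion for `<`; tying it to addition is what lets the ordered semiring
structure be derived from the equations for addition and multiplication. -/
theorem lt_iff (a b : 𝓜.Dom) : a < b ↔ ∃ c, b = a + c + 1 := by
  constructor
  · have h := hM.out.ind₁ (fun _ => ⟨_, 𝓜.sets_nonempty.choose_spec⟩) (fun _ => a)
      (fun x v => v 1 < v 0 → v 0 = v 1 + x + 1) inferInstance
      ⟨0, fun h => (hM.out.basic.not_lt_zero _ h).elim⟩ ?_ b
    · simp only [vcons] at h
      exact fun hab => h.imp fun c hc => hc hab
    · rintro n ⟨c, h⟩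
      simp only [vcons] at h ⊢
      by_cases hn : a < n
      · exact ⟨c + 1, fun _ => by rw [add_succ, ← h hn]⟩
      · refine ⟨0, fun h' => ?_⟩
        obtain h' | rfl := (hM.out.basic.lt_succ _ _).1 h'
        · exact (hn h').elim
        · rw [add_zero]
  · rintro ⟨c, rfl⟩
    refine ind (fun _ => a) (fun v => v 1 < v 1 + v 0 + 1) ?_ ?_ c
    · simp only [vcons, add_zero]
      exact (hM.out.basic.lt_succ _ _).2 (.inr rfl)
    · intro n h
      simp only [vcons, add_succ] at h ⊢
      exact (hM.out.basic.lt_succ _ _).2 (.inl h)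

theorem le_iff (a b : 𝓜.Dom) : a ≤ b ↔ ∃ c, b = a + c := by
  change a < b ∨ a = b ↔ _
  rw [lt_iff]
  constructor
  · rintro (⟨c, rfl⟩ | rfl)
    · exact ⟨c + 1, by rw [add_succ]⟩
    · exact ⟨0, by rw [add_zero]⟩
  · rintro ⟨c, rfl⟩
    obtain rfl | ⟨d, rfl⟩ := eq_zero_or_succ c
    · exact .inr (by rw [add_zero])
    · exact .inl ⟨d, by rw [add_succ]⟩

end Arith

open Arith

noncomputable instance : CommSemiring 𝓜.Dom where
  add_assoc := Arith.add_assoc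
  zero_add := Arith.zero_add
  add_zero := Arith.add_zero
  add_comm := Arith.add_comm
  mul_assoc := Arith.mul_assoc
  mul_comm := Arith.mul_comm
  zero_mul := Arith.zero_mul
  mul_zero := Arith.mul_zero
  left_distrib := Arith.mul_add
  right_distrib a b c := by
    rw [Arith.mul_comm, Arith.mul_add, Arith.mul_comm c, Arith.mul_comm c]
  one_mul a := by rw [Arith.mul_comm, Arith.mul_one]
  mul_one := Arith.mul_one
  nsmul := nsmulRec
  npow := npowRec

instance : IsCancelAdd 𝓜.Dom where
  add_left_cancel a b c h := Arith.add_right_cancel (c := a) (by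
    rw [_root_.add_comm b, _root_.add_comm c]; exact h)
  add_right_cancel a b c h := Arith.add_right_cancel h

noncomputable instance : LinearOrder 𝓜.Dom where
  le_refl a := .inr rfl
  le_trans a b c := by
    simp only [le_iff]
    rintro ⟨x, rfl⟩ ⟨y, rfl⟩
    exact ⟨x + y, _root_.add_assoc _ _ _⟩
  lt_iff_le_not_ge a b := by
    simp only [le_iff, lt_iff]
    constructor
    · rintro ⟨c, rfl⟩
      refine ⟨⟨c + 1, _root_.add_assoc _ _ _⟩, ?_⟩
      rintro ⟨d, h⟩
      have : c + d + 1 = 0 := add_left_cancel (a := a) (by rw [_root_.add_zero]; nth_rw 2 [h]; ring)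
      exact hM.out.basic.succ_ne_zero _ this
    · rintro ⟨⟨c, rfl⟩, h⟩
      obtain rfl | ⟨d, rfl⟩ := eq_zero_or_succ c
      · exact (h ⟨0, by simp⟩).elim
      · exact ⟨d, (_root_.add_assoc _ _ _).symm⟩
  le_antisymm a b := by
    simp only [le_iff]
    rintro ⟨x, rfl⟩ ⟨y, h⟩
    obtain rfl | ⟨d, rfl⟩ := eq_zero_or_succ x
    · simp
    · have : d + y + 1 = 0 := add_left_cancel (a := a) (by
        rw [_root_.add_zero]; nth_rw 2 [h]; ring)
      exact (hM.out.basic.succ_ne_zero _ this).elim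
  le_total a b := by
    simp only [le_iff]
    obtain ⟨c, h | h⟩ := exists_add a b
    · exact .inl ⟨c, h.symm⟩
    · exact .inr ⟨c, h.symm⟩
  toDecidableLE := Classical.decRel _

instance : CanonicallyOrderedAdd 𝓜.Dom where
  exists_add_of_le h := (le_iff _ _).1 h
  le_self_add _ b := (le_iff _ _).2 ⟨b, rfl⟩
  le_add_self _ b := (le_iff _ _).2 ⟨b, _root_.add_comm _ _⟩

instance : IsOrderedAddMonoid 𝓜.Dom where
  add_le_add_left a b h c := by
    obtain ⟨d, rfl⟩ := (le_iff _ _).1 h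
    exact (le_iff _ _).2 ⟨d, by ring⟩

instance : IsOrderedCancelAddMonoid 𝓜.Dom where
  le_of_add_le_add_left a b c h := by
    obtain ⟨d, h⟩ := (le_iff _ _).1 h
    exact (le_iff _ _).2 ⟨d, add_left_cancel (a := a) (by rw [h]; ring)⟩

theorem zero_lt_succ (a : 𝓜.Dom) : 0 < a + 1 := (lt_iff _ _).2 ⟨a, by ring⟩

instance : IsStrictOrderedRing 𝓜.Dom where
  zero_le_one := (le_iff _ _).2 ⟨1, by ring⟩
  exists_pair_ne := ⟨0, 1, fun h => hM.out.basic.succ_ne_zero 0 (by rw [_root_.zero_add]; exact h.symm)⟩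
  mul_lt_mul_of_pos_left a ha b c h := by
    obtain ⟨a, rfl⟩ := (lt_iff _ _).1 ha
    obtain ⟨d, rfl⟩ := (lt_iff _ _).1 h
    exact (lt_iff _ _).2 ⟨d * (a + 1) + a, by ring⟩
  mul_lt_mul_of_pos_right a ha b c h := by
    obtain ⟨a, rfl⟩ := (lt_iff _ _).1 ha
    obtain ⟨d, rfl⟩ := (lt_iff _ _).1 h
    exact (lt_iff _ _).2 ⟨d * (a + 1) + a, by ring⟩

theorem lt_succ_iff {a b : 𝓜.Dom} : a < b + 1 ↔ a ≤ b := hM.out.basic.lt_succ a b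

theorem succ_le_iff {a b : 𝓜.Dom} : a + 1 ≤ b ↔ a < b := by
  rw [← lt_succ_iff, add_lt_add_iff_right]

theorem eq_zero_or_eq_succ (a : 𝓜.Dom) : a = 0 ∨ ∃ b, a = b + 1 := Arith.eq_zero_or_succ a

/-- As i ≤ i + j, the code lies between (i + j)² and (i + j + 1)² (the latter excluded), so it
determines the sum i + j, and then i. The step `key` compares the sums without subtraction. -/
theorem pair_inj {a b c d : 𝓜.Dom} : pair a b = pair c d ↔ a = c ∧ b = d := by
  refine ⟨fun h => ?_, fun ⟨h, h'⟩ => by rw [h, h']⟩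
  unfold pair at h
  have key : ∀ a b c d : 𝓜.Dom, (a + b) * (a + b) + a = (c + d) * (c + d) + c →
      c + d ≤ a + b := fun a b c d h => by
    by_contra! hlt
    obtain ⟨e, he⟩ := (lt_iff _ _).1 hlt
    rw [he] at h
    have h2 : b + (a + b) * (1 + e + e) + e * e + e + e + 1 + c = 0 :=
      add_left_cancel (a := (a + b) * (a + b) + a) (by rw [_root_.add_zero]; nth_rw 2 [h]; ring)
    simp at h2
  have hs := le_antisymm (key _ _ _ _ h) (key _ _ _ _ h.symm)
  rw [hs] at h
  obtain rfl := add_left_cancel h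
  exact ⟨rfl, (add_left_cancel hs).symm⟩

end L2Structure

/-! ## Classes of definable predicates -/

namespace L2Structure

section Projections

variable {𝓜 : L2Structure.{u}}

open Classical in
/-- The first component of a code of a pair. -/
noncomputable def fst (c : 𝓜.Dom) : 𝓜.Dom := if h : ∃ a b, c = pair a b then h.choose else 0

open Classical in
/-- The second component of a code of a pair. -/
noncomputable def snd (c : 𝓜.Dom) : 𝓜.Dom :=
  if h : ∃ a b, c = pair a b then h.choose_spec.choose else 0

theorem fst_eq_zero {c : 𝓜.Dom} (h : ¬ ∃ a b, c = pair a b) : fst c = 0 := dif_neg h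

theorem snd_eq_zero {c : 𝓜.Dom} (h : ¬ ∃ a b, c = pair a b) : snd c = 0 := dif_neg h

variable [hM : Fact 𝓜.ModelsRCA0]

@[simp] theorem fst_pair (a b : 𝓜.Dom) : fst (pair a b) = a := by
  have h : ∃ x y, pair a b = pair x y := ⟨a, b, rfl⟩
  rw [fst, dif_pos h]
  exact (pair_inj.1 h.choose_spec.choose_spec).1.symm

@[simp] theorem snd_pair (a b : 𝓜.Dom) : snd (pair a b) = b := by
  have h : ∃ x y, pair a b = pair x y := ⟨a, b, rfl⟩
  rw [snd, dif_pos h]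
  exact (pair_inj.1 h.choose_spec.choose_spec).2.symm

theorem le_mul_self (a : 𝓜.Dom) : a ≤ a * a := by
  obtain rfl | ⟨b, rfl⟩ := eq_zero_or_eq_succ a
  · simp
  · exact (Arith.le_iff _ _).2 ⟨b * b + b, by ring⟩

theorem left_le_pair (a b : 𝓜.Dom) : a ≤ pair a b := le_add_self

theorem right_le_pair (a b : 𝓜.Dom) : b ≤ pair a b :=
  le_add_self.trans ((le_mul_self (a + b)).trans le_self_add)

theorem fst_le (c : 𝓜.Dom) : fst c ≤ c := by
  by_cases h : ∃ a b, c = pair a b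
  · obtain ⟨a, b, rfl⟩ := h
    simpa using left_le_pair a b
  · simp [fst_eq_zero h]

theorem snd_le (c : 𝓜.Dom) : snd c ≤ c := by
  by_cases h : ∃ a b, c = pair a b
  · obtain ⟨a, b, rfl⟩ := h
    simpa using right_le_pair a b
  · simp [snd_eq_zero h]

/-- A description of the projections with bounded quantifiers only, including the default value 0
off the codes of pairs; it makes unpacking a pair a Σ⁰₀ operation. -/
theorem projections_eq_iff (c a b : 𝓜.Dom) : (fst c = a ∧ snd c = b) ↔
    c = pair a b ∨ ((∀ x, x < c + 1 → ∀ y, y < c + 1 → ¬ c = pair x y) ∧ a = 0 ∧ b = 0) := by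
  by_cases h : ∃ x y, c = pair x y
  · obtain ⟨x, y, rfl⟩ := h
    have h' : ¬ ∀ z, z < pair x y + 1 → ∀ w, w < pair x y + 1 → ¬ pair x y = pair z w :=
      fun h => h x (lt_succ_iff.2 (left_le_pair _ _)) y (lt_succ_iff.2 (right_le_pair _ _)) rfl
    rw [fst_pair, snd_pair, pair_inj, or_iff_left fun h => h' h.1]
  · rw [fst_eq_zero h, snd_eq_zero h]
    simp only [not_exists] at h
    simp [h, eq_comm]

end Projections

end L2Structure

open L2Structure

section

variable {ι : Type w} {𝓜 : ι → L2Structure.{u}} [hM : ∀ i, Fact (𝓜 i).ModelsRCA0]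
  {Γ : L2Formula → Prop} {V : ∀ i, ℕ → (𝓜 i).sets} [hΓ : L2Formula.BoundedClass Γ]
  {s t r : ∀ i, (ℕ → (𝓜 i).Dom) → (𝓜 i).Dom}

theorem IsTerm.shift (h : IsTerm 𝓜 r) : IsTerm 𝓜 (fun i v => r i fun n => v (n + 1)) := by
  obtain ⟨τ, h⟩ := h
  exact ⟨τ.subst fun n => .var (n + 1), fun i v => by simp [L2Term.eval_subst, L2Term.eval, h]⟩

instance Expr.projections [hs : IsTerm 𝓜 s] [ht : IsTerm 𝓜 t] [hr : IsTerm 𝓜 r] :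
    Expr Γ V (fun i v => fst (r i v) = s i v ∧ snd (r i v) = t i v) :=
  have := hr.shift
  have := hr.shift.shift
  Expr.congr inferInstance fun i v => (projections_eq_iff (r i v) (s i v) (t i v)).symm

/-- Unpack the pair `r`. -/
theorem Expr.unpack (P : ∀ i, (𝓜 i).Dom → (𝓜 i).Dom → (ℕ → (𝓜 i).Dom) → Prop)
    [hr : IsTerm 𝓜 r] (h : Expr Γ V (fun i v => P i (v 1) (v 0) (fun n => v (n + 2)))) :
    Expr Γ V (fun i v => P i (fst (r i v)) (snd (r i v)) v) := by
  have := hr.shift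
  have := hr.shift.shift
  refine Expr.congr (P := fun i v => ∃ x, x < r i v + 1 ∧ ∃ y, y < r i v + 1 ∧
    (fst (r i v) = x ∧ snd (r i v) = y) ∧ P i x y v) inferInstance fun i v => ?_
  constructor
  · rintro ⟨x, -, y, -, ⟨rfl, rfl⟩, h⟩
    exact h
  · exact fun h => ⟨_, lt_succ_iff.2 (fst_le _), _, lt_succ_iff.2 (snd_le _), ⟨rfl, rfl⟩, h⟩

end

/-- A class of predicates on the number domains of a family of structures with the closure
properties of `Δ⁰₁` definable predicates. Finitely many variables are packed into one by pairing. -/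
structure DefClass {ι : Type w} (𝓜 : ι → L2Structure.{u}) where
  Def : (∀ i, (𝓜 i).Dom → Prop) → Prop
  not : ∀ {P}, Def P → Def fun i c => ¬ P i c
  and : ∀ {P Q}, Def P → Def Q → Def fun i c => P i c ∧ Q i c
  ball : ∀ {P : ∀ i, (𝓜 i).Dom → (𝓜 i).Dom → Prop}, Def (fun i c => P i (fst c) (snd c)) →
    Def fun i c => ∀ x, x < snd c → P i (fst c) x
  eq : Def fun _ c => fst c = snd c
  lt : Def fun _ c => fst c < snd c
  comp : ∀ {P} {t : ∀ i, (𝓜 i).Dom → (𝓜 i).Dom}, Def P → Def (fun i c => snd c = t i (fst c)) →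
    Def fun i c => P i (t i c)
  fn_comp : ∀ {s t : ∀ i, (𝓜 i).Dom → (𝓜 i).Dom}, Def (fun i c => snd c = s i (fst c)) →
    Def (fun i c => snd c = t i (fst c)) → Def fun i c => snd c = s i (t i (fst c))
  fn_pair : ∀ {s t : ∀ i, (𝓜 i).Dom → (𝓜 i).Dom}, Def (fun i c => snd c = s i (fst c)) →
    Def (fun i c => snd c = t i (fst c)) →
    Def fun i c => snd c = pair (s i (fst c)) (t i (fst c))
  fn_id : Def fun _ c => snd c = fst c
  fn_zero : Def fun _ c => snd c = 0
  fn_one : Def fun _ c => snd c = 1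
  fn_add : Def fun _ c => snd c = fst (fst c) + snd (fst c)
  fn_mul : Def fun _ c => snd c = fst (fst c) * snd (fst c)
  fn_fst : Def fun _ c => snd c = fst (fst c)
  fn_snd : Def fun _ c => snd c = snd (fst c)

section

variable {ι : Type w} {𝓜 : ι → L2Structure.{u}} (D : DefClass 𝓜)

class IsDef (P : ∀ i, (𝓜 i).Dom → Prop) : Prop where
  out : D.Def P

class IsFn (t : ∀ i, (𝓜 i).Dom → (𝓜 i).Dom) : Prop where
  out : D.Def fun i c => snd c = t i (fst c)

/-- A definable family of sets. -/
class IsDefSet (A : ∀ i, (𝓜 i).Dom → Set (𝓜 i).Dom) : Prop where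
  out : D.Def fun i c => snd c ∈ A i (fst c)

/-- Closure under unbounded number quantifiers. -/
class DefClass.Arithmetical : Prop where
  ex : ∀ {P : ∀ i, (𝓜 i).Dom → (𝓜 i).Dom → Prop}, D.Def (fun i c => P i (fst c) (snd c)) →
    D.Def fun i c => ∃ x, P i c x

variable {D} {P Q : ∀ i, (𝓜 i).Dom → Prop} {s t : ∀ i, (𝓜 i).Dom → (𝓜 i).Dom}
  {A B : ∀ i, (𝓜 i).Dom → Set (𝓜 i).Dom}

theorem IsDef.congr (h : IsDef D P) (hPQ : ∀ i c, P i c ↔ Q i c) : IsDef D Q := by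
  have : P = Q := by funext i c; exact propext (hPQ i c)
  exact this ▸ h

theorem IsFn.congr (h : IsFn D s) (hst : ∀ i c, s i c = t i c) : IsFn D t := by
  have : s = t := by funext i c; exact hst i c
  exact this ▸ h

theorem IsDef.comp (hP : IsDef D P) (ht : IsFn D t) : IsDef D (fun i c => P i (t i c)) :=
  ⟨D.comp hP.out ht.out⟩

theorem IsFn.comp (hs : IsFn D s) (ht : IsFn D t) : IsFn D (fun i c => s i (t i c)) :=
  ⟨D.fn_comp hs.out ht.out⟩

namespace IsFn

instance id : IsFn D (fun _ c => c) := ⟨D.fn_id⟩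

instance zero : IsFn D (fun _ _ => 0) := ⟨D.fn_zero⟩

instance one : IsFn D (fun _ _ => 1) := ⟨D.fn_one⟩

instance pair [hs : IsFn D s] [ht : IsFn D t] :
    IsFn D (fun i c => L2Structure.pair (s i c) (t i c)) := ⟨D.fn_pair hs.out ht.out⟩

instance fst [hs : IsFn D s] : IsFn D (fun i c => L2Structure.fst (s i c)) :=
  ⟨D.fn_comp D.fn_fst hs.out⟩

instance snd [hs : IsFn D s] : IsFn D (fun i c => L2Structure.snd (s i c)) :=
  ⟨D.fn_comp D.fn_snd hs.out⟩

end IsFn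

theorem IsDef.comp₂ {P : ∀ i, (𝓜 i).Dom → (𝓜 i).Dom → Prop} [hM : ∀ i, Fact (𝓜 i).ModelsRCA0]
    (hP : IsDef D (fun i c => P i (fst c) (snd c))) (hs : IsFn D s) (ht : IsFn D t) :
    IsDef D (fun i c => P i (s i c) (t i c)) :=
  IsDef.congr (hP.comp (inferInstance : IsFn D (fun i c => pair (s i c) (t i c)))) (by simp)

theorem IsFn.comp₂ {f : ∀ i, (𝓜 i).Dom → (𝓜 i).Dom → (𝓜 i).Dom}
    [hM : ∀ i, Fact (𝓜 i).ModelsRCA0]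
    (hf : IsFn D (fun i c => f i (L2Structure.fst c) (L2Structure.snd c))) (hs : IsFn D s) (ht : IsFn D t) :
    IsFn D (fun i c => f i (s i c) (t i c)) :=
  IsFn.congr (hf.comp (inferInstance : IsFn D (fun i c => L2Structure.pair (s i c) (t i c))))
    (by simp)

variable [hM : ∀ i, Fact (𝓜 i).ModelsRCA0]

namespace IsFn

instance add [hs : IsFn D s] [ht : IsFn D t] : IsFn D (fun i c => s i c + t i c) :=
  comp₂ (f := fun _ x y => x + y) ⟨D.fn_add⟩ hs ht

instance mul [hs : IsFn D s] [ht : IsFn D t] : IsFn D (fun i c => s i c * t i c) :=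
  comp₂ (f := fun _ x y => x * y) ⟨D.fn_mul⟩ hs ht

end IsFn

namespace IsDef

instance eq [hs : IsFn D s] [ht : IsFn D t] : IsDef D (fun i c => s i c = t i c) :=
  comp₂ (P := fun _ x y => x = y) ⟨D.eq⟩ hs ht

instance lt [hs : IsFn D s] [ht : IsFn D t] : IsDef D (fun i c => s i c < t i c) :=
  comp₂ (P := fun _ x y => x < y) ⟨D.lt⟩ hs ht

instance not [hP : IsDef D P] : IsDef D (fun i c => ¬ P i c) := ⟨D.not hP.out⟩

instance and [hP : IsDef D P] [hQ : IsDef D Q] : IsDef D (fun i c => P i c ∧ Q i c) :=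
  ⟨D.and hP.out hQ.out⟩

instance or [IsDef D P] [IsDef D Q] : IsDef D (fun i c => P i c ∨ Q i c) :=
  congr (inferInstance : (IsDef D (fun i c => ¬ (¬ P i c ∧ ¬ Q i c)))) fun i v => by tauto

instance imp [IsDef D P] [IsDef D Q] : IsDef D (fun i c => P i c → Q i c) :=
  congr (inferInstance : (IsDef D (fun i c => ¬ (P i c ∧ ¬ Q i c)))) fun i v => by tauto

instance iff [IsDef D P] [IsDef D Q] : IsDef D (fun i c => (P i c ↔ Q i c)) :=
  congr (inferInstance : (IsDef D (fun i c => (P i c → Q i c) ∧ (Q i c → P i c))))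
    fun i v => by tauto

instance le [IsFn D s] [IsFn D t] : IsDef D (fun i c => s i c ≤ t i c) :=
  congr (inferInstance : (IsDef D (fun i c => s i c < t i c ∨ s i c = t i c)))
    fun _ _ => le_iff_lt_or_eq.symm

instance ball {P : ∀ i, (𝓜 i).Dom → (𝓜 i).Dom → Prop} [ht : IsFn D t]
    [hP : IsDef D (fun i c => P i (fst c) (snd c))] :
    IsDef D (fun i c => ∀ x, x < t i c → P i c x) :=
  comp₂ (P := fun i c y => ∀ x, x < y → P i c x) ⟨D.ball hP.out⟩ IsFn.id ht

instance bex {P : ∀ i, (𝓜 i).Dom → (𝓜 i).Dom → Prop} [IsFn D t]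
    [IsDef D (fun i c => P i (fst c) (snd c))] :
    IsDef D (fun i c => ∃ x, x < t i c ∧ P i c x) :=
  congr (inferInstance : (IsDef D (fun i c => ¬ ∀ x, x < t i c → ¬ P i c x)))
    fun _ _ => by push Not; rfl

theorem const_true : IsDef D (fun _ _ => True) :=
  congr (inferInstance : IsDef D fun i _ => (0 : (𝓜 i).Dom) = 0) (by simp)

theorem const_false : IsDef D (fun _ _ => False) :=
  congr (inferInstance : IsDef D fun i _ => ¬ (0 : (𝓜 i).Dom) = 0) (by simp)

instance mem [hA : IsDefSet D A] [ht : IsFn D t] : IsDef D (fun i c => t i c ∈ A i c) :=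
  comp₂ (P := fun i c y => y ∈ A i c) ⟨hA.out⟩ IsFn.id ht

variable [hD : D.Arithmetical]

instance ex {P : ∀ i, (𝓜 i).Dom → (𝓜 i).Dom → Prop}
    [hP : IsDef D (fun i c => P i (fst c) (snd c))] : IsDef D (fun i c => ∃ x, P i c x) :=
  ⟨hD.ex hP.out⟩

instance all {P : ∀ i, (𝓜 i).Dom → (𝓜 i).Dom → Prop}
    [IsDef D (fun i c => P i (fst c) (snd c))] : IsDef D (fun i c => ∀ x, P i c x) :=
  congr (inferInstance : (IsDef D (fun i c => ¬ ∃ x, ¬ P i c x))) fun _ _ => by push Not; rfl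

instance exUnique {P : ∀ i, (𝓜 i).Dom → (𝓜 i).Dom → Prop}
    [IsDef D (fun i c => P i (fst c) (snd c))] : IsDef D (fun i c => ∃! x, P i c x) := by
  have : IsDef D (fun i c => P i (fst (fst c)) (snd c)) :=
    comp₂ (P := P) inferInstance inferInstance inferInstance
  exact congr (inferInstance : (IsDef D (fun i c => ∃ x, P i c x ∧ ∀ y, P i c y → y = x)))
    fun _ _ => Iff.rfl

instance subset [hA : IsDefSet D A] [hB : IsDefSet D B] : IsDef D (fun i c => A i c ⊆ B i c) :=
  have := IsDef.mk hA.out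
  have := IsDef.mk hB.out
  congr (inferInstance : IsDef D (fun i c => ∀ x, x ∈ A i c → x ∈ B i c)) fun _ _ => Iff.rfl

end IsDef

end

open L2Formula

/-! ## Definability by formulas with parameters -/

section

variable {ι : Type w} {𝓜 : ι → L2Structure.{u}}

/-- The predicate `P` is defined by a formula in `Γ` with number parameters `v` and set
parameters `V`. -/
def DefinedBy (Γ : L2Formula → Prop) (v : ∀ i, ℕ → (𝓜 i).Dom) (V : ∀ i, ℕ → (𝓜 i).sets)
    (P : ∀ i, (𝓜 i).Dom → Prop) : Prop :=
  ∃ P' : ∀ i, (ℕ → (𝓜 i).Dom) → Prop, Expr Γ V P' ∧ ∀ i c, P' i (vcons c (v i)) ↔ P i c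

namespace DefinedBy

variable [hM : ∀ i, Fact (𝓜 i).ModelsRCA0] {Γ : L2Formula → Prop} [BoundedClass Γ]
  {v : ∀ i, ℕ → (𝓜 i).Dom} {V : ∀ i, ℕ → (𝓜 i).sets}

theorem not {P : ∀ i, (𝓜 i).Dom → Prop} (hP : DefinedBy Γ v V P) :
    DefinedBy Γ v V fun i c => ¬ P i c := by
  obtain ⟨P', _, h⟩ := hP
  exact ⟨_, (inferInstance : Expr Γ V fun i v => ¬ P' i v), by simp [h]⟩

theorem and {P Q : ∀ i, (𝓜 i).Dom → Prop} (hP : DefinedBy Γ v V P) (hQ : DefinedBy Γ v V Q) :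
    DefinedBy Γ v V fun i c => P i c ∧ Q i c := by
  obtain ⟨P', _, h⟩ := hP
  obtain ⟨Q', _, h'⟩ := hQ
  exact ⟨_, (inferInstance : Expr Γ V fun i v => P' i v ∧ Q' i v), by simp [h, h']⟩

theorem ball {P : ∀ i, (𝓜 i).Dom → (𝓜 i).Dom → Prop}
    (hP : DefinedBy Γ v V fun i c => P i (fst c) (snd c)) :
    DefinedBy Γ v V fun i c => ∀ x, x < snd c → P i (fst c) x := by
  obtain ⟨P', hP', h⟩ := hP
  -- Variables after unpacking and under the quantifier: 0 is the bound x, 1 and 2 are the second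
  -- and first components, 3 is the packed variable, and the parameters start at 4.
  have h1 := hP'.comp (fun n _ v => vcons (pair (v 2) (v 0)) (fun m => v (m + 4)) n)
    (by rintro (_ | n) <;> simp only [vcons] <;> infer_instance)
  have h2 : Expr Γ V _ := Expr.unpack (r := fun _ v => v 0) (fun i a b v => ∀ x, x < b →
    P' i (vcons (pair a x) fun n => v (n + 1)))
    (Expr.ball (P := fun i x v => P' i (vcons (pair (v 1) x) fun n => v (n + 3))) (hP := by
      refine Expr.congr h1 fun i v => ?_
      refine Eq.to_iff (congrArg _ (funext fun n => ?_))
      cases n <;> rfl))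
  refine ⟨_, h2, fun i c => ?_⟩
  simp only [vcons_comp_succ, vcons_zero, h, fst_pair, snd_pair]

theorem of_expr (P : ∀ i, (ℕ → (𝓜 i).Dom) → Prop) [hP : Expr Γ V P] :
    DefinedBy Γ v V fun i c => P i (vcons c (v i)) :=
  ⟨P, hP, fun _ _ => Iff.rfl⟩

/-- Unpack the two components of the variable. -/
theorem unpack (P : ∀ i, (𝓜 i).Dom → (𝓜 i).Dom → (ℕ → (𝓜 i).Dom) → Prop)
    [h : Expr Γ V (fun i v => P i (v 1) (v 0) (fun n => v (n + 2)))] :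
    DefinedBy Γ v V fun i c => P i (fst c) (snd c) (vcons c (v i)) :=
  ⟨_, Expr.unpack (r := fun _ v => v 0) P h, fun _ _ => Iff.rfl⟩

/-- Unpack the variable as `((x, y), z)`. -/
theorem unpack₃ (P : ∀ i, (𝓜 i).Dom → (𝓜 i).Dom → (𝓜 i).Dom → (ℕ → (𝓜 i).Dom) → Prop)
    [h : Expr Γ V (fun i v => P i (v 1) (v 0) (v 2) (fun n => v (n + 4)))] :
    DefinedBy Γ v V fun i c => P i (fst (fst c)) (snd (fst c)) (snd c) (vcons c (v i)) :=
  unpack (fun i a b v => P i (fst a) (snd a) b v)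
    (h := Expr.unpack (r := fun _ v => v 1) (fun i x y v => P i x y (v 0) fun n => v (n + 2)) h)

theorem eq : DefinedBy Γ v V fun _ c => fst c = snd c := unpack fun _ a b _ => a = b

theorem lt : DefinedBy Γ v V fun _ c => fst c < snd c := unpack fun _ a b _ => a < b

theorem fn_id : DefinedBy Γ v V fun _ c => snd c = fst c := unpack fun _ a b _ => b = a

theorem fn_zero : DefinedBy Γ v V fun _ c => snd c = 0 := unpack fun _ _ b _ => b = 0

theorem fn_one : DefinedBy Γ v V fun _ c => snd c = 1 := unpack fun _ _ b _ => b = 1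

theorem fn_add : DefinedBy Γ v V fun _ c => snd c = fst (fst c) + snd (fst c) :=
  unpack₃ fun _ x y z _ => z = x + y

theorem fn_mul : DefinedBy Γ v V fun _ c => snd c = fst (fst c) * snd (fst c) :=
  unpack₃ fun _ x y z _ => z = x * y

theorem fn_fst : DefinedBy Γ v V fun _ c => snd c = fst (fst c) :=
  unpack₃ fun _ x _ z _ => z = x

theorem fn_snd : DefinedBy Γ v V fun _ c => snd c = snd (fst c) :=
  unpack₃ fun _ _ y z _ => z = y

theorem fn_pair {s t : ∀ i, (𝓜 i).Dom → (𝓜 i).Dom}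
    (hs : DefinedBy Γ v V fun i c => snd c = s i (fst c))
    (ht : DefinedBy Γ v V fun i c => snd c = t i (fst c)) :
    DefinedBy Γ v V fun i c => snd c = pair (s i (fst c)) (t i (fst c)) := by
  obtain ⟨S, hS, hs⟩ := hs
  obtain ⟨T, hT, ht⟩ := ht
  have h1 : Expr Γ V fun i v => S i (vcons (pair (v 3) (v 1)) fun m => v (m + 5)) :=
    Expr.congr (hS.comp (fun n _ v => vcons (pair (v 3) (v 1)) (fun m => v (m + 5)) n)
      (by rintro (_ | n) <;> simp only [vcons] <;> infer_instance)) fun i v => Iff.rfl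
  have h2 : Expr Γ V fun i v => T i (vcons (pair (v 3) (v 0)) fun m => v (m + 5)) :=
    Expr.congr (hT.comp (fun n _ v => vcons (pair (v 3) (v 0)) (fun m => v (m + 5)) n)
      (by rintro (_ | n) <;> simp only [vcons] <;> infer_instance)) fun i v => Iff.rfl
  have h3 : Expr Γ V fun i v => ∃ y, y < v 0 + 1 ∧ ∃ z, z < v 0 + 1 ∧
      v 0 = pair y z ∧ S i (vcons (pair (v 1) y) fun n => v (n + 3)) ∧
        T i (vcons (pair (v 1) z) fun n => v (n + 3)) := inferInstance
  have h4 := @unpack ι 𝓜 hM Γ _ v V (fun i a b v => ∃ y, y < b + 1 ∧ ∃ z, z < b + 1 ∧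
      b = pair y z ∧ S i (vcons (pair a y) fun n => v (n + 1)) ∧
        T i (vcons (pair a z) fun n => v (n + 1))) h3
  obtain ⟨P', hP', h⟩ := h4
  refine ⟨P', hP', fun i c => (h i c).trans ?_⟩
  simp only [vcons_comp_succ, hs, ht, fst_pair, snd_pair]
  constructor
  · rintro ⟨y, -, z, -, h, rfl, rfl⟩
    exact h
  · intro h
    exact ⟨_, lt_succ_iff.2 (h ▸ left_le_pair _ _), _, lt_succ_iff.2 (h ▸ right_le_pair _ _), h,
      rfl, rfl⟩

end DefinedBy

/-- The class of predicates defined by arithmetical formulas with parameters `v` and `V`. -/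
def formulaClass [hM : ∀ i, Fact (𝓜 i).ModelsRCA0] (v : ∀ i, ℕ → (𝓜 i).Dom)
    (V : ∀ i, ℕ → (𝓜 i).sets) : DefClass 𝓜 where
  Def := DefinedBy IsArithmetical v V
  not := .not
  and := .and
  ball := .ball
  eq := .eq
  lt := .lt
  -- Composition quantifies over the intermediate value without a bound; this is why the class
  -- consists of arithmetical, not Σ⁰₀, formulas.
  comp := by
    rintro P t ⟨P', hP, hP'⟩ ⟨T, hT, hT'⟩
    have h1 : Expr IsArithmetical V fun i v => P' i (vcons (v 0) fun m => v (m + 2)) :=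
      Expr.congr (hP.comp (fun n _ v => vcons (v 0) (fun m => v (m + 2)) n)
        (by rintro (_ | n) <;> simp only [vcons] <;> infer_instance)) fun i v => Iff.rfl
    have h2 : Expr IsArithmetical V fun i v =>
        T i (vcons (pair (v 1) (v 0)) fun m => v (m + 2)) :=
      Expr.congr (hT.comp (fun n _ v => vcons (pair (v 1) (v 0)) (fun m => v (m + 2)) n)
        (by rintro (_ | n) <;> simp only [vcons] <;> infer_instance)) fun i v => Iff.rfl
    refine ⟨_, (inferInstance : Expr IsArithmetical V fun i v =>
      ∃ y, T i (vcons (pair (v 0) y) fun n => v (n + 1)) ∧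
        P' i (vcons y fun n => v (n + 1))), fun i c => ?_⟩
    simp [hP', hT']
  fn_comp := by
    rintro s t ⟨S, hS, hS'⟩ ⟨T, hT, hT'⟩
    have h1 : Expr IsArithmetical V fun i v =>
        S i (vcons (pair (v 0) (v 1)) fun m => v (m + 4)) :=
      Expr.congr (hS.comp (fun n _ v => vcons (pair (v 0) (v 1)) (fun m => v (m + 4)) n)
        (by rintro (_ | n) <;> simp only [vcons] <;> infer_instance)) fun i v => Iff.rfl
    have h2 : Expr IsArithmetical V fun i v =>
        T i (vcons (pair (v 2) (v 0)) fun m => v (m + 4)) :=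
      Expr.congr (hT.comp (fun n _ v => vcons (pair (v 2) (v 0)) (fun m => v (m + 4)) n)
        (by rintro (_ | n) <;> simp only [vcons] <;> infer_instance)) fun i v => Iff.rfl
    have h3 : Expr IsArithmetical V fun i v =>
      ∃ y, T i (vcons (pair (v 1) y) fun n => v (n + 3)) ∧
        S i (vcons (pair y (v 0)) fun n => v (n + 3)) := inferInstance
    obtain ⟨P', hP', h⟩ := @DefinedBy.unpack ι 𝓜 hM IsArithmetical _ v V (fun i a b v =>
      ∃ y, T i (vcons (pair a y) fun n => v (n + 1)) ∧
        S i (vcons (pair y b) fun n => v (n + 1))) h3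
    refine ⟨P', hP', fun i c => (h i c).trans ?_⟩
    simp [hS', hT']
  fn_pair := .fn_pair
  fn_id := .fn_id
  fn_zero := .fn_zero
  fn_one := .fn_one
  fn_add := .fn_add
  fn_mul := .fn_mul
  fn_fst := .fn_fst
  fn_snd := .fn_snd

variable [hM : ∀ i, Fact (𝓜 i).ModelsRCA0] {v : ∀ i, ℕ → (𝓜 i).Dom} {V : ∀ i, ℕ → (𝓜 i).sets}

instance : (formulaClass v V).Arithmetical where
  ex := by
    rintro P ⟨P', hP, hP'⟩
    have h1 : Expr IsArithmetical V fun i v =>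
        P' i (vcons (pair (v 1) (v 0)) fun m => v (m + 2)) :=
      Expr.congr (hP.comp (fun n _ v => vcons (pair (v 1) (v 0)) (fun m => v (m + 2)) n)
        (by rintro (_ | n) <;> simp only [vcons] <;> infer_instance)) fun i v => Iff.rfl
    refine ⟨_, (inferInstance : Expr IsArithmetical V fun i v =>
      ∃ y, P' i (vcons (pair (v 0) y) fun n => v (n + 1))), fun i c => ?_⟩
    simp [hP']

instance IsFn.formulaClass_param (n : ℕ) : IsFn (formulaClass v V) (fun i _ => v i n) where
  out := by
    obtain ⟨P', hP', h⟩ := DefinedBy.unpack (Γ := IsArithmetical) (v := v) (V := V)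
      fun _ _ b v => b = v (n + 1)
    exact ⟨P', hP', h⟩

instance IsDefSet.formulaClass_param (n : ℕ) :
    IsDefSet (formulaClass v V) (fun i _ => (V i n : Set (𝓜 i).Dom)) where
  out := by
    obtain ⟨P', hP', h⟩ := DefinedBy.unpack (Γ := IsArithmetical) (v := v) (V := V)
      fun i _ b v => b ∈ (V i n : Set (𝓜 i).Dom)
    exact ⟨P', hP', h⟩

theorem IsDef.exists_formula {P : ∀ i, (𝓜 i).Dom → Prop} (h : IsDef (formulaClass v V) P) :
    ∃ φ : L2Formula, φ.IsArithmetical ∧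
      ∀ i c, φ.Sat (𝓜 i) (vcons c (v i)) (V i) ↔ P i c := by
  obtain ⟨P', ⟨φ, hφ, h⟩, h'⟩ := h.out
  exact ⟨φ, hφ, fun i c => (h _ _).trans (h' i c)⟩

end

/-! ## The sets of a model -/

namespace L2Structure

variable {𝓜 : L2Structure.{u}} [hM : Fact 𝓜.ModelsRCA0]

noncomputable def someSet (𝓜 : L2Structure.{u}) : 𝓜.sets := ⟨_, 𝓜.sets_nonempty.choose_spec⟩

/-- With a dummy quantifier in front, a Σ⁰₀ formula is both Σ⁰₁ and Π⁰₁, so Δ⁰₁ comprehension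
applies. -/
theorem mem_sets_of_sigma00 {v : ℕ → 𝓜.Dom} {V : ℕ → 𝓜.sets} {P : 𝓜.Dom → Prop}
    (h : DefinedBy (ι := Unit) (𝓜 := fun _ => 𝓜) IsSigma00 (fun _ => v) (fun _ => V)
      (fun _ => P)) : {c | P c} ∈ 𝓜.sets := by
  obtain ⟨P', hP, h⟩ := h
  have := hP.comp (fun n _ v => v (n + 1)) fun n => IsTerm.var (n + 1)
  obtain ⟨φ, hφ, hP⟩ := this
  have key : ∀ n x, φ.Sat 𝓜 (vcons x (vcons n v)) V ↔ P n := fun n x => by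
    exact (hP () _).trans (h () n)
  obtain ⟨X, hX, hX'⟩ := hM.out.comprehension (exN φ) (allN φ) ⟨φ, hφ, rfl⟩ ⟨φ, hφ, rfl⟩ v V
    (by simp [Sat, key])
  have : {c | P c} = X := by ext c; simp [hX', key]
  rwa [this]

theorem mem_sets_of_delta01 {V : ℕ → 𝓜.sets} {P : 𝓜.Dom → Prop}
    (S T : (ℕ → 𝓜.Dom) → Prop) [hS : Expr₀ V S] [hT : Expr₀ V T] (v : ℕ → 𝓜.Dom)
    (h : ∀ n, P n ↔ ∃ x, S (vcons x (vcons n v)))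
    (h' : ∀ n, P n ↔ ∀ x, T (vcons x (vcons n v))) :
    {c | P c} ∈ 𝓜.sets := by
  obtain ⟨φ, hφ, hS⟩ := hS
  obtain ⟨ψ, hψ, hT⟩ := hT
  obtain ⟨X, hX, hX'⟩ := hM.out.comprehension (exN φ) (allN ψ) ⟨φ, hφ, rfl⟩ ⟨ψ, hψ, rfl⟩ v V
    (fun n => by simp [Sat, hS (), hT (), ← h, ← h'])
  have : {c | P c} = X := by ext c; simp [hX', hS (), h]
  rwa [this]

/-- The predicates on a model which define one of its sets. -/
def setClass (𝓜 : L2Structure.{u}) [hM : Fact 𝓜.ModelsRCA0] :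
    DefClass (ι := Unit) (fun _ => 𝓜) where
  Def P := {c | P () c} ∈ 𝓜.sets
  not {P} h := mem_sets_of_sigma00 (v := fun _ => 0) (V := fun _ => ⟨_, h⟩)
    (P := fun c => ¬ P () c) (.not (.of_expr (P := fun _ v => v 0 ∈ {c | P () c})
      (hP := Expr.mem (V := fun _ _ => ⟨_, h⟩) 0)))
  and {P Q} h h' := mem_sets_of_sigma00 (v := fun _ => 0) (V := vcons ⟨_, h⟩ fun _ => ⟨_, h'⟩)
    (P := fun c => P () c ∧ Q () c)
    (.and (.of_expr (P := fun _ v => v 0 ∈ {c | P () c})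
        (hP := Expr.mem (V := fun _ => vcons ⟨_, h⟩ fun _ => ⟨_, h'⟩) 0))
      (.of_expr (P := fun _ v => v 0 ∈ {c | Q () c})
        (hP := Expr.mem (V := fun _ => vcons ⟨_, h⟩ fun _ => ⟨_, h'⟩) 1)))
  ball {P} h := mem_sets_of_sigma00 (v := fun _ => 0) (V := fun _ => ⟨_, h⟩)
    (P := fun c => ∀ x, x < snd c → P () (fst c) x) (.ball (P := P)
      (.of_expr (P := fun _ v => v 0 ∈ {c | P () (fst c) (snd c)})
        (hP := Expr.mem (V := fun _ _ => ⟨_, h⟩) 0)))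
  eq := mem_sets_of_sigma00 (v := fun _ => 0) (V := fun _ => 𝓜.someSet) .eq
  lt := mem_sets_of_sigma00 (v := fun _ => 0) (V := fun _ => 𝓜.someSet) .lt
  -- Since t is total with its graph in the model, P(t(c)) holds iff some value of t at c satisfies
  -- P, iff every value does: a Δ⁰₁ definition. The same device is used for `fn_comp`.
  comp {P t} h h' := by
    let V : ℕ → 𝓜.sets := vcons ⟨_, h⟩ fun _ => ⟨_, h'⟩
    have i1 : Expr₀ V (fun v => v 0 ∈ {c | P () c}) := Expr.mem (V := fun _ => V) 0
    have i2 : Expr₀ V (fun v => pair (v 1) (v 0) ∈ {c | snd c = t () (fst c)}) :=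
      Expr.mem (V := fun _ => V) 1
    refine mem_sets_of_delta01 (V := V) (P := fun c => P () (t () c))
      (fun v => pair (v 1) (v 0) ∈ {c | snd c = t () (fst c)} ∧ v 0 ∈ {c | P () c})
      (fun v => pair (v 1) (v 0) ∈ {c | snd c = t () (fst c)} → v 0 ∈ {c | P () c})
      (fun _ => 0) ?_ ?_ <;> simp [vcons]
  fn_comp {s t} h h' := by
    let V : ℕ → 𝓜.sets := vcons ⟨_, h⟩ fun _ => ⟨_, h'⟩
    have i1 : Expr₀ V (fun v => pair (v 2) (v 0) ∈ {c | snd c = s () (fst c)}) :=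
      Expr.mem (V := fun _ => V) 0
    have i2 : Expr₀ V (fun v => pair (v 1) (v 2) ∈ {c | snd c = t () (fst c)}) :=
      Expr.mem (V := fun _ => V) 1
    have e1 : Expr₀ V _ := Expr.unpack (r := fun _ v => v 1)
      (fun _ a b v => pair a (v 0) ∈ {c | snd c = t () (fst c)} ∧
        pair (v 0) b ∈ {c | snd c = s () (fst c)}) inferInstance
    have e2 : Expr₀ V _ := Expr.unpack (r := fun _ v => v 1)
      (fun _ a b v => pair a (v 0) ∈ {c | snd c = t () (fst c)} →
        pair (v 0) b ∈ {c | snd c = s () (fst c)}) inferInstance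
    refine mem_sets_of_delta01 (V := V) (P := fun c => snd c = s () (t () (fst c))) _ _
      (hS := e1) (hT := e2) (fun _ => 0) ?_ ?_ <;> simp [vcons]
  fn_pair {s t} h h' := mem_sets_of_sigma00 (v := fun _ => 0)
    (V := vcons ⟨_, h⟩ fun _ => ⟨_, h'⟩)
    (P := fun c => snd c = pair (s () (fst c)) (t () (fst c)))
    (.fn_pair (s := s) (t := t) (.of_expr (P := fun _ v => v 0 ∈ {c | snd c = s () (fst c)})
        (hP := Expr.mem (V := fun _ => vcons ⟨_, h⟩ fun _ => ⟨_, h'⟩) 0))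
      (.of_expr (P := fun _ v => v 0 ∈ {c | snd c = t () (fst c)})
        (hP := Expr.mem (V := fun _ => vcons ⟨_, h⟩ fun _ => ⟨_, h'⟩) 1)))
  fn_id := mem_sets_of_sigma00 (v := fun _ => 0) (V := fun _ => 𝓜.someSet) .fn_id
  fn_zero := mem_sets_of_sigma00 (v := fun _ => 0) (V := fun _ => 𝓜.someSet) .fn_zero
  fn_one := mem_sets_of_sigma00 (v := fun _ => 0) (V := fun _ => 𝓜.someSet) .fn_one
  fn_add := mem_sets_of_sigma00 (v := fun _ => 0) (V := fun _ => 𝓜.someSet) .fn_add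
  fn_mul := mem_sets_of_sigma00 (v := fun _ => 0) (V := fun _ => 𝓜.someSet) .fn_mul
  fn_fst := mem_sets_of_sigma00 (v := fun _ => 0) (V := fun _ => 𝓜.someSet) .fn_fst
  fn_snd := mem_sets_of_sigma00 (v := fun _ => 0) (V := fun _ => 𝓜.someSet) .fn_snd

instance IsFn.setClass_const (a : 𝓜.Dom) : IsFn 𝓜.setClass (fun _ _ => a) where
  out := by
    have := DefinedBy.unpack (ι := Unit) (𝓜 := fun _ => 𝓜) (Γ := IsSigma00) (v := fun _ _ => a)
      (V := fun _ _ => 𝓜.someSet) (fun _ _ b v => b = v 1)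
    exact mem_sets_of_sigma00 this

instance IsDef.setClass_const (p : Prop) : IsDef 𝓜.setClass (fun _ _ => p) := by
  by_cases hp : p
  · simpa [hp] using IsDef.const_true (D := 𝓜.setClass)
  · simpa [hp] using IsDef.const_false (D := 𝓜.setClass)

theorem isDefSet_of_mem {A : Set 𝓜.Dom} (hA : A ∈ 𝓜.sets) :
    IsDefSet 𝓜.setClass (fun _ _ => A) :=
  ⟨𝓜.setClass.comp (P := fun _ c => c ∈ A) (t := fun _ c => snd c) hA (IsFn.snd (hs := IsFn.id)).out⟩

/-- Comprehension for definable predicates. -/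
theorem mem_sets (P : 𝓜.Dom → Prop) [h : IsDef 𝓜.setClass (fun _ => P)] : {c | P c} ∈ 𝓜.sets :=
  h.out

end L2Structure

/-! ## Closure properties of arithmetical classes, and models of `ACA₀` -/

section

variable {ι : Type w} {𝓜 : ι → L2Structure.{u}} {D : DefClass 𝓜}
  {s t : ∀ i, (𝓜 i).Dom → (𝓜 i).Dom} {A : ∀ i, (𝓜 i).Dom → Set (𝓜 i).Dom}
  {P : ∀ i, (𝓜 i).Dom → (𝓜 i).Dom → Prop}

/-- The pattern unifies with almost anything, hence the low priority: instances for concrete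
operations are tried first. -/
instance (priority := low) IsFn.comp_inst [hs : IsFn D s] [ht : IsFn D t] :
    IsFn D (fun i c => s i (t i c)) := hs.comp ht

variable [hM : ∀ i, Fact (𝓜 i).ModelsRCA0]

instance (priority := low) IsDefSet.comp_inst [hA : IsDefSet D A] [ht : IsFn D t] :
    IsDefSet D (fun i c => A i (t i c)) where
  out := (IsDef.comp₂ (P := fun i x y => y ∈ A i x) ⟨hA.out⟩
    (inferInstance : IsFn D fun i c => t i (fst c)) IsFn.snd).out

instance IsDefSet.setOf [hP : IsDef D (fun i c => P i (fst c) (snd c))] :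
    IsDefSet D (fun i c => {x | P i c x}) := ⟨hP.out⟩

instance IsDefSet.univ : IsDefSet D (fun _ _ => Set.univ) := ⟨IsDef.const_true.out⟩

instance IsDefSet.sec [hA : IsDefSet D A] [hs : IsFn D s] :
    IsDefSet D (fun i c => sec (A i c) (s i c)) where
  out := (inferInstance : IsDef D fun i c =>
    pair (s i (fst c)) (snd c) ∈ A i (fst c)).out

theorem IsFn.eval {δ : ∀ i, (𝓜 i).Dom → ℕ → (𝓜 i).Dom} (t : L2Term)
    (hδ : ∀ n, IsFn D fun i c => δ i c n) : IsFn D fun i c => t.eval (𝓜 i) (δ i c) := by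
  induction t with
  | var n => exact hδ n
  | zero => exact IsFn.zero
  | one => exact IsFn.one
  | add s t _ _ => simp only [L2Term.eval]; infer_instance
  | mul s t _ _ => simp only [L2Term.eval]; infer_instance

/-- Satisfaction of an arithmetical formula is definable. -/
theorem IsDef.sat [hD : D.Arithmetical] {φ : L2Formula} (hφ : φ.IsArithmetical)
    {V : ∀ i, ℕ → (𝓜 i).sets} (hV : ∀ n, IsDefSet D fun i _ => (V i n : Set (𝓜 i).Dom))
    {δ : ∀ i, (𝓜 i).Dom → ℕ → (𝓜 i).Dom} (hδ : ∀ n, IsFn D fun i c => δ i c n) :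
    IsDef D fun i c => φ.Sat (𝓜 i) (δ i c) (V i) := by
  induction φ generalizing δ with
  | eq s t =>
    have := IsFn.eval s hδ
    have := IsFn.eval t hδ
    simp only [Sat]; infer_instance
  | lt s t =>
    have := IsFn.eval s hδ
    have := IsFn.eval t hδ
    simp only [Sat]; infer_instance
  | mem t n => have := IsFn.eval t hδ; simp only [Sat]; infer_instance
  | neg φ ih => have := ih hφ hδ; simp only [Sat]; infer_instance
  | and φ ψ ih₁ ih₂ =>
    have := ih₁ hφ.1 hδ
    have := ih₂ hφ.2 hδ
    simp only [Sat]; infer_instance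
  | allN φ ih =>
    simp only [Sat]
    have := ih (δ := fun i c => vcons (snd c) (δ i (fst c))) hφ (by
      rintro (_ | n)
      · exact (inferInstance : IsFn D fun _ c => snd c)
      · exact (hδ n).comp (IsFn.fst (hs := IsFn.id)))
    exact IsDef.all (hD := hD)
  | allS φ => exact hφ.elim

end

namespace L2Structure

variable {𝓜 : L2Structure.{u}}

theorem ModelsACA0.modelsRCA0 (h : 𝓜.ModelsACA0) : 𝓜.ModelsRCA0 where
  basic := h.basic
  induction := by
    rintro φ ⟨θ, hθ, rfl⟩ v V h0 hs n
    obtain ⟨X, hX, hX'⟩ := h.comprehension (exN θ) hθ.isArithmetical v V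
    exact (hX' n).1 (h.induction X hX ((hX' 0).2 h0) (fun n hn => (hX' _).2 (hs n ((hX' n).1 hn))) n)
  comprehension := by
    rintro φ ψ ⟨θ, hθ, rfl⟩ - v V -
    exact h.comprehension (exN θ) hθ.isArithmetical v V

section

variable [hM : Fact 𝓜.ModelsRCA0]

instance ModelsACA0.arithmetical [h : Fact 𝓜.ModelsACA0] : 𝓜.setClass.Arithmetical where
  ex {P} hP := by
    -- The term spells out `pair c x`, with c as variable 1 and x as variable 0.
    obtain ⟨X, hX, hX'⟩ := h.out.comprehension (exN (mem (.add (.mul (.add (.var 1) (.var 0))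
      (.add (.var 1) (.var 0))) (.var 1)) 0)) trivial (fun _ => 0) (fun _ => ⟨_, hP⟩)
    have : {c | ∃ x, P () c x} = X := by
      ext c
      rw [hX', sat_exN]
      refine exists_congr fun x => ?_
      change _ ↔ P () (fst (pair c x)) (snd (pair c x))
      simp
    change {c | ∃ x, P () c x} ∈ 𝓜.sets
    rwa [this]

/-- For the reversals it is enough to produce projections of sets: closure under one number
quantifier can be iterated along the structure of a formula. -/
theorem arithmetical_of_projection
    (h : ∀ A ∈ 𝓜.sets, {n | ∃ x, pair n x ∈ A} ∈ 𝓜.sets) : 𝓜.setClass.Arithmetical where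
  ex {P} hP := by
    have h := h _ hP
    simp only [Set.mem_ofPred_eq, fst_pair, snd_pair] at h
    exact h

/-- Comprehension is `IsDef.sat` for `setClass`; set induction is Σ⁰₁ induction with a dummy
quantifier. -/
theorem modelsACA0 [𝓜.setClass.Arithmetical] : 𝓜.ModelsACA0 where
  basic := hM.out.basic
  induction X hX h0 hs := by
    have := hM.out.induction (exN (mem (.var 1) 0)) ⟨_, .mem _ _, rfl⟩ (fun _ => 0)
      (fun _ => ⟨X, hX⟩)
    simp only [sat_exN, Sat, L2Term.eval, vcons, exists_const] at this
    exact this h0 hs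
  comprehension φ hφ v V := by
    have hδ : ∀ n, IsFn 𝓜.setClass fun _ c => vcons c v n := by
      rintro (_ | n)
      · exact IsFn.id
      · exact IsFn.setClass_const (v n)
    have := IsDef.sat (D := 𝓜.setClass) hφ (V := fun _ => V)
      (fun n => isDefSet_of_mem (V n).2) (δ := fun _ c => vcons c v) hδ
    exact ⟨_, this.out, fun n => Iff.rfl⟩

end

instance ModelsACA0.factRCA0 [h : Fact 𝓜.ModelsACA0] : Fact 𝓜.ModelsRCA0 := ⟨h.out.modelsRCA0⟩

end L2Structure

/-! ### The least number operator -/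

namespace L2Structure

section Least

variable {𝓜 : L2Structure.{u}}

theorem app_eq {F : Set 𝓜.Dom} {a b : 𝓜.Dom} (h : pair a b ∈ F)
    (h' : ∀ c, pair a c ∈ F → c = b) : app F a = b :=
  h' _ (Classical.epsilon_spec (p := fun b => pair a b ∈ F) ⟨b, h⟩)

open Classical in
/-- The least element of `P`, if there is one. -/
noncomputable def mu (P : 𝓜.Dom → Prop) : 𝓜.Dom :=
  if h : ∃ x, P x ∧ ∀ y, y < x → ¬ P y then h.choose else 0

variable [hM : Fact 𝓜.ModelsRCA0]

/-- An arithmetical description of the graph, default value 0 included; unlike a choice operator,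
`mu` can therefore occur in definable functions. -/
theorem mu_eq_iff (P : 𝓜.Dom → Prop) (x : 𝓜.Dom) : x = mu P ↔
    (P x ∧ ∀ y, y < x → ¬ P y) ∨ ((¬ ∃ x, P x ∧ ∀ y, y < x → ¬ P y) ∧ x = 0) := by
  by_cases h : ∃ x, P x ∧ ∀ y, y < x → ¬ P y
  · rw [mu, dif_pos h]
    constructor
    · rintro rfl
      exact .inl h.choose_spec
    · rintro (hx | hx)
      · rcases lt_trichotomy x h.choose with hlt | he | hlt
        · exact (h.choose_spec.2 _ hlt hx.1).elim
        · exact he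
        · exact (hx.2 _ hlt h.choose_spec.1).elim
      · exact (hx.1 h).elim
  · rw [mu, dif_neg h]
    simp only [h, not_false_eq_true, true_and]
    exact ⟨.inr, fun h' => h'.resolve_left fun h' => h ⟨_, h'⟩⟩

theorem mu_eq {P : 𝓜.Dom → Prop} {x : 𝓜.Dom} (hx : P x) (h : ∀ y, P y → y = x) : mu P = x :=
  ((mu_eq_iff P x).2 (.inl ⟨hx, fun y hy hP => hy.ne (h y hP)⟩)).symm

variable [hA : 𝓜.setClass.Arithmetical]

theorem induction (P : 𝓜.Dom → Prop) [h : IsDef 𝓜.setClass (fun _ => P)] (h0 : P 0)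
    (hs : ∀ n, P n → P (n + 1)) (n : 𝓜.Dom) : P n :=
  modelsACA0.induction {c | P c} h.out h0 hs n

theorem exists_least (P : 𝓜.Dom → Prop) [h : IsDef 𝓜.setClass (fun _ => P)] {x : 𝓜.Dom}
    (hx : P x) : ∃ x, P x ∧ ∀ y, y < x → ¬ P y := by
  by_contra! hn
  have : IsDef 𝓜.setClass fun _ c => P (snd c) := h.comp (IsFn.snd (hs := IsFn.id))
  have : ∀ n, ∀ y, y < n → ¬ P y := by
    apply induction
    · exact fun y hy => (hM.out.basic.not_lt_zero _ hy).elim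
    · intro n ih y hy hP
      obtain ⟨z, hz, hz'⟩ := hn y hP
      exact ih z (hz.trans_le (lt_succ_iff.1 hy)) hz'
  exact this (x + 1) x (lt_succ_iff.2 le_rfl) hx

theorem mu_spec (P : 𝓜.Dom → Prop) [h : IsDef 𝓜.setClass (fun _ => P)] {x : 𝓜.Dom}
    (hx : P x) : P (mu P) ∧ ∀ y, P y → mu P ≤ y := by
  have := exists_least P hx
  rw [mu, dif_pos this]
  exact ⟨this.choose_spec.1, fun y hy => not_lt.1 fun hlt => this.choose_spec.2 y hlt hy⟩

end Least

end L2Structure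

/-! ### Definability of sequences, trees, intervals and codes -/

section

variable {ι : Type w} {𝓜 : ι → L2Structure.{u}} {D : DefClass 𝓜} [hD : D.Arithmetical]
  [hM : ∀ i, Fact (𝓜 i).ModelsRCA0] {s t r : ∀ i, (𝓜 i).Dom → (𝓜 i).Dom}
  {A B F : ∀ i, (𝓜 i).Dom → Set (𝓜 i).Dom}

instance IsFn.mu {P : ∀ i, (𝓜 i).Dom → (𝓜 i).Dom → Prop}
    [hP : IsDef D (fun i c => P i (L2Structure.fst c) (L2Structure.snd c))] :
    IsFn D (fun i c => mu (P i c)) where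
  out := by
    have : IsDef D (fun i c => P i (L2Structure.fst (L2Structure.fst c)) (L2Structure.snd c)) :=
      hP.comp₂ (P := P) inferInstance inferInstance
    have : IsDef D (fun i c => P i (L2Structure.fst c) (L2Structure.snd c)) := hP
    have : IsDef D (fun i c => P i (L2Structure.fst (L2Structure.fst c)) (L2Structure.snd (L2Structure.fst c))) :=
      hP.comp₂ (P := P) inferInstance inferInstance
    have : IsDef D (fun i c => P i (L2Structure.fst (L2Structure.fst (L2Structure.fst c)))
        (L2Structure.snd c)) :=
      hP.comp₂ (P := P) inferInstance inferInstance
    exact (IsDef.congr (P := fun i c => (P i (L2Structure.fst c) (L2Structure.snd c) ∧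
      ∀ y, y < L2Structure.snd c → ¬ P i (L2Structure.fst c) y) ∨
      ((¬ ∃ x, P i (L2Structure.fst c) x ∧ ∀ y, y < x → ¬ P i (L2Structure.fst c) y) ∧
        L2Structure.snd c = 0)) inferInstance fun i c => (mu_eq_iff _ _).symm).out

namespace IsDef

instance hasLength [IsFn D s] [IsFn D t] : IsDef D (fun i c => HasLength (s i c) (t i c)) := by
  unfold HasLength; infer_instance

instance isRem [IsFn D s] [IsFn D t] [IsFn D r] :
    IsDef D (fun i c => IsRem (s i c) (t i c) (r i c)) := by
  unfold IsRem; infer_instance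

instance hasEntry [IsFn D s] [IsFn D t] [IsFn D r] :
    IsDef D (fun i c => HasEntry (s i c) (t i c) (r i c)) := by
  unfold HasEntry; infer_instance

instance isInitSeg [IsFn D s] [IsFn D t] : IsDef D (fun i c => IsInitSeg (s i c) (t i c)) := by
  unfold IsInitSeg; infer_instance

instance ltKB [IsFn D s] [IsFn D t] : IsDef D (fun i c => ltKB (s i c) (t i c)) := by
  unfold L2Structure.ltKB; infer_instance

end IsDef

namespace IsDefSet

instance finSeqs : IsDefSet D (fun i _ => (𝓜 i).finSeqs) := by
  unfold L2Structure.finSeqs; infer_instance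

instance plusTree [IsDefSet D A] : IsDefSet D (fun i c => plusTree (A i c)) := by
  unfold L2Structure.plusTree; infer_instance

instance prodSet [IsDefSet D A] [IsDefSet D B] : IsDefSet D (fun i c => prodSet (A i c) (B i c)) := by
  unfold L2Structure.prodSet; infer_instance

instance intervalBasis [IsDefSet D A] :
    IsDefSet D (fun i c => intervalBasis (A i c) L2Structure.ltKB) := by
  unfold L2Structure.intervalBasis; infer_instance

instance ratCodes : IsDefSet D (fun i _ => (𝓜 i).ratCodes) := by
  have : ∀ i, (𝓜 i).ratCodes = {c | ∃ p n d, d ≠ 0 ∧ c = pair (pair p n) d} := fun i => by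
    ext c
    exact ⟨fun ⟨q, h, h'⟩ => ⟨q.p, q.n, q.d, h, h'⟩, fun ⟨p, n, d, h, h'⟩ => ⟨⟨p, n, d⟩, h, h'⟩⟩
  simp only [this]
  unfold Ne
  infer_instance

end IsDefSet

instance IsDef.isFun [IsDefSet D F] [IsDefSet D A] [IsDefSet D B] :
    IsDef D (fun i c => IsFun (F i c) (A i c) (B i c)) := by
  unfold IsFun; infer_instance

end

/-! ## Finite sequences -/

namespace L2Structure

variable {𝓜 : L2Structure.{u}} [hM : Fact 𝓜.ModelsRCA0]

theorem IsRem.unique {a m r r' : 𝓜.Dom} (h : IsRem a m r) (h' : IsRem a m r') : r = r' := by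
  obtain ⟨hr, q, hq⟩ := h
  obtain ⟨hr', q', hq'⟩ := h'
  have key : ∀ {q q' r r' : 𝓜.Dom}, r < m → m * q + r = m * q' + r' → q' ≤ q := by
    intro q q' r r' hr h
    by_contra! hlt
    obtain ⟨e, rfl⟩ := (Arith.lt_iff _ _).1 hlt
    have : r = m + (m * e + r') := add_left_cancel (a := m * q) (h.trans (by ring))
    exact hr.not_ge (this ▸ le_self_add)
  obtain rfl := le_antisymm (key hr' (hq'.symm.trans hq)) (key hr (hq.symm.trans hq'))
  exact add_left_cancel (hq.symm.trans hq')

theorem HasLength.unique {s l l' : 𝓜.Dom} (h : HasLength s l) (h' : HasLength s l') : l = l' := by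
  obtain ⟨a, b, rfl⟩ := h
  obtain ⟨a', b', h'⟩ := h'
  exact (pair_inj.1 h').1

theorem HasEntry.unique {s i v v' : 𝓜.Dom} (h : HasEntry s i v) (h' : HasEntry s i v') :
    v = v' := by
  obtain ⟨l, a, b, rfl, -, h⟩ := h
  obtain ⟨l', a', b', e, -, h'⟩ := h'
  obtain ⟨rfl, rfl⟩ := pair_inj.1 (pair_inj.1 e).2
  exact h.unique h'

theorem HasEntry.lt_length {s i v l : 𝓜.Dom} (h : HasEntry s i v) (hl : HasLength s l) :
    i < l := by
  obtain ⟨l', a, b, rfl, h, -⟩ := h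
  rwa [hl.unique ⟨a, b, rfl⟩]

theorem HasEntry.exists_length {s i v : 𝓜.Dom} (h : HasEntry s i v) :
    ∃ l, HasLength s l ∧ i < l := by
  obtain ⟨l, a, b, rfl, h, -⟩ := h
  exact ⟨l, ⟨a, b, rfl⟩, h⟩

theorem exists_length {σ : 𝓜.Dom} (h : σ ∈ 𝓜.finSeqs) : ∃ l, HasLength σ l :=
  h.imp fun _ h => h.1

variable [hA : 𝓜.setClass.Arithmetical]

theorem exists_isRem (a m : 𝓜.Dom) (hm : 0 < m) : ∃ r, IsRem a m r := by
  refine induction (fun a => ∃ r, IsRem a m r) ⟨0, hm, 0, by ring⟩ ?_ a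
  rintro n ⟨r, hr, q, rfl⟩
  obtain h | h := (succ_le_iff.2 hr).lt_or_eq
  · exact ⟨r + 1, h, q, by ring⟩
  · exact ⟨0, hm, q + 1, by rw [mul_add, mul_one]; nth_rw 3 [← h]; ring⟩

theorem exists_entry {s l i : 𝓜.Dom} (h : HasLength s l) (hi : i < l) : ∃ v, HasEntry s i v := by
  obtain ⟨a, b, rfl⟩ := h
  obtain ⟨r, hr⟩ := exists_isRem a (b * (i + 1) + 1) (zero_lt_succ _)
  exact ⟨r, l, a, b, rfl, hi, hr⟩

/-- Two finite sequences of the same length with the same entries are equal. -/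
theorem finSeqs_ext {σ τ l : 𝓜.Dom} (hσ : σ ∈ 𝓜.finSeqs) (hτ : τ ∈ 𝓜.finSeqs)
    (hσl : HasLength σ l) (hτl : HasLength τ l) (h : ∀ i v, HasEntry σ i v ↔ HasEntry τ i v) :
    σ = τ := by
  obtain ⟨k, hk, hσ⟩ := hσ
  obtain ⟨m, hm, hτ⟩ := hτ
  obtain rfl := hk.unique hσl
  obtain rfl := hm.unique hτl
  rcases lt_trichotomy σ τ with hlt | he | hlt
  · obtain ⟨i, v, h1, h2⟩ := hτ σ hlt hσl
    exact (h2 ((h i v).2 h1)).elim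
  · exact he
  · obtain ⟨i, v, h1, h2⟩ := hσ τ hlt hτl
    exact (h2 ((h i v).1 h1)).elim

/-- Every sequence code is represented by an element of `finSeqs`. -/
theorem exists_finSeq {s l : 𝓜.Dom} (h : HasLength s l) :
    ∃ σ ∈ 𝓜.finSeqs, HasLength σ l ∧ ∀ i v, HasEntry σ i v ↔ HasEntry s i v := by
  obtain ⟨σ, ⟨hσl, hσ⟩, hmin⟩ := exists_least
    (fun σ => HasLength σ l ∧ ∀ i v, HasEntry σ i v ↔ HasEntry s i v)
    ⟨h, fun _ _ => Iff.rfl⟩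
  refine ⟨σ, ⟨l, hσl, fun s' hs' hl' => ?_⟩, hσl, hσ⟩
  by_contra! hn
  refine hmin s' hs' ⟨hl', fun i v => ⟨fun hv => ?_, fun hv => hn i v ((hσ i v).2 hv)⟩⟩
  obtain ⟨w, hw⟩ := exists_entry hσl (hv.lt_length hl')
  obtain rfl := hv.unique (hn i w hw)
  exact (hσ _ _).1 hw

/-- A stand-in for the factorial of N, which is not yet available as a function: multiply by N + 1
at each step. -/
theorem exists_common_multiple (N : 𝓜.Dom) :
    ∃ b, 0 < b ∧ ∀ k, k < N → ∃ c, b = (k + 1) * c := by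
  refine induction (fun N => ∃ b, 0 < b ∧ ∀ k, k < N → ∃ c, b = (k + 1) * c)
    ⟨1, one_pos, fun k hk => (not_lt_zero hk).elim⟩ ?_ N
  rintro N ⟨b, hb, h⟩
  refine ⟨b * (N + 1), mul_pos hb (zero_lt_succ _), fun k hk => ?_⟩
  obtain hk | rfl := (lt_succ_iff.1 hk).lt_or_eq
  · obtain ⟨c, rfl⟩ := h k hk
    exact ⟨c * (N + 1), by ring⟩
  · exact ⟨b, by ring⟩

/-- A Bézout identity without subtraction for the moduli m_i = b(i + 1) + 1 and m_j, where j − i = e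
+ 1 divides b. First, b is a multiple of m_i modulo m_j (`h1`). Next, (j + 1)b ≡ −1 modulo m_j, so
multiplying by (j + 1)·(j + 1)b turns b into a square that is ≡ 1. -/
theorem beta_coprime {b l j e : 𝓜.Dom} (hb : 0 < b) (h : b = (e + 1) * l) (i : 𝓜.Dom)
    (hj : j = i + e + 1) :
    ∃ x y, (b * (i + 1) + 1) * x = (b * (j + 1) + 1) * y + 1 := by
  have hc : 0 < (j + 1) * b := mul_pos (zero_lt_succ _) hb
  obtain ⟨c, hc⟩ := (Arith.lt_iff _ _).1 hc
  rw [zero_add] at hc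
  refine ⟨(j + 1) * l * ((j + 1) * ((j + 1) * b)),
    (i + 1) * l * ((j + 1) * ((j + 1) * b)) + c, ?_⟩
  have h1 : (b * (i + 1) + 1) * ((j + 1) * l) = (b * (j + 1) + 1) * ((i + 1) * l) + b := by
    nth_rw 3 [h]
    rw [hj]; ring
  calc _ = (b * (i + 1) + 1) * ((j + 1) * l) * ((j + 1) * ((j + 1) * b)) := by ring
    _ = (b * (j + 1) + 1) * ((i + 1) * l * ((j + 1) * ((j + 1) * b))) +
      ((j + 1) * b) * ((j + 1) * b) := by rw [h1]; ring
    _ = (b * (j + 1) + 1) * ((i + 1) * l * ((j + 1) * ((j + 1) * b))) +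
      (((j + 1) * b + 1) * c + 1) := by rw [hc]; ring
    _ = _ := by ring

/-- Gödel's lemma on the beta function. -/
theorem exists_beta (f : 𝓜.Dom → 𝓜.Dom) [hf : IsFn 𝓜.setClass fun _ => f] (n : 𝓜.Dom) :
    ∃ a b, ∀ i, i < n → IsRem a (b * (i + 1) + 1) (f i) := by
  obtain ⟨B, hB⟩ : ∃ B, ∀ i, i < n → f i ≤ B := by
    have : IsFn 𝓜.setClass fun _ c => f (snd c) := hf.comp (IsFn.snd (hs := IsFn.id))
    refine induction (fun n => ∃ B, ∀ i, i < n → f i ≤ B)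
      ⟨0, fun k hk => (not_lt_zero hk).elim⟩ ?_ n
    rintro n ⟨B, hB⟩
    refine ⟨B + f n, fun i hi => ?_⟩
    obtain hi | rfl := (lt_succ_iff.1 hi).lt_or_eq
    · exact (hB i hi).trans le_self_add
    · exact le_add_self
  obtain ⟨b₀, hb₀, hdvd₀⟩ := exists_common_multiple n
  -- Divisibility of b makes the moduli pairwise coprime, and its size makes every f i smaller than
  -- its modulus.
  obtain ⟨b, hb, hdvd, hbB⟩ : ∃ b, 0 < b ∧ (∀ k, k < n → ∃ c, b = (k + 1) * c) ∧ B ≤ b := by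
    refine ⟨b₀ * (B + 1), mul_pos hb₀ (zero_lt_succ _), fun k hk => ?_, ?_⟩
    · obtain ⟨c, rfl⟩ := hdvd₀ k hk
      exact ⟨c * (B + 1), by ring⟩
    · obtain ⟨c, rfl⟩ := (Arith.lt_iff _ _).1 hb₀
      exact (Arith.le_iff _ _).2 ⟨c * (B + 1) + 1, by ring⟩
  have hlt : ∀ i, i < n → f i < b * (i + 1) + 1 := fun i hi =>
    lt_succ_iff.2 (((hB i hi).trans hbB).trans
      (le_mul_of_one_le_right (zero_le) le_add_self))
  -- The Chinese remainder theorem by induction on l: M is a common multiple of the first l moduli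
  -- and is invertible modulo each of the remaining ones, while a already has the first l
  -- remainders.
  suffices h : ∀ l, l ≤ n → ∃ a M, (∀ i, i < l → ∃ c, M = (b * (i + 1) + 1) * c) ∧
      (∀ j, j < n → l ≤ j → ∃ x y, M * x = (b * (j + 1) + 1) * y + 1) ∧
      ∀ i, i < l → IsRem a (b * (i + 1) + 1) (f i) by
    obtain ⟨a, M, -, -, h⟩ := h n le_rfl
    exact ⟨a, b, h⟩
  refine induction _ ?_ ?_
  · exact fun _ => ⟨0, 1, fun k hk => (not_lt_zero hk).elim, fun j _ _ => ⟨1, 0, by ring⟩,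
      fun k hk => (not_lt_zero hk).elim⟩
  · intro l ih hl
    have hl' := succ_le_iff.1 hl
    obtain ⟨a, M, hM1, hM2, hMf⟩ := ih hl'.le
    obtain ⟨x, y, hxy⟩ := hM2 l hl' le_rfl
    -- The correction is a multiple of M, so the old remainders survive. Modulo the new modulus M·x
    -- ≡ 1, and the sum becomes f l + (b(l + 1) + 1)·a ≡ f l; here b(l + 1) plays the role of −1.
    refine ⟨a + M * x * (f l + b * (l + 1) * a), M * (b * (l + 1) + 1), ?_, ?_, ?_⟩
    · intro i hi
      obtain hi | rfl := (lt_succ_iff.1 hi).lt_or_eq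
      · obtain ⟨c, hc⟩ := hM1 i hi
        exact ⟨c * (b * (l + 1) + 1), by rw [hc]; ring⟩
      · exact ⟨M, by ring⟩
    · intro j hj hlj
      obtain ⟨x, y, hx⟩ := hM2 j hj (le_self_add.trans hlj)
      obtain ⟨e, he⟩ := (Arith.lt_iff _ _).1 (succ_le_iff.1 hlj)
      obtain ⟨k, hk⟩ := hdvd e (lt_of_le_of_lt (by rw [he, add_assoc, add_comm l, add_assoc]; exact le_self_add) hj)
      obtain ⟨x', y', hx'⟩ := beta_coprime hb hk l he
      refine ⟨x * x', (b * (j + 1) + 1) * y * y' + y + y', ?_⟩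
      calc _ = (M * x) * ((b * (l + 1) + 1) * x') := by ring
        _ = _ := by rw [hx, hx']; ring
    · intro i hi
      obtain hi | rfl := (lt_succ_iff.1 hi).lt_or_eq
      · obtain ⟨hr, q, hq⟩ := hMf i hi
        obtain ⟨c, hc⟩ := hM1 i hi
        refine ⟨hr, q + c * x * (f l + b * (l + 1) * a), ?_⟩
        rw [hc]; nth_rw 1 [hq]; ring
      · refine ⟨hlt i hl', a + y * (f i + b * (i + 1) * a), ?_⟩
        rw [hxy]; ring

/-- Finite sequences with prescribed entries exist. -/
theorem exists_seq (R : 𝓜.Dom → 𝓜.Dom → Prop)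
    [hR : IsDef 𝓜.setClass fun _ c => R (fst c) (snd c)] (n : 𝓜.Dom)
    (h : ∀ i, i < n → ∃ v, R i v) :
    ∃ σ ∈ 𝓜.finSeqs, HasLength σ n ∧ ∀ i, i < n → ∃ v, HasEntry σ i v ∧ R i v := by
  obtain ⟨a, b, hab⟩ := exists_beta (fun i => mu (R i)) n
  obtain ⟨σ, hσ, hl, he⟩ := exists_finSeq (s := pair n (pair a b)) ⟨a, b, rfl⟩
  refine ⟨σ, hσ, hl, fun i hi => ⟨mu (R i), (he _ _).2 ⟨n, a, b, rfl, hi, hab i hi⟩, ?_⟩⟩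
  obtain ⟨v, hv⟩ := h i hi
  have : IsDef 𝓜.setClass fun _ => R i :=
    hR.comp₂ (P := fun _ => R) (IsFn.setClass_const i) IsFn.id
  exact (mu_spec (R i) hv).1

theorem exists_restriction {σ l n : 𝓜.Dom} (hσ : HasLength σ l) (hn : n ≤ l) :
    ∃ τ ∈ 𝓜.finSeqs, HasLength τ n ∧ IsInitSeg τ σ := by
  obtain ⟨τ, hτ, hl, h⟩ := exists_seq (fun i v => HasEntry σ i v) n
    fun i hi => exists_entry hσ (hi.trans_le hn)
  refine ⟨τ, hτ, hl, fun i v hv => ?_⟩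
  obtain ⟨w, hw, hw'⟩ := h i (hv.lt_length hl)
  rwa [hv.unique hw]

theorem exists_extension {σ l : 𝓜.Dom} (hσ : HasLength σ l) (m : 𝓜.Dom) :
    ∃ τ ∈ 𝓜.finSeqs, HasLength τ (l + 1) ∧ IsInitSeg σ τ ∧ HasEntry τ l m := by
  obtain ⟨τ, hτ, hl, h⟩ := exists_seq (fun i v => HasEntry σ i v ∨ (i = l ∧ v = m)) (l + 1)
    fun i hi => by
      obtain hi | rfl := (lt_succ_iff.1 hi).lt_or_eq
      · exact (exists_entry hσ hi).imp fun v hv => .inl hv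
      · exact ⟨m, .inr ⟨rfl, rfl⟩⟩
  refine ⟨τ, hτ, hl, fun i v hv => ?_, ?_⟩
  · have hi := hv.lt_length hσ
    obtain ⟨w, hw, hw' | hw'⟩ := h i (hi.trans (lt_succ_iff.2 le_rfl))
    · rwa [hv.unique hw']
    · exact (hi.ne hw'.1).elim
  · obtain ⟨w, hw, hw' | ⟨-, rfl⟩⟩ := h l (lt_succ_iff.2 le_rfl)
    · exact (lt_irrefl _ (hw'.lt_length hσ)).elim
    · exact hw

theorem IsInitSeg.trans {ρ σ τ : 𝓜.Dom} (h : IsInitSeg ρ σ) (h' : IsInitSeg σ τ) :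
    IsInitSeg ρ τ := fun i v hv => h' i v (h i v hv)

theorem IsInitSeg.le {σ τ k l : 𝓜.Dom} (h : IsInitSeg σ τ) (hσ : HasLength σ k)
    (hτ : HasLength τ l) : k ≤ l := by
  by_contra! hlt
  obtain ⟨v, hv⟩ := exists_entry hσ hlt
  exact lt_irrefl _ ((h _ _ hv).lt_length hτ)

theorem IsInitSeg.entry_iff {σ τ k i : 𝓜.Dom} (h : IsInitSeg σ τ) (hσ : HasLength σ k)
    (hi : i < k) (v : 𝓜.Dom) : HasEntry σ i v ↔ HasEntry τ i v := by
  refine ⟨h i v, fun hv => ?_⟩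
  obtain ⟨w, hw⟩ := exists_entry hσ hi
  rwa [hv.unique (h _ _ hw)]

/-- A sequence whose entries all agree with those of `τ`, or which is at most as long as a
common extension, is an initial segment. -/
theorem IsInitSeg.of_common {σ τ ρ k l : 𝓜.Dom} (h : IsInitSeg σ ρ) (h' : IsInitSeg τ ρ)
    (hσ : HasLength σ k) (hτ : HasLength τ l) (hkl : k ≤ l) : IsInitSeg σ τ := fun i v hv =>
  (h'.entry_iff hτ ((hv.lt_length hσ).trans_le hkl) v).2 (h i v hv)

theorem IsInitSeg.eq_of_length {σ τ l : 𝓜.Dom} (h : IsInitSeg σ τ) (hσ : σ ∈ 𝓜.finSeqs)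
    (hτ : τ ∈ 𝓜.finSeqs) (hσl : HasLength σ l) (hτl : HasLength τ l) : σ = τ :=
  finSeqs_ext hσ hτ hσl hτl fun i v =>
    ⟨h i v, fun hv => (h.entry_iff hσl (hv.lt_length hτl) v).2 hv⟩

/-! ### The Kleene–Brouwer order -/

open Classical in
/-- The `i`-th entry of `σ`, or `⊤` if there is none. -/
noncomputable def entry (σ i : 𝓜.Dom) : WithTop 𝓜.Dom :=
  if h : ∃ v, HasEntry σ i v then (h.choose : WithTop 𝓜.Dom) else ⊤

theorem entry_eq_coe {σ i v : 𝓜.Dom} : entry σ i = v ↔ HasEntry σ i v := by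
  unfold entry
  split_ifs with h
  · rw [WithTop.coe_inj]
    exact ⟨fun h' => h' ▸ h.choose_spec, fun h' => h.choose_spec.unique h'⟩
  · simpa using fun h' => h ⟨v, h'⟩

theorem entry_eq_top {σ i : 𝓜.Dom} : entry σ i = ⊤ ↔ ¬ ∃ v, HasEntry σ i v := by
  unfold entry
  split_ifs with h <;> simp [h]

theorem entry_eq_iff {σ τ i : 𝓜.Dom} :
    entry σ i = entry τ i ↔ ∀ v, HasEntry σ i v ↔ HasEntry τ i v := by
  simp only [← entry_eq_coe]
  refine ⟨fun h v => by rw [h], fun h => ?_⟩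
  cases hσ : entry σ i with
  | coe v => exact ((h v).1 hσ).symm
  | top =>
    cases hτ : entry τ i with
    | coe v => rw [← hσ, (h v).2 hτ]
    | top => rfl

theorem finSeqs_ext_entry {σ τ : 𝓜.Dom} (hσ : σ ∈ 𝓜.finSeqs) (hτ : τ ∈ 𝓜.finSeqs)
    (h : ∀ i, entry σ i = entry τ i) : σ = τ := by
  simp only [entry_eq_iff] at h
  obtain ⟨k, hk⟩ := exists_length hσ
  obtain ⟨l, hl⟩ := exists_length hτ
  have h1 : IsInitSeg σ τ := fun i v => (h i v).1
  have h2 : IsInitSeg τ σ := fun i v => (h i v).2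
  obtain rfl := le_antisymm (h1.le hk hl) (h2.le hl hk)
  exact h1.eq_of_length hσ hτ hk hl

theorem exists_first_difference {σ τ : 𝓜.Dom} (hσ : σ ∈ 𝓜.finSeqs) (hτ : τ ∈ 𝓜.finSeqs)
    (h : σ ≠ τ) : ∃ j, (∀ i, i < j → entry σ i = entry τ i) ∧ entry σ j ≠ entry τ j := by
  obtain ⟨i, hi⟩ : ∃ i, ¬ ∀ v, HasEntry σ i v ↔ HasEntry τ i v := by
    by_contra! hn
    exact h (finSeqs_ext_entry hσ hτ fun i => entry_eq_iff.2 (hn i))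
  obtain ⟨j, hj, hmin⟩ := exists_least (fun i => ¬ ∀ v, HasEntry σ i v ↔ HasEntry τ i v) hi
  exact ⟨j, fun i hi => entry_eq_iff.2 (not_not.1 (hmin i hi)), fun h => hj (entry_eq_iff.1 h)⟩

/-- Reading a missing entry as ⊤ makes a proper extension smaller at the place where the shorter
sequence ends, so the two clauses of the Kleene–Brouwer order merge into one lexicographic
comparison; transitivity and totality follow as usual. -/
theorem ltKB_iff {σ τ : 𝓜.Dom} (hσ : σ ∈ 𝓜.finSeqs) (hτ : τ ∈ 𝓜.finSeqs) :
    ltKB σ τ ↔ ∃ j, (∀ i, i < j → entry σ i = entry τ i) ∧ entry σ j < entry τ j := by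
  obtain ⟨l, hl⟩ := exists_length hτ
  constructor
  · rintro (⟨h, hne⟩ | ⟨j, a, b, ha, hb, hlt, h⟩)
    · have hagree : ∀ i, i < l → entry σ i = entry τ i := fun i hi =>
        entry_eq_iff.2 fun v => (h.entry_iff hl hi v).symm
      obtain ⟨j, hj, hj'⟩ := exists_first_difference hσ hτ hne
      refine ⟨j, hj, ?_⟩
      have : entry τ j = ⊤ := entry_eq_top.2 fun ⟨v, hv⟩ => hj' (hagree j (hv.lt_length hl))
      rw [this] at hj' ⊢
      exact lt_top_iff_ne_top.2 hj'
    · refine ⟨j, fun i hi => entry_eq_iff.2 (h i hi), ?_⟩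
      rw [entry_eq_coe.2 ha, entry_eq_coe.2 hb]
      exact WithTop.coe_lt_coe.2 hlt
  · rintro ⟨j, h, hlt⟩
    cases hσj : entry σ j with
    | top => simp [hσj] at hlt
    | coe a =>
      cases hτj : entry τ j with
      | top =>
        refine .inl ⟨fun i v hv => ?_, fun h => by simp [h, hτj] at hσj⟩
        have : i < j := by
          by_contra! hji
          obtain ⟨w, hw⟩ := exists_entry hl (hji.trans_lt (hv.lt_length hl))
          exact entry_eq_top.1 hτj ⟨w, hw⟩
        exact (entry_eq_iff.1 (h i this) v).2 hv
      | coe b =>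
        rw [hσj, hτj] at hlt
        exact .inr ⟨j, a, b, entry_eq_coe.1 hσj, entry_eq_coe.1 hτj, WithTop.coe_lt_coe.1 hlt,
          fun i hi => entry_eq_iff.1 (h i hi)⟩

theorem ltKB_trans {ρ σ τ : 𝓜.Dom} (hρ : ρ ∈ 𝓜.finSeqs) (hσ : σ ∈ 𝓜.finSeqs)
    (hτ : τ ∈ 𝓜.finSeqs) (h : ltKB ρ σ) (h' : ltKB σ τ) : ltKB ρ τ := by
  obtain ⟨j, h1, h2⟩ := (ltKB_iff hρ hσ).1 h
  obtain ⟨k, h3, h4⟩ := (ltKB_iff hσ hτ).1 h'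
  rw [ltKB_iff hρ hτ]
  rcases lt_trichotomy j k with hlt | rfl | hlt
  · exact ⟨j, fun i hi => (h1 i hi).trans (h3 i (hi.trans hlt)), h3 j hlt ▸ h2⟩
  · exact ⟨j, fun i hi => (h1 i hi).trans (h3 i hi), h2.trans h4⟩
  · exact ⟨k, fun i hi => (h1 i (hi.trans hlt)).trans (h3 i hi), h1 k hlt ▸ h4⟩

theorem ltKB_total {σ τ : 𝓜.Dom} (hσ : σ ∈ 𝓜.finSeqs) (hτ : τ ∈ 𝓜.finSeqs) (h : σ ≠ τ) :
    ltKB σ τ ∨ ltKB τ σ := by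
  obtain ⟨j, h1, h2⟩ := exists_first_difference hσ hτ h
  rw [ltKB_iff hσ hτ, ltKB_iff hτ hσ]
  exact h2.lt_or_gt.imp (fun h => ⟨j, h1, h⟩) fun h => ⟨j, fun i hi => (h1 i hi).symm, h⟩

theorem ltKB_irrefl {σ : 𝓜.Dom} (hσ : σ ∈ 𝓜.finSeqs) : ¬ ltKB σ σ := fun h => by
  obtain ⟨j, -, h⟩ := (ltKB_iff hσ hσ).1 h
  exact lt_irrefl _ h

end L2Structure

/-! ## Branches of trees -/

namespace L2Structure

/-- `τ` is smaller than `σ` at the first difference, where both are defined. -/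
def IsLeftOf {𝓜 : L2Structure.{u}} (τ σ : 𝓜.Dom) : Prop :=
  ∃ j a b, HasEntry τ j a ∧ HasEntry σ j b ∧ a < b ∧
    ∀ i, i < j → ∀ v, HasEntry τ i v ↔ HasEntry σ i v

end L2Structure

instance IsDef.isLeftOf {ι : Type w} {𝓜 : ι → L2Structure.{u}} {D : DefClass 𝓜}
    [hD : D.Arithmetical] [hM : ∀ i, Fact (𝓜 i).ModelsRCA0] {s t : ∀ i, (𝓜 i).Dom → (𝓜 i).Dom}
    [IsFn D s] [IsFn D t] : IsDef D (fun i c => IsLeftOf (s i c) (t i c)) := by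
  unfold IsLeftOf; infer_instance

namespace L2Structure

variable {𝓜 : L2Structure.{u}} [hM : Fact 𝓜.ModelsRCA0] [hA : 𝓜.setClass.Arithmetical]

theorem IsTree.exists_restriction {T : Set 𝓜.Dom} (hT : IsTree T) {σ l n : 𝓜.Dom} (hσ : σ ∈ T)
    (hl : HasLength σ l) (hn : n ≤ l) : ∃ τ ∈ T, HasLength τ n ∧ IsInitSeg τ σ := by
  obtain ⟨τ, hτ, h, h'⟩ := L2Structure.exists_restriction hl hn
  exact ⟨τ, hT.2 σ hσ τ hτ h', h, h'⟩

theorem IsLeftOf.of_initSeg {ρ τ σ k : 𝓜.Dom} (h : IsLeftOf ρ τ) (hτ : IsInitSeg τ σ)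
    (hk : HasLength τ k) : IsLeftOf ρ σ := by
  obtain ⟨j, a, b, ha, hb, hab, h⟩ := h
  exact ⟨j, a, b, ha, hτ _ _ hb, hab, fun i hi v =>
    (h i hi v).trans (hτ.entry_iff hk (hi.trans (hb.lt_length hk)) v)⟩

/-- A nonempty tree without end nodes has a branch, namely the leftmost one. -/
theorem exists_branch_of_pruned {S : Set 𝓜.Dom} (hS : S ∈ 𝓜.sets) (hT : IsTree S) {ρ : 𝓜.Dom}
    (hρ : ρ ∈ S) (hext : ∀ σ ∈ S, ∀ n, HasLength σ n →
      ∃ τ ∈ S, HasLength τ (n + 1) ∧ IsInitSeg σ τ) : ∃ F ∈ 𝓜.sets, IsBranch F S := by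
  have := isDefSet_of_mem hS
  -- The leftmost nodes. There is one of every length (`hex`), and any two agree wherever both have
  -- an entry (`huniq`), so together they form the branch.
  let Good (σ : 𝓜.Dom) : Prop := σ ∈ S ∧ ∀ τ, τ ∈ S → ¬ IsLeftOf τ σ
  have hex : ∀ n, ∃ σ, HasLength σ n ∧ Good σ := by
    refine induction (fun n => ∃ σ, HasLength σ n ∧ σ ∈ S ∧ ∀ τ, τ ∈ S → ¬ IsLeftOf τ σ) ?_ ?_
    · obtain ⟨l, hl⟩ := exists_length (hT.1 hρ)
      obtain ⟨σ, hσ, h0, -⟩ := hT.exists_restriction hρ hl (zero_le)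
      exact ⟨σ, h0, hσ, fun τ _ ⟨j, a, b, _, hb, _⟩ => not_lt_zero (hb.lt_length h0)⟩
    · rintro n ⟨σ, hσn, hσ, hleft⟩
      obtain ⟨τ, hτ, hτn, hστ⟩ := hext σ hσ n hσn
      obtain ⟨m, hm⟩ := exists_entry hτn (lt_succ_iff.2 le_rfl)
      -- Extending a leftmost node by the least possible entry keeps it leftmost.
      obtain ⟨m, ⟨τ, hτ, hτn, hστ, hm⟩, hmin⟩ := exists_least
        (fun m => ∃ τ, τ ∈ S ∧ HasLength τ (n + 1) ∧ IsInitSeg σ τ ∧ HasEntry τ n m)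
        ⟨τ, hτ, hτn, hστ, hm⟩
      refine ⟨τ, hτn, hτ, fun ρ hρ ⟨j, a, b, ha, hb, hab, hj⟩ => ?_⟩
      obtain hjn | rfl := (lt_succ_iff.1 (hb.lt_length hτn)).lt_or_eq
      · exact hleft ρ hρ ⟨j, a, b, ha, (hστ.entry_iff hσn hjn b).2 hb, hab, fun i hi v =>
          (hj i hi v).trans (hστ.entry_iff hσn (hi.trans hjn) v).symm⟩
      · obtain rfl := hb.unique hm
        obtain ⟨l, hl, hjl⟩ := ha.exists_length
        obtain ⟨ρ', hρ', hl', hi⟩ := hT.exists_restriction hρ hl (succ_le_iff.2 hjl)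
        refine hmin a hab ⟨ρ', hρ', hl', fun i v hv => ?_,
          (hi.entry_iff hl' (lt_succ_iff.2 le_rfl) a).2 ha⟩
        have hij := hv.lt_length hσn
        exact (hi.entry_iff hl' (hij.trans (lt_succ_iff.2 le_rfl)) v).2
          ((hj i hij v).2 (hστ i v hv))
  have huniq : ∀ σ τ i v w, Good σ → Good τ → HasEntry σ i v → HasEntry τ i w → v = w := by
    intro σ τ i v w hσ hτ hv hw
    by_contra hne
    obtain ⟨i, ⟨v, w, hv, hw, hne⟩, hmin⟩ := exists_least
      (fun i => ∃ v w, HasEntry σ i v ∧ HasEntry τ i w ∧ ¬ v = w) ⟨v, w, hv, hw, hne⟩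
    have hag : ∀ i', i' < i → ∀ u, HasEntry σ i' u ↔ HasEntry τ i' u := by
      intro i' hi' u
      obtain ⟨l, hl, hil⟩ := hv.exists_length
      obtain ⟨l', hl', hil'⟩ := hw.exists_length
      obtain ⟨v', hv'⟩ := exists_entry hl (hi'.trans hil)
      obtain ⟨w', hw'⟩ := exists_entry hl' (hi'.trans hil')
      obtain rfl : v' = w' := by_contra fun h => hmin i' hi' ⟨v', w', hv', hw', h⟩
      exact ⟨fun h => h.unique hv' ▸ hw', fun h => h.unique hw' ▸ hv'⟩
    rcases lt_or_gt_of_ne hne with h | h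
    · exact hτ.2 σ hσ.1 ⟨i, v, w, hv, hw, h, hag⟩
    · exact hσ.2 τ hτ.1 ⟨i, w, v, hw, hv, h, fun i' hi' u => (hag i' hi' u).symm⟩
  refine ⟨{p | ∃ i v, p = pair i v ∧ ∃ σ, (σ ∈ S ∧ ∀ τ, τ ∈ S → ¬ IsLeftOf τ σ) ∧
    HasEntry σ i v}, mem_sets _, ⟨?_, fun i _ => ?_⟩, fun n => ?_⟩
  · rintro p ⟨i, v, rfl, -⟩
    exact ⟨i, trivial, v, trivial, rfl⟩
  · obtain ⟨σ, hσ, hG⟩ := hex (i + 1)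
    obtain ⟨v, hv⟩ := exists_entry hσ (lt_succ_iff.2 le_rfl)
    refine ⟨v, ⟨i, v, rfl, σ, hG, hv⟩, ?_⟩
    rintro w ⟨i', w', e, τ, hτ, hw⟩
    obtain ⟨rfl, rfl⟩ := pair_inj.1 e
    exact huniq _ _ _ _ _ hτ hG hw hv
  · obtain ⟨σ, hσ, hG⟩ := hex n
    refine ⟨σ, hG.1, hσ, fun i hi v => ⟨fun hv => ⟨i, v, rfl, σ, hG, hv⟩, ?_⟩⟩
    rintro ⟨i', v', e, τ, hτ, hv⟩
    obtain ⟨rfl, rfl⟩ := pair_inj.1 e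
    obtain ⟨w, hw⟩ := exists_entry hσ hi
    rwa [huniq _ _ _ _ _ hτ hG hv hw]

theorem IsBranch.mono {F S T : Set 𝓜.Dom} (h : IsBranch F S) (hST : S ⊆ T) : IsBranch F T :=
  ⟨h.1, fun n => (h.2 n).imp fun _ h => ⟨hST h.1, h.2⟩⟩

theorem isTree_plusTree {T : Set 𝓜.Dom} (hT : IsTree T) : IsTree (plusTree T) := by
  refine ⟨fun σ h => h.1, ?_⟩
  rintro σ ⟨hσ, ρ, hρ, ⟨l, hl, hl'⟩, hle⟩ τ hτ hτσ
  obtain ⟨k, hk⟩ := exists_length hτ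
  obtain ⟨ρ', hρ', hk', hi⟩ := hT.exists_restriction hρ hl' (hτσ.le hk hl)
  exact ⟨hτ, ρ', hρ', ⟨k, hk, hk'⟩, fun n a b ha hb => hle n a b (hi _ _ ha) (hτσ _ _ hb)⟩

/-- A form of König's lemma. -/
theorem exists_branch_of_branch_plusTree {T G : Set 𝓜.Dom} (hTs : T ∈ 𝓜.sets) (hT : IsTree T)
    (hG : G ∈ 𝓜.sets) (h : IsBranch G (plusTree T)) : ∃ F ∈ 𝓜.sets, IsBranch F T := by
  have := isDefSet_of_mem hTs
  have := isDefSet_of_mem hG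
  -- The part of T whose entries are bounded by G; G being a branch of T⁺, it has nodes of every
  -- length.
  let B : Set 𝓜.Dom := {σ | σ ∈ T ∧ ∀ i v w, HasEntry σ i v → pair i w ∈ G → v ≤ w}
  have hBdef : IsDefSet 𝓜.setClass (fun _ _ => B) := by
    change IsDefSet 𝓜.setClass (fun _ _ =>
      {σ | σ ∈ T ∧ ∀ i v w, HasEntry σ i v → pair i w ∈ G → v ≤ w})
    infer_instance
  have hB : IsTree B := ⟨fun σ hσ => hT.1 hσ.1, fun σ hσ τ hτ hi => ⟨hT.2 σ hσ.1 τ hτ hi,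
    fun i v w hv hw => hσ.2 i v w (hi _ _ hv) hw⟩⟩
  have hBex : ∀ n, ∃ σ ∈ B, HasLength σ n := by
    intro n
    obtain ⟨τ, ⟨-, σ, hσ, ⟨l, hl, hl'⟩, hle⟩, hτn, hτ⟩ := h.2 n
    obtain rfl := hl.unique hτn
    exact ⟨σ, ⟨hσ, fun i v w hv hw => hle i v w hv ((hτ i (hv.lt_length hl') w).2 hw)⟩, hl'⟩
  -- Nodes with extensions in B of every greater length: an arithmetical substitute for having
  -- infinitely many extensions.
  let S : Set 𝓜.Dom := {σ | σ ∈ B ∧ ∀ k, HasLength σ k → ∀ n, k ≤ n →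
    ∃ τ, τ ∈ B ∧ HasLength τ n ∧ IsInitSeg σ τ}
  have hS : IsTree S := by
    refine ⟨fun σ hσ => hB.1 hσ.1, fun σ hσ τ hτ hi => ⟨hB.2 σ hσ.1 τ hτ hi, fun k hk n hn => ?_⟩⟩
    obtain ⟨l, hl⟩ := exists_length (hB.1 hσ.1)
    obtain ⟨ρ, hρ, hρn, hσρ⟩ := hσ.2 l hl (max n l) (le_max_right _ _)
    obtain ⟨ρ', hρ', hn', hi'⟩ := hB.exists_restriction hρ hρn (le_max_left n l)
    exact ⟨ρ', hρ', hn', (hi.trans hσρ).of_common hi' hk hn' hn⟩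
  obtain ⟨σ₀, hσ₀, h0⟩ := hBex 0
  have hσ₀S : σ₀ ∈ S := ⟨hσ₀, fun k hk n _ => by
    obtain ⟨τ, hτ, hn⟩ := hBex n
    exact ⟨τ, hτ, hn, fun i v hv => (not_lt_zero (hv.lt_length h0)).elim⟩⟩
  have hstep : ∀ σ ∈ S, ∀ n, HasLength σ n →
      ∃ τ ∈ S, HasLength τ (n + 1) ∧ IsInitSeg σ τ := by
    intro σ hσ k hk
    obtain ⟨w, hw, -⟩ := h.1.2 k trivial
    by_contra! hn
    have hbad : ∀ m, ∃ n, k + 1 ≤ n ∧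
        ¬ ∃ ρ, ρ ∈ B ∧ HasLength ρ n ∧ IsInitSeg σ ρ ∧ HasEntry ρ k m := by
      intro m
      by_contra! hm
      obtain ⟨τ, hτ, hτk, hστ, hτm⟩ := hm (k + 1) le_rfl
      refine hn τ ⟨hτ, fun k' hk' n hkn => ?_⟩ hτk hστ
      obtain rfl := hk'.unique hτk
      obtain ⟨ρ, hρ, hρn, hσρ, hρm⟩ := hm n hkn
      refine ⟨ρ, hρ, hρn, fun i v hv => ?_⟩
      obtain hi | rfl := (lt_succ_iff.1 (hv.lt_length hτk)).lt_or_eq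
      · exact hσρ i v ((hστ.entry_iff hk hi v).2 hv)
      · rwa [hv.unique hτm]
    -- If no child of σ is in S, each possible entry m dies out at some level. By induction on M the
    -- entries below M all die out by a common level; with M beyond the bound given by G this
    -- contradicts σ ∈ S.
    have hbd : ∀ M, ∃ N, ∀ n, N ≤ n → ∀ m, m < M →
        ¬ ∃ ρ, ρ ∈ B ∧ HasLength ρ n ∧ IsInitSeg σ ρ ∧ HasEntry ρ k m := by
      refine induction _ ⟨0, fun _ _ m hm => (not_lt_zero hm).elim⟩ ?_
      rintro M ⟨N, hN⟩
      obtain ⟨n₀, hkn, hn₀⟩ := hbad M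
      refine ⟨max N n₀, fun n hn m hm => ?_⟩
      obtain hm | rfl := (lt_succ_iff.1 hm).lt_or_eq
      · exact hN n ((le_max_left _ _).trans hn) m hm
      · rintro ⟨ρ, hρ, hρn, hσρ, hρm⟩
        obtain ⟨τ, hτ, hτn, hi⟩ := hB.exists_restriction hρ hρn ((le_max_right _ _).trans hn)
        exact hn₀ ⟨τ, hτ, hτn, hσρ.of_common hi hk hτn (le_self_add.trans hkn),
          (hi.entry_iff hτn (succ_le_iff.1 hkn) _).2 hρm⟩
    obtain ⟨N, hN⟩ := hbd (w + 1)
    obtain ⟨ρ, hρ, hρn, hσρ⟩ := hσ.2 k hk (max N (k + 1)) (le_self_add.trans (le_max_right _ _))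
    obtain ⟨m, hm⟩ := exists_entry hρn (succ_le_iff.1 (le_max_right N (k + 1)))
    exact hN _ (le_max_left _ _) m (lt_succ_iff.2 (hρ.2 k m w hm hw)) ⟨ρ, hρ, hρn, hσρ, hm⟩
  obtain ⟨F, hF, hFS⟩ := exists_branch_of_pruned (S := S) (mem_sets _) hS hσ₀S hstep
  exact ⟨F, hF, hFS.mono fun σ hσ => hσ.1.1⟩

/-- If `T` is well founded then the Kleene–Brouwer order of `T⁺` is a well-order. -/
theorem exists_ltKB_least {T Y : Set 𝓜.Dom} (hTs : T ∈ 𝓜.sets) (hT : IsTree T)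
    (hwf : IsWellFounded T) (hYs : Y ∈ 𝓜.sets) (hY : Y ⊆ plusTree T) (hne : Y.Nonempty) :
    ∃ y ∈ Y, ∀ z ∈ Y, z ≠ y → ltKB y z := by
  have := isDefSet_of_mem hTs
  have := isDefSet_of_mem hYs
  by_contra! hmin
  have hT' := isTree_plusTree hT
  -- A branch of this tree is a branch of T⁺, since its nodes are initial segments of elements of Y.
  let S : Set 𝓜.Dom := {σ | σ ∈ 𝓜.finSeqs ∧ (∃ y, y ∈ Y ∧ IsInitSeg σ y) ∧
    ∀ y, y ∈ Y → ¬ IsLeftOf y σ}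
  have hS : IsTree S := by
    refine ⟨fun σ hσ => hσ.1, fun σ hσ τ hτ hi => ⟨hτ, ?_, fun y hy hl => ?_⟩⟩
    · obtain ⟨y, hy, h⟩ := hσ.2.1
      exact ⟨y, hy, hi.trans h⟩
    · obtain ⟨k, hk⟩ := exists_length hτ
      exact hσ.2.2 y hy (hl.of_initSeg hi hk)
  obtain ⟨y₀, hy₀⟩ := hne
  obtain ⟨l₀, hl₀⟩ := exists_length (hY hy₀).1
  obtain ⟨σ₀, hσ₀, h0, hi₀⟩ := L2Structure.exists_restriction hl₀ (zero_le)
  have hσ₀S : σ₀ ∈ S := ⟨hσ₀, ⟨y₀, hy₀, hi₀⟩, fun y _ ⟨j, a, b, _, hb, _⟩ =>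
    not_lt_zero (hb.lt_length h0)⟩
  have hstep : ∀ σ ∈ S, ∀ n, HasLength σ n →
      ∃ τ ∈ S, HasLength τ (n + 1) ∧ IsInitSeg σ τ := by
    intro σ hσ n hn
    -- some element of `Y` properly extends `σ`
    obtain ⟨y, hy, hi, m, hm⟩ : ∃ y ∈ Y, IsInitSeg σ y ∧ ∃ m, HasEntry y n m := by
      by_contra! hno
      have heq : ∀ y ∈ Y, IsInitSeg σ y → y = σ := by
        intro y hy hi
        obtain ⟨k, hk⟩ := exists_length (hY hy).1
        obtain rfl : n = k := (hi.le hn hk).antisymm (not_lt.1 fun hlt => by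
          obtain ⟨m, hm⟩ := exists_entry hk hlt
          exact hno y hy hi m hm)
        exact (hi.eq_of_length hσ.1 (hY hy).1 hn hk).symm
      -- Otherwise σ itself is in Y and is KB-least there: anything of Y below it would properly
      -- extend it or lie to its left.
      obtain ⟨y, hy, hi⟩ := hσ.2.1
      obtain rfl := heq y hy hi
      obtain ⟨z, hz, hne, hyz⟩ := hmin y hy
      rcases ltKB_total (hY hz).1 hσ.1 hne with h | h
      · rcases h with ⟨h, -⟩ | h
        · exact hne (heq z hz h)
        · exact hσ.2.2 z hz h
      · exact hyz h
    obtain ⟨m, ⟨y, hy, hi, hm⟩, hmin'⟩ := exists_least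
      (fun m => ∃ y, y ∈ Y ∧ IsInitSeg σ y ∧ HasEntry y n m) ⟨y, hy, hi, hm⟩
    obtain ⟨l, hl, hnl⟩ := hm.exists_length
    obtain ⟨τ, hτ, hτn, hτy⟩ := L2Structure.exists_restriction hl (succ_le_iff.2 hnl)
    have hστ := hi.of_common hτy hn hτn le_self_add
    refine ⟨τ, ⟨hτ, ⟨y, hy, hτy⟩, fun z hz ⟨j, a, b, ha, hb, hab, hj⟩ => ?_⟩, hτn, hστ⟩
    obtain hjn | rfl := (lt_succ_iff.1 (hb.lt_length hτn)).lt_or_eq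
    · exact hσ.2.2 z hz ⟨j, a, b, ha, (hστ.entry_iff hn hjn b).2 hb, hab, fun i hi v =>
        (hj i hi v).trans (hστ.entry_iff hn (hi.trans hjn) v).symm⟩
    · obtain rfl := (hτy _ _ hb).unique hm
      exact hmin' a hab ⟨z, hz, fun i v hv => (hj i (hv.lt_length hn) v).2 (hστ i v hv), ha⟩
  obtain ⟨F, hF, hFS⟩ := exists_branch_of_pruned (S := S) (mem_sets _) hS hσ₀S hstep
  refine hwf (exists_branch_of_branch_plusTree hTs hT hF (hFS.mono fun σ hσ => ?_))
  obtain ⟨y, hy, hi⟩ := hσ.2.1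
  exact hT'.2 y (hY hy) σ hσ.1 hi

/-! ## The order topology of `KB(T⁺)` -/

theorem mem_sec_intervalBasis {L : Set 𝓜.Dom} {r : 𝓜.Dom → 𝓜.Dom → Prop} {i x : 𝓜.Dom} :
    x ∈ sec (intervalBasis L r) i ↔ ∃ a b, i = pair a b ∧ x ∈ L ∧
      (a = 0 ∨ ∃ a' ∈ L, a = a' + 1 ∧ r a' x) ∧ (b = 0 ∨ ∃ b' ∈ L, b = b' + 1 ∧ r x b') := by
  constructor
  · rintro ⟨a, b, y, e, h⟩
    obtain ⟨rfl, rfl⟩ := pair_inj.1 e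
    exact ⟨a, b, rfl, h⟩
  · rintro ⟨a, b, rfl, h⟩
    exact ⟨a, b, x, rfl, h⟩

/-- Take the larger of the left ends and the smaller of the right ends, with 0 standing for an
infinite end. -/
theorem exists_inter_interval {L : Set 𝓜.Dom} (hL : L ⊆ 𝓜.finSeqs) {x i j : 𝓜.Dom}
    (hi : x ∈ sec (intervalBasis L ltKB) i) (hj : x ∈ sec (intervalBasis L ltKB) j) :
    ∃ k, x ∈ sec (intervalBasis L ltKB) k ∧ ∀ y, y ∈ sec (intervalBasis L ltKB) k →
      y ∈ sec (intervalBasis L ltKB) i ∧ y ∈ sec (intervalBasis L ltKB) j := by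
  rw [mem_sec_intervalBasis] at hi hj
  obtain ⟨a, b, rfl, hx, ha, hb⟩ := hi
  obtain ⟨c, d, rfl, -, hc, hd⟩ := hj
  simp only [mem_sec_intervalBasis]
  have hleft : ∃ e, (e = 0 ∨ ∃ a' ∈ L, e = a' + 1 ∧ ltKB a' x) ∧ ∀ y ∈ L,
      (e = 0 ∨ ∃ a' ∈ L, e = a' + 1 ∧ ltKB a' y) →
      (a = 0 ∨ ∃ a' ∈ L, a = a' + 1 ∧ ltKB a' y) ∧
        (c = 0 ∨ ∃ a' ∈ L, c = a' + 1 ∧ ltKB a' y) := by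
    rcases id ha with rfl | ⟨a', ha', rfl, hax⟩
    · exact ⟨c, hc, fun y _ h => ⟨.inl rfl, h⟩⟩
    rcases id hc with rfl | ⟨c', hc', rfl, hcx⟩
    · exact ⟨_, ha, fun y _ h => ⟨h, .inl rfl⟩⟩
    by_cases hac : a' = c'
    · subst hac
      exact ⟨_, ha, fun y _ h => ⟨h, h⟩⟩
    rcases ltKB_total (hL ha') (hL hc') hac with h | h
    · refine ⟨_, hc, fun y hy hcy => ⟨.inr ⟨a', ha', rfl, ?_⟩, hcy⟩⟩
      obtain h' | ⟨z, hz, e, hzy⟩ := hcy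
      · exact (hM.out.basic.succ_ne_zero _ h').elim
      · obtain rfl := add_right_cancel e
        exact ltKB_trans (hL ha') (hL hz) (hL hy) h hzy
    · refine ⟨_, ha, fun y hy hcy => ⟨hcy, .inr ⟨c', hc', rfl, ?_⟩⟩⟩
      obtain h' | ⟨z, hz, e, hzy⟩ := hcy
      · exact (hM.out.basic.succ_ne_zero _ h').elim
      · obtain rfl := add_right_cancel e
        exact ltKB_trans (hL hc') (hL hz) (hL hy) h hzy
  have hright : ∃ e, (e = 0 ∨ ∃ a' ∈ L, e = a' + 1 ∧ ltKB x a') ∧ ∀ y ∈ L,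
      (e = 0 ∨ ∃ a' ∈ L, e = a' + 1 ∧ ltKB y a') →
      (b = 0 ∨ ∃ a' ∈ L, b = a' + 1 ∧ ltKB y a') ∧
        (d = 0 ∨ ∃ a' ∈ L, d = a' + 1 ∧ ltKB y a') := by
    rcases id hb with rfl | ⟨b', hb', rfl, hbx⟩
    · exact ⟨d, hd, fun y _ h => ⟨.inl rfl, h⟩⟩
    rcases id hd with rfl | ⟨d', hd', rfl, hdx⟩
    · exact ⟨_, hb, fun y _ h => ⟨h, .inl rfl⟩⟩
    by_cases hbd : b' = d'
    · subst hbd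
      exact ⟨_, hb, fun y _ h => ⟨h, h⟩⟩
    rcases ltKB_total (hL hb') (hL hd') hbd with h | h
    · refine ⟨_, hb, fun y hy hcy => ⟨hcy, .inr ⟨d', hd', rfl, ?_⟩⟩⟩
      obtain h' | ⟨z, hz, e, hzy⟩ := hcy
      · exact (hM.out.basic.succ_ne_zero _ h').elim
      · obtain rfl := add_right_cancel e
        exact ltKB_trans (hL hy) (hL hz) (hL hd') hzy h
    · refine ⟨_, hd, fun y hy hcy => ⟨.inr ⟨b', hb', rfl, ?_⟩, hcy⟩⟩
      obtain h' | ⟨z, hz, e, hzy⟩ := hcy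
      · exact (hM.out.basic.succ_ne_zero _ h').elim
      · obtain rfl := add_right_cancel e
        exact ltKB_trans (hL hy) (hL hz) (hL hb') hzy h
  obtain ⟨e, he, he'⟩ := hleft
  obtain ⟨f, hf, hf'⟩ := hright
  refine ⟨pair e f, ⟨e, f, rfl, hx, he, hf⟩, ?_⟩
  rintro y ⟨e', f', h, hy, hey, hfy⟩
  obtain ⟨rfl, rfl⟩ := pair_inj.1 h
  exact ⟨⟨a, b, rfl, hy, (he' y hy hey).1, (hf' y hy hfy).1⟩,
    ⟨c, d, rfl, hy, (he' y hy hey).2, (hf' y hy hfy).2⟩⟩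

/-- The graph of a function witnessing that the sets `sec U i` form a basis. -/
noncomputable def basisFun (X U : Set 𝓜.Dom) : Set 𝓜.Dom :=
  {p | ∃ x i j, p = pair (pair x (pair i j)) (mu fun k => x ∈ sec U k ∧
    ∀ y, y ∈ sec U k → y ∈ sec U i ∧ y ∈ sec U j) ∧ x ∈ X}

theorem isCSCS_intervalBasis {L : Set 𝓜.Dom} (hLs : L ∈ 𝓜.sets) (hL : L ⊆ 𝓜.finSeqs) :
    IsCSCS L (intervalBasis L ltKB) (basisFun L (intervalBasis L ltKB)) := by
  have := isDefSet_of_mem hLs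
  refine ⟨fun i x hx => ?_, ⟨?_, ?_⟩, fun x hx => ⟨pair 0 0, ?_⟩, fun x i j hi hj => ?_⟩
  · obtain ⟨_, _, _, h, _⟩ := mem_sec_intervalBasis.1 hx
    exact h
  · rintro p ⟨x, i, j, rfl, hx⟩
    exact ⟨_, ⟨x, hx, _, ⟨i, trivial, j, trivial, rfl⟩, rfl⟩, _, trivial, rfl⟩
  · rintro p ⟨x, hx, _, ⟨i, -, j, -, rfl⟩, rfl⟩
    refine ⟨_, ⟨x, i, j, rfl, hx⟩, ?_⟩
    rintro b ⟨x', i', j', e, -⟩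
    simp only [pair_inj] at e
    obtain ⟨⟨rfl, rfl, rfl⟩, rfl⟩ := e
    rfl
  · exact mem_sec_intervalBasis.2 ⟨0, 0, rfl, hx, .inl rfl, .inl rfl⟩
  · have hx : x ∈ L := by
      obtain ⟨_, _, _, h, _⟩ := mem_sec_intervalBasis.1 hi
      exact h
    have happ : app (basisFun L (intervalBasis L ltKB)) (pair x (pair i j)) = _ :=
      app_eq ⟨x, i, j, rfl, hx⟩ fun c hc => by
        obtain ⟨x', i', j', e, -⟩ := hc
        simp only [pair_inj] at e
        obtain ⟨⟨rfl, rfl, rfl⟩, rfl⟩ := e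
        rfl
    rw [happ]
    obtain ⟨k, hk⟩ := exists_inter_interval hL hi hj
    have := (mu_spec (fun k => x ∈ sec (intervalBasis L ltKB) k ∧
      ∀ y, y ∈ sec (intervalBasis L ltKB) k →
        y ∈ sec (intervalBasis L ltKB) i ∧ y ∈ sec (intervalBasis L ltKB) j) hk).1
    exact ⟨this.1, fun y hy => this.2 y hy⟩

/-- The KB-least point y of Y is isolated by (−∞, z), with z the immediate successor of y in T⁺, or
by the whole line if y is the greatest point of T⁺. -/
theorem isScattered_of_isWellFounded {T : Set 𝓜.Dom} (hTs : T ∈ 𝓜.sets) (hT : IsTree T)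
    (hwf : IsWellFounded T) :
    IsScattered (plusTree T) (intervalBasis (plusTree T) ltKB) := by
  have := isDefSet_of_mem hTs
  intro Y hYs hY hne
  obtain ⟨y, hy, hmin⟩ := exists_ltKB_least hTs hT hwf hYs hY hne
  refine ⟨y, hy, ?_⟩
  have hyT := hY hy
  by_cases hZ : ∃ z ∈ plusTree T, ltKB y z
  · obtain ⟨z, ⟨hz, hyz⟩, hzmin⟩ := exists_ltKB_least hTs hT hwf
      (mem_sets fun z => z ∈ plusTree T ∧ ltKB y z) (fun z hz => hz.1) hZ
    refine ⟨pair 0 (z + 1), Set.eq_singleton_iff_unique_mem.2 ⟨⟨mem_sec_intervalBasis.2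
      ⟨_, _, rfl, hyT, .inl rfl, .inr ⟨z, hz, rfl, hyz⟩⟩, hy⟩, ?_⟩⟩
    rintro x ⟨hx, hxY⟩
    obtain ⟨a, b, e, hxT, -, hb⟩ := mem_sec_intervalBasis.1 hx
    obtain ⟨rfl, rfl⟩ := pair_inj.1 e
    obtain h | ⟨z', hz', e, hxz⟩ := hb
    · exact (hM.out.basic.succ_ne_zero _ h).elim
    obtain rfl := add_right_cancel e
    by_contra hne
    have hyx := hmin x hxY hne
    have hxz' : x ≠ z := fun h => ltKB_irrefl hxT.1 (by nth_rw 2 [h]; exact hxz)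
    exact ltKB_irrefl hxT.1 (ltKB_trans hxT.1 hz.1 hxT.1 hxz (hzmin x ⟨hxT, hyx⟩ hxz'))
  · refine ⟨pair 0 0, Set.eq_singleton_iff_unique_mem.2 ⟨⟨mem_sec_intervalBasis.2
      ⟨_, _, rfl, hyT, .inl rfl, .inl rfl⟩, hy⟩, ?_⟩⟩
    rintro x ⟨-, hxY⟩
    by_contra hne
    exact hZ ⟨x, hY hxY, hmin x hxY hne⟩

/-- Given a branch F, the sequences dominating F entrywise form a subspace without isolated points:
below any y in it and above any a' <_KB y there is an extension of y by one large entry. -/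
theorem isWellFounded_of_isScattered {T : Set 𝓜.Dom} (hTs : T ∈ 𝓜.sets)
    (hsc : IsScattered (plusTree T) (intervalBasis (plusTree T) ltKB)) :
    IsWellFounded T := by
  have := isDefSet_of_mem hTs
  rintro ⟨F, hF, hFun, hbr⟩
  have := isDefSet_of_mem hF
  -- Domination of F already implies membership in T⁺, since the restrictions of F are in T
  -- (`hYmem`).
  let Y : Set 𝓜.Dom := {τ | τ ∈ plusTree T ∧ ∀ i v w, HasEntry τ i v → pair i w ∈ F → w ≤ v}
  have hYmem : ∀ {τ n}, τ ∈ 𝓜.finSeqs → HasLength τ n →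
      (∀ i v w, HasEntry τ i v → pair i w ∈ F → w ≤ v) → τ ∈ Y := by
    intro τ n hτ hn h
    obtain ⟨σ, hσ, hσn, hσF⟩ := hbr n
    exact ⟨⟨hτ, σ, hσ, ⟨n, hn, hσn⟩, fun i v w hv hw =>
      h i w v hw ((hσF i (hv.lt_length hσn) v).1 hv)⟩, h⟩
  obtain ⟨σ₀, -, h0, -⟩ := hbr 0
  obtain ⟨ρ, hρ, hρ0, -⟩ := exists_finSeq h0
  obtain ⟨y, hy, i, hi⟩ := hsc Y (mem_sets _) (fun τ hτ => hτ.1)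
    ⟨ρ, hYmem hρ hρ0 fun i v w hv => (not_lt_zero (hv.lt_length hρ0)).elim⟩
  obtain ⟨n, hn⟩ := exists_length hy.1.1
  obtain ⟨f, hf, hfu⟩ := hFun.2 n trivial
  have hyi : y ∈ sec (intervalBasis (plusTree T) ltKB) i := by
    have : y ∈ sec (intervalBasis (plusTree T) ltKB) i ∩ Y := hi ▸ rfl
    exact this.1
  obtain ⟨a, b, rfl, -, ha, hb⟩ := mem_sec_intervalBasis.1 hyi
  have hchild : ∀ {m τ}, f ≤ m → τ ∈ 𝓜.finSeqs → HasLength τ (n + 1) → IsInitSeg y τ →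
      HasEntry τ n m → τ ∈ Y ∧ ltKB τ y := by
    intro m τ hm hτ hτn hyτ hτm
    refine ⟨hYmem hτ hτn fun i v w hv hw => ?_, .inl ⟨hyτ, ?_⟩⟩
    · obtain hi | rfl := (lt_succ_iff.1 (hv.lt_length hτn)).lt_or_eq
      · exact hy.2 i v w ((hyτ.entry_iff hn hi v).2 hv) hw
      · obtain rfl := hv.unique hτm
        rwa [hfu w hw]
    · rintro rfl
      exact lt_irrefl _ (hτm.lt_length hn)
  -- How large the new entry must be to stay above the left end a'. If a' is to the left of y, every
  -- extension of y is above it; if a' properly extends y, the new entry must exceed the n-th entry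
  -- e of a'. Being at least f keeps the extension in Y.
  obtain ⟨m, hfm, hleft⟩ : ∃ m, f ≤ m ∧ ∀ τ, τ ∈ 𝓜.finSeqs → HasLength τ (n + 1) →
      IsInitSeg y τ → HasEntry τ n m →
      (a = 0 ∨ ∃ a' ∈ plusTree T, a = a' + 1 ∧ ltKB a' τ) := by
    obtain h | ⟨a', ha', rfl, h⟩ := ha
    · exact ⟨f, le_rfl, fun _ _ _ _ _ => .inl h⟩
    obtain ⟨l, hl⟩ := exists_length ha'.1
    obtain ⟨h, hne⟩ | ⟨j, c, d, hc, hd, hcd, hj⟩ := h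
    · have hnl : n < l := (h.le hn hl).lt_of_ne fun e => by
        subst e
        exact hne (h.eq_of_length hy.1.1 ha'.1 hn hl).symm
      obtain ⟨e, he⟩ := exists_entry hl hnl
      refine ⟨e + 1 + f, le_add_self, fun τ _ hτn hyτ hτm => .inr ⟨a', ha', rfl, .inr
        ⟨n, e, _, he, hτm, ?_, fun i hi v => ?_⟩⟩⟩
      · exact lt_of_lt_of_le (lt_succ_iff.2 le_rfl) le_self_add
      · rw [← h.entry_iff hn hi, ← hyτ.entry_iff hn hi]
    · refine ⟨f, le_rfl, fun τ _ hτn hyτ hτm => .inr ⟨a', ha', rfl, .inr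
        ⟨j, c, d, hc, hyτ _ _ hd, hcd, fun i hi v => ?_⟩⟩⟩
      rw [hj i hi, ← hyτ.entry_iff hn (hi.trans (hd.lt_length hn))]
  obtain ⟨τ, hτ, hτn, hyτ, hτm⟩ := exists_extension hn m
  obtain ⟨hτY, hlt⟩ := hchild hfm hτ hτn hyτ hτm
  have hmem : τ ∈ sec (intervalBasis (plusTree T) ltKB) (pair a b) ∩ Y := by
    refine ⟨mem_sec_intervalBasis.2 ⟨a, b, rfl, hτY.1, hleft τ hτ hτn hyτ hτm, ?_⟩, hτY⟩
    obtain h | ⟨b', hb', rfl, h⟩ := hb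
    · exact .inl h
    · exact .inr ⟨b', hb', rfl, ltKB_trans hτ hy.1.1 hb'.1 hlt h⟩
  rw [hi] at hmem
  obtain rfl := hmem
  exact ltKB_irrefl hτ hlt

end L2Structure

instance IsDefSet.basisFun {ι : Type w} {𝓜 : ι → L2Structure.{u}} {D : DefClass 𝓜}
    [hD : D.Arithmetical] [hM : ∀ i, Fact (𝓜 i).ModelsRCA0]
    {X U : ∀ i, (𝓜 i).Dom → Set (𝓜 i).Dom} [IsDefSet D X] [IsDefSet D U] :
    IsDefSet D (fun i c => basisFun (X i c) (U i c)) := by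
  unfold L2Structure.basisFun; infer_instance

/-! ## Countable ultrametric spaces -/

instance IsFn.ite {ι : Type w} {𝓜 : ι → L2Structure.{u}} {D : DefClass 𝓜}
    [hM : ∀ i, Fact (𝓜 i).ModelsRCA0] {P : ∀ i, (𝓜 i).Dom → Prop}
    {s t : ∀ i, (𝓜 i).Dom → (𝓜 i).Dom} [∀ i c, Decidable (P i c)]
    [hP : IsDef D P] [hs : IsFn D s] [ht : IsFn D t] :
    IsFn D (fun i c => if P i c then s i c else t i c) where
  out := by
    have : IsDef D fun i c => P i (L2Structure.fst c) := hP.comp (IsFn.fst (hs := IsFn.id))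
    refine (IsDef.congr (P := fun i c => (P i (L2Structure.fst c) ∧
      L2Structure.snd c = s i (L2Structure.fst c)) ∨ (¬ P i (L2Structure.fst c) ∧
      L2Structure.snd c = t i (L2Structure.fst c))) inferInstance fun i c => ?_).out
    by_cases h : P i (L2Structure.fst c) <;> simp [h]

namespace L2Structure

variable {𝓜 : L2Structure.{u}} [hM : Fact 𝓜.ModelsRCA0]

namespace PreRat

theorem le_iff {q r : 𝓜.PreRat} (hq : q.n = 0) (hr : r.n = 0) :
    q.le r ↔ q.p * r.d ≤ r.p * q.d := by
  simp [PreRat.le, hq, hr]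

theorem add_n {q r : 𝓜.PreRat} (hq : q.n = 0) (hr : r.n = 0) : (q.add r).n = 0 := by
  simp [PreRat.add, hq, hr]

theorem le_add_left {q r s : 𝓜.PreRat} (hq : q.n = 0) (hr : r.n = 0) (hs : s.n = 0)
    (h : q.le r) : q.le (r.add s) := by
  rw [le_iff hq hr] at h
  rw [le_iff hq (add_n hr hs)]
  obtain ⟨e, he⟩ := (Arith.le_iff _ _).1 h
  refine (Arith.le_iff _ _).2 ⟨e * s.d + s.p * r.d * q.d, ?_⟩
  calc (r.p * s.d + s.p * r.d) * q.d = r.p * q.d * s.d + s.p * r.d * q.d := by ring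
    _ = _ := by rw [he]; simp only [add]; ring

theorem add_comm (r s : 𝓜.PreRat) : r.add s = s.add r := by
  simp only [add, PreRat.mk.injEq]
  exact ⟨by ring, by ring, by ring⟩

theorem le_add_right {q r s : 𝓜.PreRat} (hq : q.n = 0) (hr : r.n = 0) (hs : s.n = 0)
    (h : q.le s) : q.le (r.add s) := by
  rw [add_comm]; exact le_add_left hq hs hr h

theorem le_refl (q : 𝓜.PreRat) : q.le q := _root_.le_refl _

theorem unitFrac_n (k : 𝓜.Dom) : (unitFrac k).n = 0 := rfl

theorem zero_n : (zero : 𝓜.PreRat).n = 0 := rfl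

theorem zero_le {q : 𝓜.PreRat} (hq : q.n = 0) : zero.le q := by
  rw [le_iff zero_n hq]
  simp [zero]

theorem unitFrac_le_unitFrac {a b : 𝓜.Dom} (h : b ≤ a) : (unitFrac a).le (unitFrac b) := by
  rw [le_iff rfl rfl]
  simpa [unitFrac] using h

theorem code_inj {q r : 𝓜.PreRat} (h : q.code = r.code) : q = r := by
  cases q; cases r
  simpa only [code, pair_inj, PreRat.mk.injEq, and_assoc] using h

end PreRat

open PreRat

theorem realLE_const {q r : 𝓜.PreRat} (hq : q.n = 0) (hr : r.n = 0) (h : q.le r) :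
    realLE (fun _ => q) (fun _ => r) := fun _ =>
  le_add_left hq hr (add_n (unitFrac_n _) (unitFrac_n _)) h

/-- The slack 2/(k + 1) in the order of the reals has to be beaten at a suitable precision k, after
which the comparison is one of rationals. -/
theorem realLE_unitFrac_iff {a b : 𝓜.Dom} :
    realLE (fun _ => unitFrac a) (fun _ => unitFrac b) ↔ b ≤ a := by
  refine ⟨fun h => ?_, fun h => realLE_const rfl rfl (unitFrac_le_unitFrac h)⟩
  by_contra! hlt
  obtain ⟨e, rfl⟩ := (Arith.lt_iff _ _).1 hlt
  -- For a < b the difference 1/(a + 1) − 1/(b + 1) is at least 1/((a + 1)(b + 1)), which exceeds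
  -- 2/(k + 1) for k = 2(a + 1)(b + 1).
  have h1 := h ((a + 1) * (a + e + 1 + 1) + (a + 1) * (a + e + 1 + 1))
  rw [PreRat.le_iff rfl (add_n rfl (add_n rfl rfl))] at h1
  refine h1.not_gt ((Arith.lt_iff _ _).2 ?_)
  simp only [PreRat.add, unitFrac]
  generalize hk : (a + 1) * (a + e + 1 + 1) + (a + 1) * (a + e + 1 + 1) = k
  refine ⟨(k + 1) * (k + 1) * e + k, ?_⟩
  have : (k + 1) * ((a + 1) * (a + e + 1 + 1) + (a + 1) * (a + e + 1 + 1)) = (k + 1) * k := by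
    rw [hk]
  calc _ = (k + 1) * (k + 1) * (a + 1) + (k + 1) * (k + 1) * e + (k + 1) * (k + 1) := by ring
    _ = (k + 1) * (k + 1) * (a + 1) + (k + 1) * (k + 1) * e + (k + 1) * k + k + 1 := by ring
    _ = _ := by nth_rw 1 [← this]; ring

theorem not_realLE_unitFrac_zero {a : 𝓜.Dom} :
    ¬ realLE (fun _ => unitFrac a) (fun _ => PreRat.zero) := by
  intro h
  have h1 := h ((a + 1) + (a + 1))
  rw [PreRat.le_iff rfl (add_n rfl (add_n rfl rfl))] at h1
  refine h1.not_gt ((Arith.lt_iff _ _).2 ?_)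
  simp only [PreRat.add, unitFrac, PreRat.zero]
  exact ⟨a + 1 + (a + 1), by ring⟩

open Classical in
/-- The distance `1 / (v x y + 1)` of distinct points `x`, `y`. -/
noncomputable def ultraRat (v : 𝓜.Dom → 𝓜.Dom → 𝓜.Dom) (x y : 𝓜.Dom) : 𝓜.PreRat :=
  if x = y then PreRat.zero else unitFrac (v x y)

open Classical in
-- The code of `ultraRat` as a number-valued function, so that instance search can establish its
-- definability.
noncomputable def ultraCode (v : 𝓜.Dom → 𝓜.Dom → 𝓜.Dom) (x y : 𝓜.Dom) : 𝓜.Dom :=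
  if x = y then pair (pair 0 0) 1 else pair (pair 1 0) (v x y + 1)

theorem code_ultraRat (v : 𝓜.Dom → 𝓜.Dom → 𝓜.Dom) (x y : 𝓜.Dom) :
    (ultraRat v x y).code = ultraCode v x y := by
  unfold ultraRat ultraCode
  split_ifs <;> rfl

theorem ultraRat_n (v : 𝓜.Dom → 𝓜.Dom → 𝓜.Dom) (x y : 𝓜.Dom) : (ultraRat v x y).n = 0 := by
  unfold ultraRat
  split_ifs <;> rfl

/-- The code of the metric on `X` with `d(x, y) = 1 / (v x y + 1)` for `x ≠ y`. -/
noncomputable def ultraDist (X : Set 𝓜.Dom) (v : 𝓜.Dom → 𝓜.Dom → 𝓜.Dom) : Set 𝓜.Dom :=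
  {p | p = pair (pair (pair (fst (fst (fst p))) (snd (fst (fst p)))) (snd (fst p)))
      (ultraCode v (fst (fst (fst p))) (snd (fst (fst p)))) ∧
    fst (fst (fst p)) ∈ X ∧ snd (fst (fst p)) ∈ X}

theorem mem_ultraDist {X : Set 𝓜.Dom} {v : 𝓜.Dom → 𝓜.Dom → 𝓜.Dom} {p : 𝓜.Dom} :
    p ∈ ultraDist X v ↔
      ∃ x ∈ X, ∃ y ∈ X, ∃ k, p = pair (pair (pair x y) k) (ultraCode v x y) := by
  constructor
  · rintro ⟨h, hx, hy⟩
    exact ⟨_, hx, _, hy, _, h⟩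
  · rintro ⟨x, hx, y, hy, k, rfl⟩
    simp [ultraDist, hx, hy]

/-- `v` is symmetric and satisfies the ultrametric inequality. -/
structure IsUltra (X : Set 𝓜.Dom) (v : 𝓜.Dom → 𝓜.Dom → 𝓜.Dom) : Prop where
  symm : ∀ x ∈ X, ∀ y ∈ X, v x y = v y x
  ultra : ∀ x ∈ X, ∀ y ∈ X, ∀ z ∈ X, x ≠ z → x ≠ y → y ≠ z → v x y ≤ v x z ∨ v y z ≤ v x z

variable {X : Set 𝓜.Dom} {v : 𝓜.Dom → 𝓜.Dom → 𝓜.Dom}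

theorem dist_ultraDist {x y : 𝓜.Dom} (hx : x ∈ X) (hy : y ∈ X) :
    dist (ultraDist X v) x y = fun _ => ultraRat v x y := by
  funext k
  have happ : app (ultraDist X v) (pair (pair x y) k) = (ultraRat v x y).code := by
    rw [code_ultraRat]
    refine app_eq (mem_ultraDist.2 ⟨x, hx, y, hy, k, rfl⟩) fun c hc => ?_
    obtain ⟨x', -, y', -, k', e⟩ := mem_ultraDist.1 hc
    simp only [pair_inj] at e
    obtain ⟨⟨⟨rfl, rfl⟩, rfl⟩, rfl⟩ := e
    rfl
  exact (code_inj (happ.symm.trans (Classical.epsilon_spec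
    (p := fun q : 𝓜.PreRat => app (ultraDist X v) (pair (pair x y) k) = q.code) ⟨_, happ⟩))).symm

/-- Each distance is a constant sequence of rationals, so the real-number clauses reduce to rational
comparisons; the triangle inequality follows because one of the two summands already bounds d(x, z).
-/
theorem isMetricSpace_ultraDist (h : IsUltra X v) : IsMetricSpace X (ultraDist X v) where
  isFun := by
    refine ⟨fun p hp => ?_, ?_⟩
    · obtain ⟨x, hx, y, hy, k, rfl⟩ := mem_ultraDist.1 hp
      refine ⟨_, ⟨_, ⟨x, hx, y, hy, rfl⟩, k, trivial, rfl⟩, _, ⟨ultraRat v x y, ?_,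
        (code_ultraRat v x y).symm⟩, rfl⟩
      unfold ultraRat
      split_ifs
      · exact one_ne_zero
      · exact (zero_lt_succ _).ne'
    · rintro p ⟨_, ⟨x, hx, y, hy, rfl⟩, k, -, rfl⟩
      refine ⟨ultraCode v x y, mem_ultraDist.2 ⟨x, hx, y, hy, k, rfl⟩, fun c hc => ?_⟩
      obtain ⟨x', -, y', -, k', e⟩ := mem_ultraDist.1 hc
      simp only [pair_inj] at e
      obtain ⟨⟨⟨rfl, rfl⟩, rfl⟩, rfl⟩ := e
      rfl
  isReal x hx y hy := by
    rw [dist_ultraDist hx hy]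
    intro k l _
    have := le_add_left (ultraRat_n v x y) (ultraRat_n v x y) (unitFrac_n k) (PreRat.le_refl _)
    exact ⟨this, this⟩
  nonneg x hx y hy := by
    rw [dist_ultraDist hx hy]
    exact realLE_const rfl (ultraRat_n _ _ _) (PreRat.zero_le (ultraRat_n _ _ _))
  eq_zero_iff x hx y hy := by
    rw [dist_ultraDist hx hy]
    unfold ultraRat
    split_ifs with e
    · exact ⟨fun _ => e, fun _ => ⟨realLE_const rfl rfl (PreRat.le_refl _),
        realLE_const rfl rfl (PreRat.le_refl _)⟩⟩
    · exact ⟨fun h => (not_realLE_unitFrac_zero h.1).elim, fun h => (e h).elim⟩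
  symm x hx y hy := by
    rw [dist_ultraDist hx hy, dist_ultraDist hy hx]
    have : ultraRat v x y = ultraRat v y x := by
      unfold ultraRat
      simp only [h.symm x hx y hy, eq_comm]
    rw [this]
    exact ⟨realLE_const (ultraRat_n _ _ _) (ultraRat_n _ _ _) (PreRat.le_refl _),
      realLE_const (ultraRat_n _ _ _) (ultraRat_n _ _ _) (PreRat.le_refl _)⟩
  triangle x hx y hy z hz := by
    rw [dist_ultraDist hx hy, dist_ultraDist hx hz, dist_ultraDist hy hz]
    intro k
    refine le_add_left (ultraRat_n _ _ _) (add_n (ultraRat_n _ _ _) (ultraRat_n _ _ _))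
      (add_n rfl rfl) ?_
    by_cases hxz : x = z
    · rw [ultraRat, if_pos hxz]
      exact PreRat.zero_le (add_n (ultraRat_n _ _ _) (ultraRat_n _ _ _))
    by_cases hxy : x = y
    · subst hxy
      exact le_add_right (ultraRat_n _ _ _) (ultraRat_n _ _ _) (ultraRat_n _ _ _) (PreRat.le_refl _)
    by_cases hyz : y = z
    · subst hyz
      exact le_add_left (ultraRat_n _ _ _) (ultraRat_n _ _ _) (ultraRat_n _ _ _) (PreRat.le_refl _)
    rcases h.ultra x hx y hy z hz hxz hxy hyz with h | h
    · refine le_add_left (ultraRat_n _ _ _) (ultraRat_n _ _ _) (ultraRat_n _ _ _) ?_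
      rw [ultraRat, ultraRat, if_neg hxz, if_neg hxy]
      exact unitFrac_le_unitFrac h
    · refine le_add_right (ultraRat_n _ _ _) (ultraRat_n _ _ _) (ultraRat_n _ _ _) ?_
      rw [ultraRat, ultraRat, if_neg hxz, if_neg hyz]
      exact unitFrac_le_unitFrac h

/-- Reduces every Cauchy and convergence statement below to a comparison of numbers. -/
theorem realLT_ultraDist {x y : 𝓜.Dom} (hx : x ∈ X) (hy : y ∈ X) (k : 𝓜.Dom) :
    realLT (dist (ultraDist X v) x y) (fun _ => unitFrac k) ↔ x = y ∨ k < v x y := by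
  rw [dist_ultraDist hx hy, realLT, ultraRat]
  split_ifs with e
  · exact iff_of_true not_realLE_unitFrac_zero (.inl e)
  · rw [realLE_unitFrac_iff, not_le]
    simp [e]

theorem app_mem {F A B : Set 𝓜.Dom} (hF : IsFun F A B) {a : 𝓜.Dom} (ha : a ∈ A) :
    pair a (app F a) ∈ F ∧ app F a ∈ B := by
  obtain ⟨b, hb, hu⟩ := hF.2 a ha
  rw [app_eq hb hu]
  obtain ⟨a', -, b', hb', e⟩ := hF.1 hb
  exact ⟨hb, (pair_inj.1 e).2 ▸ hb'⟩

end L2Structure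

section

variable {ι : Type w} {𝓜 : ι → L2Structure.{u}} {D : DefClass 𝓜}
  [hM : ∀ i, Fact (𝓜 i).ModelsRCA0]

theorem IsDefSet.ultraDist {X : ∀ i, (𝓜 i).Dom → Set (𝓜 i).Dom} [IsDefSet D X]
    {v : ∀ i, (𝓜 i).Dom → (𝓜 i).Dom → (𝓜 i).Dom → (𝓜 i).Dom}
    (hv : IsFn D fun i c => v i (fst c) (fst (fst (fst (snd c)))) (snd (fst (fst (snd c))))) :
    IsDefSet D (fun i c => ultraDist (X i c) (v i c)) := by
  unfold L2Structure.ultraDist ultraCode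
  infer_instance

end

/-! ## The metric space of a tree -/

namespace L2Structure

/-- The first place where `σ` and `τ` differ. -/
noncomputable def firstDiff {𝓜 : L2Structure.{u}} (σ τ : 𝓜.Dom) : 𝓜.Dom :=
  mu fun j => ¬ ∀ v, HasEntry σ j v ↔ HasEntry τ j v

variable {𝓜 : L2Structure.{u}} [hM : Fact 𝓜.ModelsRCA0] [hA : 𝓜.setClass.Arithmetical]

theorem firstDiff_spec {σ τ : 𝓜.Dom} (hσ : σ ∈ 𝓜.finSeqs) (hτ : τ ∈ 𝓜.finSeqs) (h : σ ≠ τ) :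
    (∀ i, i < firstDiff σ τ → ∀ v, HasEntry σ i v ↔ HasEntry τ i v) ∧
      ¬ ∀ v, HasEntry σ (firstDiff σ τ) v ↔ HasEntry τ (firstDiff σ τ) v := by
  obtain ⟨j, -, hj⟩ := exists_first_difference hσ hτ h
  have := mu_spec (fun j => ¬ ∀ v, HasEntry σ j v ↔ HasEntry τ j v)
    fun h => hj (entry_eq_iff.2 h)
  exact ⟨fun i hi => by_contra fun hn => (this.2 i hn).not_gt hi, this.1⟩

theorem le_firstDiff {σ τ n : 𝓜.Dom} (hσ : σ ∈ 𝓜.finSeqs) (hτ : τ ∈ 𝓜.finSeqs) (h : σ ≠ τ)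
    (hn : ∀ i, i < n → ∀ v, HasEntry σ i v ↔ HasEntry τ i v) : n ≤ firstDiff σ τ :=
  not_lt.1 fun hlt => (firstDiff_spec hσ hτ h).2 (hn _ hlt)

theorem isUltra_firstDiff {T : Set 𝓜.Dom} (hT : IsTree T) : IsUltra T firstDiff where
  symm σ _ τ _ := by unfold firstDiff; simp only [Iff.comm]
  ultra ρ hρ σ hσ τ hτ hρτ hρσ hστ := by
    have h1 := (firstDiff_spec (hT.1 hρ) (hT.1 hσ) hρσ).1
    have h2 := (firstDiff_spec (hT.1 hσ) (hT.1 hτ) hστ).1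
    have h3 := le_firstDiff (n := min (firstDiff ρ σ) (firstDiff σ τ)) (hT.1 hρ) (hT.1 hτ) hρτ
      fun i hi v => (h1 i (hi.trans_le (min_le_left _ _)) v).trans
        (h2 i (hi.trans_le (min_le_right _ _)) v)
    rcases min_choice (firstDiff ρ σ) (firstDiff σ τ) with e | e <;> rw [e] at h3
    · exact .inl h3
    · exact .inr h3

/-- The restrictions of the branch form a Cauchy sequence. A limit x would have some length l;
restrictions longer than l have an entry at l and so cannot agree with x beyond l. -/
theorem not_isCompleteMetric_of_branch {T F : Set 𝓜.Dom} (hTs : T ∈ 𝓜.sets) (hT : IsTree T)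
    (hF : F ∈ 𝓜.sets) (hbr : IsBranch F T) :
    ¬ IsCompleteMetric T (ultraDist T firstDiff) := by
  have := isDefSet_of_mem hTs
  have := isDefSet_of_mem hF
  let G : Set 𝓜.Dom := {p | ∃ n σ, p = pair n σ ∧ σ ∈ T ∧ HasLength σ n ∧
    ∀ i, i < n → ∀ v, HasEntry σ i v ↔ pair i v ∈ F}
  have hG : IsFun G Set.univ T := by
    refine ⟨?_, fun n _ => ?_⟩
    · rintro p ⟨n, σ, rfl, hσ, -⟩
      exact ⟨n, trivial, σ, hσ, rfl⟩
    · obtain ⟨σ, hσ, hn, h⟩ := hbr.2 n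
      refine ⟨σ, ⟨n, σ, rfl, hσ, hn, h⟩, ?_⟩
      rintro τ ⟨n', τ', e, hτ, hn', h'⟩
      obtain ⟨rfl, rfl⟩ := pair_inj.1 e
      exact IsInitSeg.eq_of_length (fun i v hv => (h i (hv.lt_length hn') v).2
        ((h' i (hv.lt_length hn') v).1 hv)) (hT.1 hτ) (hT.1 hσ) hn' hn
  have happ : ∀ n, app G n ∈ T ∧ HasLength (app G n) n ∧
      ∀ i, i < n → ∀ v, HasEntry (app G n) i v ↔ pair i v ∈ F := by
    intro n
    obtain ⟨n', σ, e, h⟩ := (app_mem hG (a := n) trivial).1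
    obtain ⟨e₁, e₂⟩ := pair_inj.1 e
    subst e₁
    rw [e₂]
    exact h
  intro hc
  obtain ⟨x, hx, hlim⟩ := hc G (mem_sets _) hG fun k => ⟨k + 1, fun m n hm hn => by
    obtain ⟨h1, -, h2⟩ := happ m
    obtain ⟨h3, -, h4⟩ := happ n
    rw [realLT_ultraDist h1 h3, or_iff_not_imp_left]
    exact fun hne => succ_le_iff.1 (le_firstDiff (hT.1 h1) (hT.1 h3) hne fun i hi v =>
      (h2 i (hi.trans_le hm) v).trans (h4 i (hi.trans_le hn) v).symm)⟩
  obtain ⟨l, hl⟩ := exists_length (hT.1 hx)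
  obtain ⟨N, hN⟩ := hlim l
  obtain ⟨h1, h2, -⟩ := happ (max N (l + 1))
  have hlt : l < max N (l + 1) := succ_le_iff.1 (le_max_right _ _)
  obtain h | h := (realLT_ultraDist h1 hx l).1 (hN _ (le_max_left _ _))
  · rw [h] at h2
    exact hlt.ne (hl.unique h2)
  · have hne : app G (max N (l + 1)) ≠ x := fun e => by
      rw [e] at h2
      exact hlt.ne (hl.unique h2)
    obtain ⟨v, hv⟩ := exists_entry h2 hlt
    have := ((firstDiff_spec (hT.1 h1) (hT.1 hx) hne).1 l h v).1 hv
    exact lt_irrefl _ (this.lt_length hl)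

/-- A Cauchy sequence without limit is not eventually constant, so its members must grow in length
while their prefixes stabilise; the stable prefixes are restrictions of a branch. -/
theorem isCompleteMetric_of_isWellFounded {T : Set 𝓜.Dom} (hTs : T ∈ 𝓜.sets) (hT : IsTree T)
    (hwf : IsWellFounded T) : IsCompleteMetric T (ultraDist T firstDiff) := by
  have := isDefSet_of_mem hTs
  intro G hGs hG hcau
  have := isDefSet_of_mem hGs
  have happ : ∀ n, pair n (app G n) ∈ G ∧ app G n ∈ T := fun n => app_mem hG trivial
  have hGapp : ∀ n σ, pair n σ ∈ G → σ = app G n := fun n σ h => by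
    obtain ⟨τ, _, hu⟩ := hG.2 n trivial
    exact (hu σ h).trans (hu _ (happ n).1).symm
  by_contra! hno
  have hfin : ∀ n, app G n ∈ 𝓜.finSeqs := fun n => hT.1 (happ n).2
  -- beyond some `N` all members agree below `k` and have length at least `k`
  have key : ∀ k, ∃ N, ∀ n, N ≤ n → (∃ l, HasLength (app G n) l ∧ k ≤ l) ∧
      ∀ i, i < k → ∀ v, HasEntry (app G n) i v ↔ HasEntry (app G N) i v := by
    intro k
    obtain ⟨N, hN⟩ := hcau k
    obtain ⟨m, hm, hne⟩ : ∃ m, N ≤ m ∧ app G m ≠ app G N := by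
      by_contra! hall
      refine hno (app G N) (happ N).2 fun k => ⟨N, fun n hn => ?_⟩
      rw [realLT_ultraDist (happ n).2 (happ N).2]
      exact .inl (hall n hn)
    have hagree : ∀ n, N ≤ n → ∀ i, i < k → ∀ v,
        HasEntry (app G n) i v ↔ HasEntry (app G N) i v := by
      intro n hn i hi v
      obtain h | h := (realLT_ultraDist (happ n).2 (happ N).2 k).1 (hN n N hn le_rfl)
      · rw [h]
      · by_cases e : app G n = app G N
        · rw [e]
        · exact (firstDiff_spec (hfin _) (hfin _) e).1 i (hi.trans h) v
    -- Two distinct members agree beyond k. Were one of them shorter than k, the other would have to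
    -- end at the same place, and no difference would be left.
    have hNl : ∃ l, HasLength (app G N) l ∧ k ≤ l := by
      obtain ⟨l, hl⟩ := exists_length (hfin N)
      refine ⟨l, hl, not_lt.1 fun hlk => ?_⟩
      have hlt := ((realLT_ultraDist (happ m).2 (happ N).2 k).1 (hN m N hm le_rfl)).resolve_left hne
      obtain ⟨h1, h2⟩ := firstDiff_spec (hfin m) (hfin N) hne
      obtain ⟨l', hl'⟩ := exists_length (hfin m)
      refine h2 fun v => iff_of_false (fun hv => ?_) fun hv => ?_
      · have hd := hv.lt_length hl'
        obtain ⟨w, hw⟩ := exists_entry hl' ((hlk.trans hlt).trans hd)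
        exact lt_irrefl _ (((h1 l (hlk.trans hlt) w).1 hw).lt_length hl)
      · exact ((hlk.trans hlt).trans (hv.lt_length hl)).false
    refine ⟨N, fun n hn => ⟨?_, hagree n hn⟩⟩
    obtain ⟨l, hl⟩ := exists_length (hfin n)
    refine ⟨l, hl, not_lt.1 fun hlk => ?_⟩
    obtain ⟨l', hl', hk⟩ := hNl
    obtain ⟨v, hv⟩ := exists_entry hl' (hlk.trans_le hk)
    exact lt_irrefl _ (((hagree n hn l hlk v).2 hv).lt_length hl)
  -- The branch sends i to the eventual i-th entry of the members of the sequence.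
  refine hwf ⟨{p | ∃ i v, p = pair i v ∧ ∃ N, ∀ n, N ≤ n → ∀ σ, pair n σ ∈ G → HasEntry σ i v},
    mem_sets _, ⟨?_, fun i _ => ?_⟩, fun k => ?_⟩
  · rintro p ⟨i, v, rfl, -⟩
    exact ⟨i, trivial, v, trivial, rfl⟩
  · obtain ⟨N, hN⟩ := key (i + 1)
    obtain ⟨l, hl, hil⟩ := (hN N le_rfl).1
    obtain ⟨v, hv⟩ := exists_entry hl (succ_le_iff.1 hil)
    refine ⟨v, ⟨i, v, rfl, N, fun n hn σ hσ => ?_⟩, ?_⟩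
    · rw [hGapp n σ hσ]
      exact ((hN n hn).2 i (lt_succ_iff.2 le_rfl) v).2 hv
    · rintro w ⟨i', w', e, M, hMw⟩
      obtain ⟨rfl, rfl⟩ := pair_inj.1 e
      have h1 := hMw (max N M) (le_max_right _ _) _ (happ _).1
      have h2 := ((hN (max N M) (le_max_left _ _)).2 i (lt_succ_iff.2 le_rfl) v).2 hv
      exact h1.unique h2
  · obtain ⟨N, hN⟩ := key k
    obtain ⟨l, hl, hkl⟩ := (hN N le_rfl).1
    obtain ⟨τ, hτ, hτk, hi⟩ := hT.exists_restriction (happ N).2 hl hkl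
    refine ⟨τ, hτ, hτk, fun i hik v => ?_⟩
    rw [hi.entry_iff hτk hik]
    constructor
    · intro hv
      refine ⟨i, v, rfl, N, fun n hn σ hσ => ?_⟩
      rw [hGapp n σ hσ]
      exact ((hN n hn).2 i hik v).2 hv
    · rintro ⟨i', v', e, M, hMv⟩
      obtain ⟨rfl, rfl⟩ := pair_inj.1 e
      exact ((hN (max N M) (le_max_left _ _)).2 i hik v).1
        (hMv (max N M) (le_max_right _ _) _ (happ _).1)

theorem isCompleteMetric_iff_isWellFounded {T : Set 𝓜.Dom} (hTs : T ∈ 𝓜.sets) (hT : IsTree T) :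
    IsCompleteMetric T (ultraDist T firstDiff) ↔ IsWellFounded T :=
  ⟨fun h ⟨_, hF, hbr⟩ => not_isCompleteMetric_of_branch hTs hT hF hbr h,
    isCompleteMetric_of_isWellFounded hTs hT⟩

end L2Structure

section

variable {ι : Type w} {𝓜 : ι → L2Structure.{u}} {D : DefClass 𝓜} [hD : D.Arithmetical]
  [hM : ∀ i, Fact (𝓜 i).ModelsRCA0] {s t : ∀ i, (𝓜 i).Dom → (𝓜 i).Dom}

instance IsFn.firstDiff [IsFn D s] [IsFn D t] : IsFn D (fun i c => firstDiff (s i c) (t i c)) := by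
  unfold L2Structure.firstDiff; infer_instance

instance IsDefSet.ultraDist_firstDiff {X : ∀ i, (𝓜 i).Dom → Set (𝓜 i).Dom} [IsDefSet D X] :
    IsDefSet D (fun i c => L2Structure.ultraDist (X i c) L2Structure.firstDiff) :=
  IsDefSet.ultraDist inferInstance

end

/-! ## The normal form of `Π¹₁` formulas -/

namespace L2Structure

open Classical in
/-- The point `(c, χ, w)`, where `χ` is `0` or `1` according to whether `c` is in `X`. -/
noncomputable def graphPoint {𝓜 : L2Structure.{u}} (X : Set 𝓜.Dom) (g : 𝓜.Dom → 𝓜.Dom)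
    (c : 𝓜.Dom) : 𝓜.Dom :=
  pair c (pair (if c ∈ X then 0 else 1) (g c))

/-- The binary constraint `Q` on the points of a graph represents the predicate `P`: the functions
`g` for which no two points `(c, χ, g c)` are in `Q` satisfy `P X c ↔ fst (g c) = 0`, and
there is such a function for every `X`. -/
structure Represents {𝓜 : L2Structure.{u}} [hM : Fact 𝓜.ModelsRCA0]
    (Q : 𝓜.Dom → 𝓜.Dom → Prop) (P : 𝓜.sets → 𝓜.Dom → Prop) : Prop where
  sound : ∀ (X : 𝓜.sets) (g : 𝓜.Dom → 𝓜.Dom),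
    (∀ c d, ¬ Q (graphPoint X g c) (graphPoint X g d)) → ∀ c, fst (g c) = 0 ↔ P X c
  complete : ∀ X : 𝓜.sets, ∃ g : 𝓜.Dom → 𝓜.Dom, IsFn 𝓜.setClass (fun _ => g) ∧
    ∀ c d, ¬ Q (graphPoint X g c) (graphPoint X g d)

/-- Replace the last component `w` of the point `(c, χ, w)`. -/
noncomputable def restPoint {𝓜 : L2Structure.{u}} (p w : 𝓜.Dom) : 𝓜.Dom :=
  pair (fst p) (pair (fst (snd p)) w)

section

variable {𝓜 : L2Structure.{u}} [hM : Fact 𝓜.ModelsRCA0] (X : Set 𝓜.Dom) (g : 𝓜.Dom → 𝓜.Dom)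
  (c : 𝓜.Dom)

@[simp] theorem fst_graphPoint : fst (graphPoint X g c) = c := by simp [graphPoint]

@[simp] theorem fst_snd_graphPoint : fst (snd (graphPoint X g c)) = 0 ↔ c ∈ X := by
  simp [graphPoint]

@[simp] theorem snd_snd_graphPoint : snd (snd (graphPoint X g c)) = g c := by simp [graphPoint]

@[simp] theorem restPoint_graphPoint (h : 𝓜.Dom → 𝓜.Dom) :
    restPoint (graphPoint X g c) (h c) = graphPoint X h c := by simp [graphPoint, restPoint]

end

end L2Structure

section

variable {ι : Type w} {𝓜 : ι → L2Structure.{u}} {D : DefClass 𝓜}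
  [hM : ∀ i, Fact (𝓜 i).ModelsRCA0] {s t : ∀ i, (𝓜 i).Dom → (𝓜 i).Dom}

instance IsFn.restPoint [IsFn D s] [IsFn D t] :
    IsFn D (fun i c => restPoint (s i c) (t i c)) := by
  unfold L2Structure.restPoint; infer_instance

variable (D) in
/-- The predicate `P` with a set argument is represented by a definable constraint. -/
def Representable (P : ∀ i, (𝓜 i).sets → (𝓜 i).Dom → Prop) : Prop :=
  ∃ Q : ∀ i, (𝓜 i).Dom → (𝓜 i).Dom → Prop, IsDef D (fun i c => Q i (fst c) (snd c)) ∧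
    ∀ i, Represents (Q i) (P i)

namespace Representable

variable [hD : D.Arithmetical] [hA : ∀ i, (𝓜 i).setClass.Arithmetical]
  {P R : ∀ i, (𝓜 i).sets → (𝓜 i).Dom → Prop}

/-- The first component of g c is a truth value, with 0 for true. As P does not involve X, the
constraint looks at one point only. -/
theorem of_isDef {P : ∀ i, (𝓜 i).Dom → Prop} (hP : IsDef D P)
    (hP' : ∀ i, IsDef (𝓜 i).setClass fun _ => P i) : Representable D fun i _ c => P i c := by
  classical
  have : IsDef D fun i c => P i (fst (fst c)) := hP.comp inferInstance
  refine ⟨fun i p q => ¬ (fst (snd (snd p)) = 0 ↔ P i (fst p)), inferInstance, fun i => ⟨?_, ?_⟩⟩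
  · intro X g hg c
    simpa using hg c c
  · intro X
    have := hP' i
    exact ⟨fun c => pair (if P i c then 0 else 1) 0, inferInstance, by simp⟩

/-- Here two points are needed: the truth value at c is compared with the membership bit at t c. -/
theorem mem (ht : IsFn D t) (ht' : ∀ i, IsFn (𝓜 i).setClass fun _ => t i) :
    Representable D fun i X c => t i c ∈ (X : Set (𝓜 i).Dom) := by
  classical
  have : IsFn D fun i c => t i (fst (fst c)) := ht.comp inferInstance
  refine ⟨fun i p q => fst q = t i (fst p) ∧ ¬ (fst (snd (snd p)) = 0 ↔ fst (snd q) = 0),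
    inferInstance, fun i => ⟨?_, ?_⟩⟩
  · intro X g hg c
    simpa using hg c (t i c)
  · intro X
    have := isDefSet_of_mem X.2
    have := ht' i
    refine ⟨fun c => pair (if t i c ∈ (X : Set (𝓜 i).Dom) then 0 else 1) 0, inferInstance, ?_⟩
    rintro c d ⟨h, h'⟩
    simp at h h'
    simp [h] at h'

theorem not (hP : Representable D P) : Representable D fun i X c => ¬ P i X c := by
  classical
  obtain ⟨Q, hQ, hPQ⟩ := hP
  have : IsDef D fun i c => Q i (restPoint (fst c) (snd (snd (snd (fst c)))))
    (restPoint (snd c) (snd (snd (snd (snd c))))) := hQ.comp₂ (P := Q) inferInstance inferInstance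
  refine ⟨fun i p q => Q i (restPoint p (snd (snd (snd p)))) (restPoint q (snd (snd (snd q)))) ∨
    ¬ (fst (snd (snd p)) = 0 ↔ ¬ fst (snd (snd (snd p))) = 0),
    inferInstance, fun i => ⟨?_, ?_⟩⟩
  · intro X g hg c
    have h1 := fun c => restPoint_graphPoint (X : Set (𝓜 i).Dom) g c fun c => snd (g c)
    simp only [snd_snd_graphPoint, h1, not_or, not_not] at hg
    exact (hg c c).2.trans (not_congr ((hPQ i).sound X _ (fun c d => (hg c d).1) c))
  · intro X
    obtain ⟨g, hg, hgQ⟩ := (hPQ i).complete X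
    let h := fun c => pair (if ¬ fst (g c) = 0 then 0 else 1) (g c)
    refine ⟨h, inferInstanceAs (IsFn _ fun _ c => pair (if ¬ fst (g c) = 0 then 0 else 1) (g c)), ?_⟩
    intro c d
    simp only [snd_snd_graphPoint, h, snd_pair, fst_pair]
    simp [hgQ]

theorem and (hP : Representable D P) (hR : Representable D R) :
    Representable D fun i X c => P i X c ∧ R i X c := by
  classical
  obtain ⟨Q, hQ, hPQ⟩ := hP
  obtain ⟨S, hS, hRS⟩ := hR
  have : IsDef D fun i c => Q i (restPoint (fst c) (fst (snd (snd (snd (fst c))))))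
    (restPoint (snd c) (fst (snd (snd (snd (snd c)))))) :=
      hQ.comp₂ (P := Q) inferInstance inferInstance
  have : IsDef D fun i c => S i (restPoint (fst c) (snd (snd (snd (snd (fst c))))))
    (restPoint (snd c) (snd (snd (snd (snd (snd c)))))) :=
      hS.comp₂ (P := S) inferInstance inferInstance
  refine ⟨fun i p q =>
    Q i (restPoint p (fst (snd (snd (snd p))))) (restPoint q (fst (snd (snd (snd q))))) ∨
    S i (restPoint p (snd (snd (snd (snd p))))) (restPoint q (snd (snd (snd (snd q))))) ∨
    ¬ (fst (snd (snd p)) = 0 ↔ fst (fst (snd (snd (snd p)))) = 0 ∧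
      fst (snd (snd (snd (snd p)))) = 0),
    inferInstance, fun i => ⟨?_, ?_⟩⟩
  · intro X g hg c
    have h1 := fun c => restPoint_graphPoint (X : Set (𝓜 i).Dom) g c fun c => fst (snd (g c))
    have h2 := fun c => restPoint_graphPoint (X : Set (𝓜 i).Dom) g c fun c => snd (snd (g c))
    simp only [snd_snd_graphPoint, h1, h2, not_or, not_not] at hg
    exact (hg c c).2.2.trans (and_congr ((hPQ i).sound X _ (fun c d => (hg c d).1) c)
      ((hRS i).sound X _ (fun c d => (hg c d).2.1) c))
  · intro X
    obtain ⟨g, hg, hgQ⟩ := (hPQ i).complete X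
    obtain ⟨k, hk, hkS⟩ := (hRS i).complete X
    let h := fun c => pair (if fst (g c) = 0 ∧ fst (k c) = 0 then 0 else 1) (pair (g c) (k c))
    refine ⟨h, inferInstanceAs (IsFn _ fun _ c => pair (if fst (g c) = 0 ∧ fst (k c) = 0 then 0
      else 1) (pair (g c) (k c))), ?_⟩
    intro c d
    have h1 := fun c => restPoint_graphPoint (X : Set (𝓜 i).Dom) h c g
    have h2 := fun c => restPoint_graphPoint (X : Set (𝓜 i).Dom) h c k
    simp only [snd_snd_graphPoint, h, snd_pair, fst_pair] at h1 h2 ⊢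
    simp [h1, h2, hgQ, hkS]

/-- The last component of the new points consists of the value of a Skolem function and the
old component. -/
theorem all (hP : Representable D P) :
    Representable D fun i X c => ∀ x, P i X (pair c x) := by
  classical
  obtain ⟨Q, hQ, hPQ⟩ := hP
  have : IsDef D fun i c => Q i (restPoint (fst c) (snd (snd (snd (snd (fst c))))))
    (restPoint (snd c) (snd (snd (snd (snd (snd c)))))) :=
      hQ.comp₂ (P := Q) inferInstance inferInstance
  -- The constraint is violated if the old constraint is, if c is declared true while some (c, x) is
  -- declared false, or if c is declared false while its Skolem value x has (c, x) declared true.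
  refine ⟨fun i p q =>
    Q i (restPoint p (snd (snd (snd (snd p))))) (restPoint q (snd (snd (snd (snd q))))) ∨
    (fst (snd (snd p)) = 0 ∧ fst q = pair (fst p) (snd (fst q)) ∧
      ¬ fst (snd (snd (snd (snd q)))) = 0) ∨
    (¬ fst (snd (snd p)) = 0 ∧ fst q = pair (fst p) (fst (snd (snd (snd p)))) ∧
      fst (snd (snd (snd (snd q)))) = 0),
    inferInstance, fun i => ⟨?_, ?_⟩⟩
  · intro X g hg c
    have h1 := fun c => restPoint_graphPoint (X : Set (𝓜 i).Dom) g c fun c => snd (snd (g c))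
    simp only [snd_snd_graphPoint, h1, fst_graphPoint, not_or, not_and, not_not] at hg
    have h2 := (hPQ i).sound X _ fun c d => (hg c d).1
    simp only [← h2]
    constructor
    · intro h x
      exact (hg c (pair c x)).2.1 h (by simp)
    · intro h
      by_contra hn
      exact (hg c _).2.2 hn rfl (h _)
  · intro X
    obtain ⟨g, hg, hgQ⟩ := (hPQ i).complete X
    let s := fun c => mu fun x => ¬ fst (g (pair c x)) = 0
    let h := fun c => pair (if ∀ x, fst (g (pair c x)) = 0 then 0 else 1) (pair (s c) (g c))
    refine ⟨h, ?_, ?_⟩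
    · have : IsFn (𝓜 i).setClass fun _ => s := inferInstanceAs (IsFn _ fun _ c => mu fun x =>
        ¬ fst (g (pair c x)) = 0)
      exact inferInstanceAs (IsFn _ fun _ c => pair (if ∀ x, fst (g (pair c x)) = 0 then 0 else 1)
        (pair (s c) (g c)))
    · intro c d
      have h1 := fun c => restPoint_graphPoint (X : Set (𝓜 i).Dom) h c g
      simp only [snd_snd_graphPoint, h, snd_pair, fst_pair] at h1 ⊢
      simp only [h1, hgQ, fst_graphPoint, false_or, not_or, not_and, not_not]
      constructor
      · intro h e
        rw [e]
        exact (by simpa using h : ∀ x, fst (g (pair c x)) = 0) _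
      · intro h e
        obtain ⟨x, hx⟩ : ∃ x, ¬ fst (g (pair c x)) = 0 := by simpa using h
        rw [e]
        exact (mu_spec (fun x => ¬ fst (g (pair c x)) = 0) hx).1

/-- Induction on the formula, with X as set variable 0. Atomic formulas not mentioning X are handled
by `of_isDef`, membership in X by `mem`; under a quantifier the bound value is packed into the
argument as its second component. -/
theorem sat {φ : L2Formula} (hφ : φ.IsArithmetical) {V : ∀ i, ℕ → (𝓜 i).sets}
    (hV : ∀ n, IsDefSet D fun i _ => (V i n : Set (𝓜 i).Dom))
    {δ : ∀ i, (𝓜 i).Dom → ℕ → (𝓜 i).Dom} (hδ : ∀ n, IsFn D fun i c => δ i c n)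
    (hδ' : ∀ i n, IsFn (𝓜 i).setClass fun _ c => δ i c n) :
    Representable D fun i X c => φ.Sat (𝓜 i) (δ i c) (vcons X (V i)) := by
  have hV' : ∀ i n, IsDefSet (𝓜 i).setClass fun _ _ => (V i n : Set (𝓜 i).Dom) :=
    fun i n => isDefSet_of_mem (V i n).2
  induction φ generalizing δ with
  | eq s t =>
    change Representable D fun i _ c => (L2Formula.eq s t).Sat (𝓜 i) (δ i c) (V i)
    exact of_isDef (IsDef.sat hφ hV hδ) fun i => IsDef.sat hφ (hV' i) (hδ' i)
  | lt s t =>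
    change Representable D fun i _ c => (L2Formula.lt s t).Sat (𝓜 i) (δ i c) (V i)
    exact of_isDef (IsDef.sat hφ hV hδ) fun i => IsDef.sat hφ (hV' i) (hδ' i)
  | mem t n =>
    cases n with
    | zero => exact mem (IsFn.eval t hδ) fun i => IsFn.eval t (hδ' i)
    | succ n =>
      change Representable D fun i _ c => (L2Formula.mem t n).Sat (𝓜 i) (δ i c) (V i)
      exact of_isDef (IsDef.sat (φ := .mem t n) hφ hV hδ) fun i => IsDef.sat (φ := .mem t n) hφ (hV' i) (hδ' i)
  | neg φ ih => exact not (ih hφ hδ hδ')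
  | and φ ψ ih₁ ih₂ => exact and (ih₁ hφ.1 hδ hδ') (ih₂ hφ.2 hδ hδ')
  | allN φ ih =>
    have := all (ih (δ := fun i c => vcons (snd c) (δ i (fst c))) hφ
      (by
        rintro (_ | n)
        · exact (inferInstance : IsFn D fun _ c => snd c)
        · exact (hδ n).comp (IsFn.fst (hs := IsFn.id)))
      (by
        rintro i (_ | n)
        · exact (inferInstance : IsFn (𝓜 i).setClass fun _ c => snd c)
        · exact (hδ' i n).comp (IsFn.fst (hs := IsFn.id))))
    simpa only [fst_pair, snd_pair, Sat] using this
  | allS φ => exact hφ.elim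

end Representable

end

/-! ### Constraint trees -/

namespace L2Structure

/-- The tree of the finite sequences any two points of whose graph satisfy `R`. -/
def constraintTree {𝓜 : L2Structure.{u}} (R : 𝓜.Dom → 𝓜.Dom → Prop) : Set 𝓜.Dom :=
  {s | s ∈ 𝓜.finSeqs ∧ ∀ a x b y, HasEntry s a x → HasEntry s b y → R (pair a x) (pair b y)}

variable {𝓜 : L2Structure.{u}} [hM : Fact 𝓜.ModelsRCA0] [hA : 𝓜.setClass.Arithmetical]

theorem isTree_constraintTree (R : 𝓜.Dom → 𝓜.Dom → Prop) : IsTree (constraintTree R) :=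
  ⟨fun _ h => h.1, fun _ hσ _ hτ h =>
    ⟨hτ, fun a x b y ha hb => hσ.2 a x b y (h _ _ ha) (h _ _ hb)⟩⟩

/-- Any two points of a function are visible in its restriction to max a b + 1, so pairwise
constraints on finite sequences pass to branches and back. -/
theorem isWellFounded_constraintTree {R : 𝓜.Dom → 𝓜.Dom → Prop} :
    IsWellFounded (constraintTree R) ↔ ¬ ∃ f : 𝓜.Dom → 𝓜.Dom, IsFn 𝓜.setClass (fun _ => f) ∧
      ∀ a b, R (pair a (f a)) (pair b (f b)) := by
  refine not_congr ⟨?_, ?_⟩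
  · rintro ⟨F, hF, hFf, hbr⟩
    have := isDefSet_of_mem hF
    have happ : ∀ a, pair a (app F a) ∈ F := fun a => (app_mem hFf trivial).1
    refine ⟨app F, ⟨?_⟩, fun a b => ?_⟩
    · refine (IsDef.congr (P := fun _ c => pair (fst c) (snd c) ∈ F)
        (Q := fun _ c => snd c = app F (fst c)) inferInstance
        fun _ c => ⟨fun h => ?_, fun h => h ▸ happ _⟩).out
      obtain ⟨_, _, hu⟩ := hFf.2 (fst c) trivial
      exact (hu _ h).trans (hu _ (happ _)).symm
    · obtain ⟨σ, hσ, hl, h⟩ := hbr (max a b + 1)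
      exact hσ.2 _ _ _ _ ((h a (lt_succ_iff.2 (le_max_left _ _)) _).2 (happ a))
        ((h b (lt_succ_iff.2 (le_max_right _ _)) _).2 (happ b))
  · rintro ⟨f, hf, hR⟩
    have : IsFn 𝓜.setClass fun _ c => f (fst c) := hf.comp inferInstance
    refine ⟨{p | snd p = f (fst p) ∧ p = pair (fst p) (snd p)}, mem_sets _, ⟨?_, ?_⟩, fun n => ?_⟩
    · exact fun p hp => ⟨_, trivial, _, trivial, hp.2⟩
    · exact fun a _ => ⟨f a, by simp, fun b hb => by simpa using hb⟩
    · obtain ⟨σ, hσ, hl, h⟩ := exists_seq (fun i v => v = f i) n fun i _ => ⟨_, rfl⟩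
      have key : ∀ i v, HasEntry σ i v → v = f i := fun i v hv => by
        obtain ⟨w, hw, e⟩ := h i (hv.lt_length hl)
        exact (hv.unique hw).trans e
      refine ⟨σ, ⟨hσ, fun a x b y ha hb => ?_⟩, hl, fun i hi v => ?_⟩
      · rw [key a x ha, key b y hb]
        exact hR a b
      · simp only [Set.mem_ofPred_eq, snd_pair, fst_pair, and_true]
        refine ⟨key i v, ?_⟩
        rintro rfl
        obtain ⟨w, hw, rfl⟩ := h i hi
        exact hw

end L2Structure

section

variable {ι : Type w} {𝓜 : ι → L2Structure.{u}} {D : DefClass 𝓜}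
  [hM : ∀ i, Fact (𝓜 i).ModelsRCA0]

instance IsDefSet.constraintTree {R : ∀ i, (𝓜 i).Dom → (𝓜 i).Dom → Prop}
    [hD : D.Arithmetical] [hR : IsDef D fun i c => R i (fst c) (snd c)] :
    IsDefSet D fun i _ => L2Structure.constraintTree (R i) := by
  have : IsDef D fun i c => R i
      (pair (snd (fst (fst (fst c)))) (snd (fst (fst c)))) (pair (snd (fst c)) (snd c)) :=
    hR.comp₂ (P := R) inferInstance inferInstance
  unfold L2Structure.constraintTree
  infer_instance

/-- A representable predicate holds of all sets at `0` iff a definable tree is well founded. -/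
theorem Representable.exists_tree [hD : D.Arithmetical] [hA : ∀ i, (𝓜 i).setClass.Arithmetical]
    {P : ∀ i, (𝓜 i).sets → (𝓜 i).Dom → Prop} (hP : Representable D P) :
    ∃ T : ∀ i, Set (𝓜 i).Dom, IsDefSet D (fun i _ => T i) ∧
      ∀ i, IsTree (T i) ∧ (IsWellFounded (T i) ↔ ∀ X, P i X 0) := by
  classical
  obtain ⟨Q, hQ, hPQ⟩ := hP
  -- A branch has values (χ, w). The three clauses say that the representing constraint holds, that
  -- the truth value at 0 is false, and that χ is 0 or 1, so that it decodes to a set X.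
  refine ⟨fun i => constraintTree fun p q => ¬ Q i p q ∧ (fst p = 0 → ¬ fst (snd (snd p)) = 0) ∧
    (snd p = pair 0 (snd (snd p)) ∨ snd p = pair 1 (snd (snd p))), inferInstance, fun i =>
    ⟨isTree_constraintTree _, isWellFounded_constraintTree.trans ?_⟩⟩
  rw [← not_forall_not, not_not]
  constructor
  · intro h X
    by_contra hn
    obtain ⟨g, hg, hgQ⟩ := (hPQ i).complete X
    have := isDefSet_of_mem X.2
    refine h (fun c => pair (if c ∈ (X : Set (𝓜 i).Dom) then 0 else 1) (g c))
      ⟨inferInstance, fun a b => ⟨hgQ a b, ?_, ?_⟩⟩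
    · simp only [fst_pair, snd_pair]
      rintro rfl h0
      exact hn (((hPQ i).sound X g hgQ 0).1 h0)
    · split_ifs <;> simp
  · rintro h f ⟨hf, hfR⟩
    let X : (𝓜 i).sets := ⟨{c | fst (f c) = 0}, mem_sets _⟩
    have hfX : ∀ c, graphPoint X (fun c => snd (f c)) c = pair c (f c) := by
      intro c
      have h1 := (hfR c c).2.2
      simp only [snd_pair] at h1
      have h2 : fst (f c) = 0 ∨ fst (f c) = 1 := h1.imp (fun h => by rw [h, fst_pair])
        fun h => by rw [h, fst_pair]
      have h3 : f c = pair (fst (f c)) (snd (f c)) := by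
        rcases h1 with h1 | h1 <;> rw [h1] <;> simp
      rw [graphPoint]
      conv_rhs => rw [h3]
      congr 2
      obtain h2 | h2 := h2 <;> simp [X, h2]
    have h1 := ((hPQ i).sound X (fun c => snd (f c))
      (fun c d => by rw [hfX, hfX]; exact (hfR c d).1) 0).2 (h X)
    have h2 := (hfR 0 0).2.1
    simp only [fst_pair, snd_pair] at h2
    exact h2 trivial h1

end

/-! ## Definability of completeness -/

/-- A definable family of rational numbers. -/
class IsRatFn {ι : Type w} {𝓜 : ι → L2Structure.{u}} (D : DefClass 𝓜)
    (q : ∀ i, (𝓜 i).Dom → (𝓜 i).PreRat) : Prop where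
  p : IsFn D fun i c => (q i c).p
  n : IsFn D fun i c => (q i c).n
  d : IsFn D fun i c => (q i c).d

namespace L2Structure

variable {𝓜 : L2Structure.{u}}

/-- The least `b` with `(a, b)` in `F`. -/
noncomputable def leastApp (F : Set 𝓜.Dom) (a : 𝓜.Dom) : 𝓜.Dom := mu fun b => pair a b ∈ F

/-- The `k`-th approximation of the distance of `x` and `y`. -/
noncomputable def distApprox (D : Set 𝓜.Dom) (x y k : 𝓜.Dom) : 𝓜.PreRat :=
  ⟨fst (fst (leastApp D (pair (pair x y) k))), snd (fst (leastApp D (pair (pair x y) k))),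
    snd (leastApp D (pair (pair x y) k))⟩

variable [hM : Fact 𝓜.ModelsRCA0] {X D F A B : Set 𝓜.Dom}

/-- `app` and `dist` use a choice operator with no arithmetical definition; `leastApp` and
`distApprox` are definable replacements that agree with them where the coded object is a function.
-/
theorem leastApp_eq (hF : IsFun F A B) {a : 𝓜.Dom} (ha : a ∈ A) : leastApp F a = app F a := by
  obtain ⟨b, hb, hu⟩ := hF.2 a ha
  rw [app_eq hb hu]
  exact mu_eq hb hu

theorem distApprox_eq (hD : IsFun D (prodSet (prodSet X X) Set.univ) 𝓜.ratCodes) {x y : 𝓜.Dom}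
    (hx : x ∈ X) (hy : y ∈ X) : distApprox D x y = dist D x y := by
  funext k
  have hk : pair (pair x y) k ∈ prodSet (prodSet X X) Set.univ :=
    ⟨_, ⟨x, hx, y, hy, rfl⟩, k, trivial, rfl⟩
  obtain ⟨q, -, hq⟩ := (app_mem hD hk).2
  have h1 : dist D x y k = q := PreRat.code_inj ((Classical.epsilon_spec
    (p := fun q : 𝓜.PreRat => app D (pair (pair x y) k) = q.code) ⟨_, hq⟩).symm.trans hq)
  rw [h1, distApprox, leastApp_eq hD hk, hq]
  simp [PreRat.code]

/-- If `F` is a Cauchy sequence in `X`, it converges in `X`. -/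
def ConvergesIfCauchy (X D F : Set 𝓜.Dom) : Prop :=
  IsFun F Set.univ X → IsCauchy D F → ∃ x ∈ X, ConvergesTo D F x

theorem isMetricSpace_iff : IsMetricSpace X D ↔
    IsFun D (prodSet (prodSet X X) Set.univ) 𝓜.ratCodes ∧
    ∀ x, x ∈ X → ∀ y, y ∈ X →
      IsReal (distApprox D x y) ∧ realLE (fun _ => PreRat.zero) (distApprox D x y) ∧
      (realEq (distApprox D x y) (fun _ => PreRat.zero) ↔ x = y) ∧
      realEq (distApprox D x y) (distApprox D y x) ∧
      ∀ z, z ∈ X → realLE (distApprox D x z) (realAdd (distApprox D x y) (distApprox D y z)) := by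
  constructor
  · intro h
    refine ⟨h.isFun, fun x hx y hy => ?_⟩
    rw [distApprox_eq h.isFun hx hy, distApprox_eq h.isFun hy hx]
    refine ⟨h.isReal x hx y hy, h.nonneg x hx y hy, h.eq_zero_iff x hx y hy, h.symm x hx y hy,
      fun z hz => ?_⟩
    rw [distApprox_eq h.isFun hx hz, distApprox_eq h.isFun hy hz]
    exact h.triangle x hx y hy z hz
  · rintro ⟨hD, h⟩
    refine ⟨hD, ?_, ?_, ?_, ?_, ?_⟩ <;> intro x hx y hy <;> have h := h x hx y hy <;>
      rw [distApprox_eq hD hx hy] at h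
    · exact h.1
    · exact h.2.1
    · exact h.2.2.1
    · rw [distApprox_eq hD hy hx] at h
      exact h.2.2.2.1
    · intro z hz
      have h := h.2.2.2.2 z hz
      rwa [distApprox_eq hD hx hz, distApprox_eq hD hy hz] at h

theorem convergesIfCauchy_iff (hD : IsFun D (prodSet (prodSet X X) Set.univ) 𝓜.ratCodes) :
    ConvergesIfCauchy X D F ↔ (IsFun F Set.univ X →
      (∀ k, ∃ N, ∀ m, ∀ n, N ≤ m → N ≤ n →
        realLT (distApprox D (leastApp F m) (leastApp F n)) (fun _ => PreRat.unitFrac k)) →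
      ∃ x, x ∈ X ∧ ∀ k, ∃ N, ∀ n, N ≤ n →
        realLT (distApprox D (leastApp F n) x) (fun _ => PreRat.unitFrac k)) := by
  refine forall_congr' fun hF => ?_
  have hX : ∀ n, app F n ∈ X := fun n => (app_mem hF trivial).2
  have h1 : ∀ n, leastApp F n = app F n := fun n => leastApp_eq hF trivial
  simp only [h1]
  refine imp_congr ?_ ?_
  · simp only [IsCauchy, distApprox_eq hD (hX _) (hX _)]
  · refine exists_congr fun x => and_congr_right fun hx => ?_
    simp only [ConvergesTo, distApprox_eq hD (hX _) hx]

end L2Structure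

section

variable {ι : Type w} {𝓜 : ι → L2Structure.{u}} {D : DefClass 𝓜} [hD : D.Arithmetical]
  [hM : ∀ i, Fact (𝓜 i).ModelsRCA0] {s t r : ∀ i, (𝓜 i).Dom → (𝓜 i).Dom}
  {A B F : ∀ i, (𝓜 i).Dom → Set (𝓜 i).Dom}

instance IsFn.leastApp [IsDefSet D F] [IsFn D s] :
    IsFn D (fun i c => leastApp (F i c) (s i c)) := by
  unfold L2Structure.leastApp; infer_instance

namespace IsRatFn

attribute [instance] IsRatFn.p IsRatFn.n IsRatFn.d

variable {q q' : ∀ i, (𝓜 i).Dom → (𝓜 i).PreRat} [hq : IsRatFn D q] [hq' : IsRatFn D q']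

theorem comp {q : ∀ i, (𝓜 i).Dom → (𝓜 i).PreRat} (h : IsRatFn D q) (ht : IsFn D t) :
    IsRatFn D fun i c => q i (t i c) :=
  ⟨h.p.comp ht, h.n.comp ht, h.d.comp ht⟩

instance zero : IsRatFn D fun _ _ => PreRat.zero := by
  constructor <;> simp only [PreRat.zero] <;> infer_instance

instance unitFrac [IsFn D s] : IsRatFn D fun i c => PreRat.unitFrac (s i c) := by
  constructor <;> simp only [PreRat.unitFrac] <;> infer_instance

instance add : IsRatFn D fun i c => (q i c).add (q' i c) := by
  constructor <;> simp only [PreRat.add] <;> infer_instance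

instance distApprox [IsDefSet D A] [IsFn D s] [IsFn D t] [IsFn D r] :
    IsRatFn D fun i c => distApprox (A i c) (s i c) (t i c) (r i c) := by
  constructor <;> simp only [L2Structure.distApprox] <;> infer_instance

theorem comp₂ {x : ∀ i, (𝓜 i).Dom → (𝓜 i).Dom → (𝓜 i).PreRat}
    (hx : IsRatFn D fun i c => x i (fst c) (snd c)) (hs : IsFn D s) (ht : IsFn D t) :
    IsRatFn D fun i c => x i (s i c) (t i c) := by
  simpa using hx.comp (inferInstance : IsFn D fun i c => pair (s i c) (t i c))

instance realAdd {x y : ∀ i, (𝓜 i).Dom → (𝓜 i).Dom → (𝓜 i).PreRat}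
    [hx : IsRatFn D fun i c => x i (fst c) (snd c)]
    [hy : IsRatFn D fun i c => y i (fst c) (snd c)] [IsFn D s] :
    IsRatFn D fun i c => realAdd (x i c) (y i c) (s i c) := by
  have : IsRatFn D fun i c => x i c (s i c + s i c + 1) := hx.comp₂ inferInstance inferInstance
  have : IsRatFn D fun i c => y i c (s i c + s i c + 1) := hy.comp₂ inferInstance inferInstance
  unfold L2Structure.realAdd; infer_instance

end IsRatFn

namespace IsDef

variable {q q' : ∀ i, (𝓜 i).Dom → (𝓜 i).PreRat}
  {x y : ∀ i, (𝓜 i).Dom → (𝓜 i).Dom → (𝓜 i).PreRat}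

instance ratLE [IsRatFn D q] [IsRatFn D q'] : IsDef D fun i c => (q i c).le (q' i c) := by
  unfold PreRat.le; infer_instance

instance realLE [hx : IsRatFn D fun i c => x i (fst c) (snd c)]
    [hy : IsRatFn D fun i c => y i (fst c) (snd c)] :
    IsDef D fun i c => realLE (x i c) (y i c) := by
  unfold L2Structure.realLE; infer_instance

instance realLT [hx : IsRatFn D fun i c => x i (fst c) (snd c)]
    [hy : IsRatFn D fun i c => y i (fst c) (snd c)] :
    IsDef D fun i c => realLT (x i c) (y i c) := by
  unfold L2Structure.realLT; infer_instance

instance realEq [hx : IsRatFn D fun i c => x i (fst c) (snd c)]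
    [hy : IsRatFn D fun i c => y i (fst c) (snd c)] :
    IsDef D fun i c => realEq (x i c) (y i c) := by
  unfold L2Structure.realEq; infer_instance

instance isMetricSpace [IsDefSet D A] [IsDefSet D B] :
    IsDef D fun i c => IsMetricSpace (A i c) (B i c) := by
  simp only [isMetricSpace_iff, IsReal]
  infer_instance

/-- The conjunction matters: the arithmetical rewriting of convergence is valid only when D really
is a distance function. -/
instance isMetricSpace_and_convergesIfCauchy [IsDefSet D A] [IsDefSet D B] [IsDefSet D F] :
    IsDef D fun i c => IsMetricSpace (A i c) (B i c) ∧
      ConvergesIfCauchy (A i c) (B i c) (F i c) := by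
  refine IsDef.congr (P := fun i c => IsMetricSpace (A i c) (B i c) ∧ _) ?_ fun i c =>
    and_congr_right fun h => (convergesIfCauchy_iff h.isFun).symm
  infer_instance

end IsDef

end

/-! ## Universality over `ACA₀` -/

/-- A model of `ACA₀` with values of all variables. -/
structure ACA0Env where
  model : L2Structure.{u}
  modelsACA0 : model.ModelsACA0
  num : ℕ → model.Dom
  set : ℕ → model.sets

namespace ACA0Env

instance (e : ACA0Env.{u}) : Fact e.model.ModelsACA0 := ⟨e.modelsACA0⟩

/-- The predicates which are arithmetical uniformly in the model and the parameters. -/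
def arith : DefClass model.{u} := formulaClass num set

instance : arith.{u}.Arithmetical := inferInstanceAs (formulaClass num set).Arithmetical

instance (n : ℕ) : IsFn arith.{u} fun e _ => e.num n := IsFn.formulaClass_param n

instance (n : ℕ) : IsDefSet arith.{u} fun e _ => (e.set n : Set e.model.Dom) :=
  IsDefSet.formulaClass_param n

theorem exists_formula (P : ∀ e : ACA0Env.{u}, e.model.Dom → Prop) [h : IsDef arith P] :
    ∃ φ : L2Formula, φ.IsArithmetical ∧ ∀ (e : ACA0Env.{u}) c,
      φ.Sat e.model (vcons c e.num) e.set ↔ P e c :=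
  IsDef.exists_formula h

theorem mem_sets (P : ∀ e : ACA0Env.{u}, e.model.Dom → Prop) [h : IsDef arith P]
    (e : ACA0Env.{u}) : {c | P e c} ∈ e.model.sets := by
  obtain ⟨φ, hφ, hP⟩ := exists_formula P
  obtain ⟨X, hX, hX'⟩ := e.modelsACA0.comprehension φ hφ e.num e.set
  have : {c | P e c} = X := by ext c; rw [hX']; exact (hP e c).symm
  rwa [this]

end ACA0Env

namespace L2Structure

/-- The set coding the pair `(X, D)`. -/
def pairSet {𝓜 : L2Structure.{u}} (X D : Set 𝓜.Dom) : Set 𝓜.Dom :=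
  {c | (c = pair 0 (snd c) ∧ snd c ∈ X) ∨ (c = pair 1 (snd c) ∧ snd c ∈ D)}

section

variable {𝓜 : L2Structure.{u}} [hM : Fact 𝓜.ModelsRCA0] (X D : Set 𝓜.Dom)

@[simp] theorem sec_pairSet_zero : sec (pairSet X D) 0 = X := by
  ext x; simp [sec, pairSet, pair_inj]

@[simp] theorem sec_pairSet_one : sec (pairSet X D) 1 = D := by
  ext x; simp [sec, pairSet, pair_inj]

end

end L2Structure

instance IsDefSet.pairSet {ι : Type w} {𝓜 : ι → L2Structure.{u}} {D : DefClass 𝓜}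
    [hM : ∀ i, Fact (𝓜 i).ModelsRCA0] {A B : ∀ i, (𝓜 i).Dom → Set (𝓜 i).Dom}
    [IsDefSet D A] [IsDefSet D B] : IsDefSet D (fun i c => pairSet (A i c) (B i c)) := by
  unfold L2Structure.pairSet; infer_instance

namespace L2Structure

theorem isPi11UniversalOverACA0_isCompleteMetric :
    IsPi11UniversalOverACA0.{u} (fun _ Z => CodesMetricSpace Z)
      (fun _ Z => IsCompleteMetric (sec Z 0) (sec Z 1)) := by
  constructor
  -- Set variable 0 is the sequence to be quantified, so the code of the space moves to set variable
  -- 1.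
  · obtain ⟨φ, hφ, h⟩ := ACA0Env.exists_formula fun e _ =>
      IsMetricSpace (sec (e.set 1 : Set e.model.Dom) 0) (sec (e.set 1 : Set e.model.Dom) 1) ∧
        ConvergesIfCauchy (sec (e.set 1 : Set e.model.Dom) 0)
          (sec (e.set 1 : Set e.model.Dom) 1) (e.set 0 : Set e.model.Dom)
    refine ⟨allS φ, ⟨φ, hφ, rfl⟩, fun 𝓜 hM v V => ?_⟩
    have key := fun F : 𝓜.sets => h ⟨𝓜, hM, fun n => v (n + 1), vcons F V⟩ (v 0)
    simp only [vcons_eta] at key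
    simp only [Sat, key]
    exact ⟨fun h => ⟨(h (V 0)).1, fun F hF => (h ⟨F, hF⟩).2⟩,
      fun h F => ⟨h.1, h.2 F F.2⟩⟩
  · rintro _ ⟨φ, hφ, rfl⟩
    have hR : Representable ACA0Env.arith.{u} fun e X _ => φ.Sat e.model e.num (vcons X e.set) :=
      Representable.sat (𝓜 := ACA0Env.model) (V := ACA0Env.set) (δ := fun e _ => e.num) hφ
        (fun n => inferInstance) (fun n => inferInstance) (fun e n => inferInstance)
    obtain ⟨T, hT, hTree⟩ := hR.exists_tree
    obtain ⟨θ, hθ, h⟩ := ACA0Env.exists_formula fun e c =>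
      c ∈ pairSet (T e) (ultraDist (T e) firstDiff)
    refine ⟨θ, hθ, fun 𝓜 hM v V => ?_⟩
    have : Fact 𝓜.ModelsACA0 := ⟨hM⟩
    let e : ACA0Env.{u} := ⟨𝓜, hM, v, V⟩
    have hZ : {m | θ.Sat 𝓜 (vcons m v) V} = pairSet (T e) (ultraDist (T e) firstDiff) :=
      Set.ext (h e)
    obtain ⟨hTe, hTe'⟩ := hTree e
    rw [hZ]
    simp only [CodesMetricSpace, sec_pairSet_zero, sec_pairSet_one]
    refine ⟨isMetricSpace_ultraDist (isUltra_firstDiff hTe), ?_⟩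
    have hTs : T e ∈ 𝓜.sets := ACA0Env.mem_sets (fun e c => c ∈ T e) e
    rw [isCompleteMetric_iff_isWellFounded hTs hTe, hTe']
    rfl

/-! ## Reversals over `RCA₀` -/

/-- The set coding the sequence `A` of sets. -/
def seqSet {𝓜 : L2Structure.{u}} (A : 𝓜.Dom → Set 𝓜.Dom) : Set 𝓜.Dom := {c | snd c ∈ A (fst c)}

variable {𝓜 : L2Structure.{u}} [hM : Fact 𝓜.ModelsRCA0]

@[simp] theorem sec_seqSet (A : 𝓜.Dom → Set 𝓜.Dom) (n : 𝓜.Dom) : sec (seqSet A) n = A n := by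
  ext x; simp [sec, seqSet]

theorem seqSet_mem_sets (A : 𝓜.Dom → Set 𝓜.Dom) [h : IsDefSet 𝓜.setClass fun _ => A] :
    seqSet A ∈ 𝓜.sets := h.out

/-- `Π¹₁` comprehension for predicates whose matrix is arithmetical uniformly in the set
variable. -/
theorem Pi11Comprehension.mem_sets (h : 𝓜.Pi11Comprehension) {v : ℕ → 𝓜.Dom} {V : ℕ → 𝓜.sets}
    (P : 𝓜.sets → 𝓜.Dom → Prop)
    [hP : IsDef (formulaClass (𝓜 := fun _ : 𝓜.sets => 𝓜) (fun _ => v) (fun Y => vcons Y V)) P] :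
    {c | ∀ Y, P Y c} ∈ 𝓜.sets := by
  obtain ⟨φ, hφ, hP⟩ := hP.exists_formula
  obtain ⟨X, hX, hX'⟩ := h (allS φ) ⟨φ, hφ, rfl⟩ v V
  have : {c | ∀ Y, P Y c} = X := by
    ext c
    rw [hX']
    exact forall_congr' fun Y => (hP Y c).symm
  rwa [this]

/-- The family of structures is the constant family indexed by the quantified set Y, so that one
arithmetical matrix serves all Y. The argument needs only `RCA₀` for the matrix. -/
theorem Pi11Comprehension.scatteredIndexSets (h : 𝓜.Pi11Comprehension) :
    𝓜.ScatteredIndexSets := by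
  intro X hX U hU _ _ _
  let V : ℕ → 𝓜.sets := vcons ⟨X, hX⟩ fun _ => ⟨U, hU⟩
  let D := formulaClass (𝓜 := fun _ : 𝓜.sets => 𝓜) (fun _ _ => 0) (fun Y => vcons Y V)
  have : IsDefSet D (fun Y _ => (Y : Set 𝓜.Dom)) := IsDefSet.formulaClass_param 0
  have : IsDefSet D (fun _ _ => X) := IsDefSet.formulaClass_param 1
  have : IsDefSet D (fun _ _ => U) := IsDefSet.formulaClass_param 2
  have : D.Arithmetical := inferInstanceAs (formulaClass _ _).Arithmetical
  have hP : IsDef D fun Y c => (Y : Set 𝓜.Dom) ⊆ sec X c → (∃ y, y ∈ (Y : Set 𝓜.Dom)) →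
      ∃ y, y ∈ (Y : Set 𝓜.Dom) ∧ ∃ i, ∀ x, x ∈ sec (sec U c) i ∧ x ∈ (Y : Set 𝓜.Dom) ↔ x = y :=
    inferInstance
  have := h.mem_sets (hP := hP)
  simpa [IsScattered, Set.ext_iff, Set.Nonempty] using this

theorem Pi11Comprehension.completeIndexSets (h : 𝓜.Pi11Comprehension) :
    𝓜.CompleteIndexSets := by
  intro X hX D hD hmet
  let V : ℕ → 𝓜.sets := vcons ⟨X, hX⟩ fun _ => ⟨D, hD⟩
  let C := formulaClass (𝓜 := fun _ : 𝓜.sets => 𝓜) (fun _ _ => 0) (fun Y => vcons Y V)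
  have : IsDefSet C (fun Y _ => (Y : Set 𝓜.Dom)) := IsDefSet.formulaClass_param 0
  have : IsDefSet C (fun _ _ => X) := IsDefSet.formulaClass_param 1
  have : IsDefSet C (fun _ _ => D) := IsDefSet.formulaClass_param 2
  have : C.Arithmetical := inferInstanceAs (formulaClass _ _).Arithmetical
  have hP : IsDef C fun Y c => IsMetricSpace (sec X c) (sec D c) ∧
    ConvergesIfCauchy (sec X c) (sec D c) Y := inferInstance
  have := h.mem_sets (hP := hP)
  simpa [hmet, ConvergesIfCauchy, IsCompleteMetric] using this

/-- A two point space for each `n`, whose points are separated from `i` on if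
`(n, w) ∈ A` for some `w < i`. -/
theorem ScatteredIndexSets.modelsACA0 (h : 𝓜.ScatteredIndexSets) : 𝓜.ModelsACA0 := by
  classical
  have : 𝓜.setClass.Arithmetical := arithmetical_of_projection fun A hA => by
    have := isDefSet_of_mem hA
    let X (_ : 𝓜.Dom) : Set 𝓜.Dom := {x | x = 0 ∨ x = 1}
    let U (n : 𝓜.Dom) : Set 𝓜.Dom := {p | snd p = 0 ∨ snd p = 1 ∧ ∀ w, w < fst p → pair n w ∉ A}
    -- The basic sets decrease with their index, so the larger of the two indices serves for the
    -- intersection.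
    let K (_ : 𝓜.Dom) : Set 𝓜.Dom := {p | p = pair (pair (fst (fst p)) (pair (fst (snd (fst p)))
      (snd (snd (fst p))))) (if fst (snd (fst p)) < snd (snd (fst p)) then snd (snd (fst p))
        else fst (snd (fst p))) ∧ (fst (fst p) = 0 ∨ fst (fst p) = 1)}
    have hXd : IsDefSet 𝓜.setClass fun _ => X := inferInstanceAs (IsDefSet _ fun _ _ => {x | _})
    have hUd : IsDefSet 𝓜.setClass fun _ => U := inferInstanceAs (IsDefSet _ fun _ _ => {x | _})
    have hKd : IsDefSet 𝓜.setClass fun _ => K := inferInstanceAs (IsDefSet _ fun _ _ => {x | _})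
    have hU0 : ∀ n i, 0 ∈ sec (U n) i := fun n i => by simp [sec, U]
    have hU1 : ∀ n i, 1 ∈ sec (U n) i ↔ ∀ w, w < i → pair n w ∉ A := fun n i => by simp [sec, U]
    have hUX : ∀ n i, sec (U n) i ⊆ X n := fun n i x hx => by
      simp only [sec, U, Set.mem_ofPred_eq, snd_pair] at hx
      exact hx.imp id And.left
    have hanti : ∀ n i j, i ≤ j → sec (U n) j ⊆ sec (U n) i := by
      intro n i j hij x hx
      obtain rfl | rfl := hUX n j hx
      · exact hU0 n i
      · exact (hU1 n i).2 fun w hw => (hU1 n j).1 hx w (hw.trans_le hij)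
    have hK : ∀ n x i j, x ∈ X n → app (K n) (pair x (pair i j)) = max i j := by
      intro n x i j hx
      refine app_eq ?_ fun c hc => ?_
      · refine ⟨?_, by rwa [fst_pair, fst_pair]⟩
        simp only [fst_pair, snd_pair, max_def_lt]
      · have := hc.1
        simp only [fst_pair, snd_pair, pair_inj, true_and] at this
        rw [this, max_def_lt]
    have hcscs : ∀ n, IsCSCS (X n) (U n) (K n) := by
      intro n
      refine ⟨hUX n, ⟨?_, ?_⟩, ?_, ?_⟩
      · rintro p ⟨hp, hp'⟩
        exact ⟨_, ⟨_, hp', _, ⟨_, trivial, _, trivial, rfl⟩, rfl⟩, _, trivial, hp⟩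
      · rintro _ ⟨x, hx, _, ⟨i, -, j, -, rfl⟩, rfl⟩
        refine ⟨if i < j then j else i, ⟨by simp, by rwa [fst_pair, fst_pair]⟩, fun b hb => ?_⟩
        simpa [pair_inj] using hb.1
      · rintro x (rfl | rfl)
        · exact ⟨0, hU0 n 0⟩
        · exact ⟨0, (hU1 n 0).2 fun w hw => (not_lt_zero hw).elim⟩
      · intro x i j hi hj
        rw [hK n x i j (hUX n i hi)]
        refine ⟨?_, fun y hy => ⟨hanti n _ _ (le_max_left i j) hy,
          hanti n _ _ (le_max_right i j) hy⟩⟩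
        obtain e | e := max_choice i j <;> rw [e] <;> assumption
    have hs := h _ (seqSet_mem_sets X) _ (seqSet_mem_sets U) _ (seqSet_mem_sets K)
      (by simpa using hcscs)
    simp only [sec_seqSet] at hs
    have h01 : ∀ n, (∃ w, pair n w ∈ A) ↔ IsScattered (X n) (U n) := by
      intro n
      constructor
      · rintro ⟨w, hw⟩ Y - hYX ⟨y, hy⟩
        by_cases h0 : 0 ∈ Y
        · refine ⟨0, h0, w + 1, Set.ext fun x => ⟨?_, ?_⟩⟩
          · rintro ⟨hx, hxY⟩
            obtain rfl | rfl := hYX hxY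
            · rfl
            · exact ((hU1 n _).1 hx w (lt_succ_iff.2 le_rfl) hw).elim
          · rintro rfl
            exact ⟨hU0 n _, h0⟩
        · have hY1 : ∀ x ∈ Y, x = 1 := fun x hx =>
            (hYX hx).resolve_left fun e => h0 (e ▸ hx)
          refine ⟨y, hy, 0, Set.ext fun x => ⟨fun hx => (hY1 x hx.2).trans (hY1 y hy).symm, ?_⟩⟩
          rintro rfl
          obtain rfl := hY1 x hy
          exact ⟨(hU1 n 0).2 fun w hw => (not_lt_zero hw).elim, hy⟩
      · intro hsc
        by_contra! hno
        have hU : ∀ i, sec (U n) i = X n := fun i => (hUX n i).antisymm fun x hx => by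
          obtain rfl | rfl := hx
          · exact hU0 n i
          · exact (hU1 n i).2 fun w _ => hno w
        -- Without a witness w every basic set is the whole two-point space, which then has no
        -- isolated point.
        obtain ⟨y, -, i, hi⟩ := hsc (X n) (mem_sets _) subset_rfl ⟨0, .inl rfl⟩
        rw [hU, Set.inter_self] at hi
        have h0 : (0 : 𝓜.Dom) = y := (Set.ext_iff.1 hi 0).1 (.inl rfl)
        have h1 : (1 : 𝓜.Dom) = y := (Set.ext_iff.1 hi 1).1 (.inr rfl)
        exact one_ne_zero (h1.trans h0.symm)
    simpa only [h01] using hs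
  exact L2Structure.modelsACA0

open Classical in
/-- The metric space on all numbers with `d(x, y) = 1 / (min x y + 1)` for `x ≠ y` in which
`(n, w) ∈ A` for some `w ≤ min x y`, and `d(x, y) = 1` for other `x ≠ y`. -/
theorem CompleteIndexSets.modelsACA0 (h : 𝓜.CompleteIndexSets) : 𝓜.ModelsACA0 := by
  have : 𝓜.setClass.Arithmetical := arithmetical_of_projection fun A hA => by
    have := isDefSet_of_mem hA
    let r (n m : 𝓜.Dom) : 𝓜.Dom := if ∃ w, w < m + 1 ∧ pair n w ∈ A then m else 0
    let v (n x y : 𝓜.Dom) : 𝓜.Dom := r n (if x < y then x else y)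
    have hv : ∀ n x y, v n x y = r n (min x y) := by
      intro n x y
      simp only [v]
      split_ifs with hxy
      · rw [min_eq_left hxy.le]
      · rw [min_eq_right (not_lt.1 hxy)]
    have hr : ∀ n a b, a ≤ b → r n a ≤ r n b := by
      intro n a b hab
      simp only [r]
      split_ifs with h1 h2
      · exact hab
      · obtain ⟨w, hw, hwA⟩ := h1
        exact (h2 ⟨w, hw.trans_le (by gcongr), hwA⟩).elim
      · exact zero_le
      · exact le_rfl
    have hult : ∀ n, IsUltra Set.univ (v n) := by
      refine fun n => ⟨fun x _ y _ => by rw [hv, hv, min_comm], fun x _ y _ z _ _ _ _ => ?_⟩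
      simp only [hv]
      have : min (min x y) (min y z) ≤ min x z :=
        le_min ((min_le_left _ _).trans (min_le_left _ _))
          ((min_le_right _ _).trans (min_le_right _ _))
      obtain e | e := min_choice (min x y) (min y z) <;> rw [e] at this
      · exact .inl (hr n _ _ this)
      · exact .inr (hr n _ _ this)
    have hvd : IsDefSet 𝓜.setClass fun _ n => ultraDist Set.univ (v n) :=
      IsDefSet.ultraDist inferInstance
    have hs := h _ (seqSet_mem_sets fun _ => Set.univ) _
      (seqSet_mem_sets fun n => ultraDist Set.univ (v n))
      (by simpa using fun n => isMetricSpace_ultraDist (hult n))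
    simp only [sec_seqSet] at hs
    have hno : ∀ n, (∃ w, pair n w ∈ A) ↔ ¬ IsCompleteMetric Set.univ (ultraDist Set.univ (v n)) := by
      intro n
      constructor
      · rintro ⟨w, hw⟩ hc
        -- The identity sequence: Cauchy once the bound passes w, yet without a limit.
        let F : Set 𝓜.Dom := {p | p = pair (fst p) (fst p)}
        have hFm : ∀ i x, pair i x ∈ F ↔ x = i := fun i x => by simp [F, pair_inj]
        have hF : IsFun F Set.univ Set.univ := ⟨fun p hp => ⟨_, trivial, _, trivial, hp⟩,
          fun i _ => ⟨i, (hFm i i).2 rfl, fun x hx => (hFm i x).1 hx⟩⟩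
        have happ : ∀ i, app F i = i := fun i => app_eq ((hFm i i).2 rfl) fun x => (hFm i x).1
        have hrm : ∀ m, w ≤ m → r n m = m := fun m hm => if_pos ⟨w, lt_succ_iff.2 hm, hw⟩
        have key : ∀ k x y, max (k + 1) w ≤ x → max (k + 1) w ≤ y → k < v n x y := by
          intro k x y hx hy
          have hxy := le_min hx hy
          rw [hv, hrm _ ((le_max_right _ _).trans hxy)]
          exact succ_le_iff.1 ((le_max_left _ _).trans hxy)
        obtain ⟨x, -, hx⟩ := hc F (mem_sets _) hF fun k => ⟨max (k + 1) w, fun a b ha hb => by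
          rw [realLT_ultraDist (Set.mem_univ _) (Set.mem_univ _), happ, happ]
          exact .inr (key k a b ha hb)⟩
        -- Precision x suffices to refute a limit x: for y > x the minimum is x, so d(y, x) is at
        -- least 1/(x + 1).
        obtain ⟨N, hN⟩ := hx x
        have hx := hN (max N (x + 1)) (le_max_left _ _)
        rw [realLT_ultraDist (Set.mem_univ _) (Set.mem_univ _), happ] at hx
        have hlt : x < max N (x + 1) := succ_le_iff.1 (le_max_right _ _)
        obtain e | hx := hx
        · exact hlt.ne e.symm
        · refine hx.not_ge ?_
          rw [hv, min_eq_right hlt.le]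
          simp only [r]
          split_ifs
          · exact le_rfl
          · exact zero_le
      · intro hc
        by_contra! hno
        refine hc fun F _ hF hcau => ?_
        -- With no witness w, distinct points are at distance 1, so Cauchy sequences are eventually
        -- constant.
        have hv0 : ∀ x y, v n x y = 0 := fun x y => by
          rw [hv]
          exact if_neg fun ⟨w, _, hw⟩ => hno w hw
        obtain ⟨N, hN⟩ := hcau 0
        refine ⟨app F N, trivial, fun k => ⟨N, fun m hm => ?_⟩⟩
        have := hN m N hm le_rfl
        rw [realLT_ultraDist (Set.mem_univ _) (Set.mem_univ _), hv0] at this ⊢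
        exact .inl (this.resolve_right (lt_irrefl _))
    have := isDefSet_of_mem hs
    -- The projection is the complement of the index set.
    have hs' := mem_sets fun n => n ∉ {n | IsCompleteMetric Set.univ (ultraDist Set.univ (v n))}
    simp only [hno]
    exact hs'
  exact L2Structure.modelsACA0

/-- `Π¹₁` formulas are uniformly equivalent to the well-foundedness of trees. -/
theorem exists_treeSequence [hA : Fact 𝓜.ModelsACA0] {φ : L2Formula} (hφ : φ.IsArithmetical)
    (v : ℕ → 𝓜.Dom) (V : ℕ → 𝓜.sets) :
    ∃ T : 𝓜.Dom → Set 𝓜.Dom, IsDefSet 𝓜.setClass (fun _ => T) ∧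
      ∀ n, IsTree (T n) ∧ (IsWellFounded (T n) ↔ (allS φ).Sat 𝓜 (vcons n v) V) := by
  -- The family is indexed by n, which enters as number variable 0; hence a single formula defines
  -- all the trees T n, and the sequence of trees is a set of the model.
  let D := formulaClass (𝓜 := fun _ : 𝓜.Dom => 𝓜) (fun n => vcons n v) (fun _ => V)
  have : D.Arithmetical := inferInstanceAs (formulaClass _ _).Arithmetical
  have hR : Representable D fun n X _ => φ.Sat 𝓜 (vcons n v) (vcons X V) :=
    Representable.sat (V := fun _ => V) (δ := fun n _ => vcons n v) hφ
      (fun n => IsDefSet.formulaClass_param n) (fun n => IsFn.formulaClass_param n)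
      (fun e n => IsFn.setClass_const _)
  obtain ⟨T, hT, hTree⟩ := hR.exists_tree
  have hP : IsDef D fun n c => c ∈ T n := inferInstance
  obtain ⟨θ, hθ, h⟩ := hP.exists_formula
  refine ⟨T, ?_, hTree⟩
  have hδ : ∀ n, IsFn 𝓜.setClass fun _ c => vcons (snd c) (vcons (fst c) v) n := by
    rintro (_ | _ | n)
    · exact (inferInstance : IsFn 𝓜.setClass fun _ c => snd c)
    · exact (inferInstance : IsFn 𝓜.setClass fun _ c => fst c)
    · exact IsFn.setClass_const (v n)
  have := IsDef.sat (D := 𝓜.setClass) hθ (V := fun _ => V) (fun n => isDefSet_of_mem (V n).2)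
    (δ := fun _ c => vcons (snd c) (vcons (fst c) v)) hδ
  exact ⟨(this.congr fun _ c => h (fst c) (snd c)).out⟩

theorem mem_sets_of_isDefSet {T : 𝓜.Dom → Set 𝓜.Dom} (h : IsDefSet 𝓜.setClass fun _ => T)
    (n : 𝓜.Dom) : T n ∈ 𝓜.sets :=
  mem_sets fun c => c ∈ (fun n _ => T n) n c

theorem pi11Comprehension_iff_scatteredIndexSets :
    𝓜.Pi11Comprehension ↔ 𝓜.ScatteredIndexSets := by
  refine ⟨fun h => h.scatteredIndexSets, fun h => ?_⟩
  have : Fact 𝓜.ModelsACA0 := ⟨h.modelsACA0⟩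
  rintro _ ⟨φ, hφ, rfl⟩ v V
  obtain ⟨T, hT, hTree⟩ := exists_treeSequence hφ v V
  have hL : IsDefSet 𝓜.setClass fun _ n => plusTree (T n) := inferInstance
  have hB : IsDefSet 𝓜.setClass fun _ n => intervalBasis (plusTree (T n)) ltKB := inferInstance
  have hK : IsDefSet 𝓜.setClass fun _ n =>
    basisFun (plusTree (T n)) (intervalBasis (plusTree (T n)) ltKB) := inferInstance
  have hs := h _ (seqSet_mem_sets fun n => plusTree (T n))
    _ (seqSet_mem_sets fun n => intervalBasis (plusTree (T n)) ltKB)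
    _ (seqSet_mem_sets fun n => basisFun (plusTree (T n)) (intervalBasis (plusTree (T n)) ltKB))
    fun n => by
      simp only [sec_seqSet]
      exact isCSCS_intervalBasis (mem_sets_of_isDefSet hL n) fun _ h => h.1
  refine ⟨_, hs, fun n => ?_⟩
  simp only [sec_seqSet, Set.mem_ofPred_eq]
  have hTs := mem_sets_of_isDefSet hT n
  exact Iff.trans ⟨isWellFounded_of_isScattered hTs, isScattered_of_isWellFounded hTs (hTree n).1⟩
    (hTree n).2

theorem pi11Comprehension_iff_completeIndexSets :
    𝓜.Pi11Comprehension ↔ 𝓜.CompleteIndexSets := by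
  refine ⟨fun h => h.completeIndexSets, fun h => ?_⟩
  have : Fact 𝓜.ModelsACA0 := ⟨h.modelsACA0⟩
  rintro _ ⟨φ, hφ, rfl⟩ v V
  obtain ⟨T, hT, hTree⟩ := exists_treeSequence hφ v V
  have hs := h _ (seqSet_mem_sets T) _ (seqSet_mem_sets fun n => ultraDist (T n) firstDiff)
    fun n => by
      simp only [sec_seqSet]
      exact isMetricSpace_ultraDist (isUltra_firstDiff (hTree n).1)
  refine ⟨_, hs, fun n => ?_⟩
  simp only [sec_seqSet, Set.mem_ofPred_eq]
  rw [isCompleteMetric_iff_isWellFounded (mem_sets_of_isDefSet hT n) (hTree n).1, (hTree n).2]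

end L2Structure

/-! ### The main theorem -/

theorem mainTheorem8 :
    (∀ 𝓜 : L2Structure.{u}, 𝓜.ModelsACA0 →
      ∀ T ∈ 𝓜.sets, L2Structure.IsTree T →
        (L2Structure.plusTree T ∈ 𝓜.sets ∧
          L2Structure.intervalBasis (L2Structure.plusTree T) L2Structure.ltKB ∈ 𝓜.sets ∧
          ∃ K ∈ 𝓜.sets, L2Structure.IsCSCS (L2Structure.plusTree T)
            (L2Structure.intervalBasis (L2Structure.plusTree T) L2Structure.ltKB) K) ∧
        (L2Structure.IsWellFounded T ↔
          L2Structure.IsScattered (L2Structure.plusTree T)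
            (L2Structure.intervalBasis (L2Structure.plusTree T) L2Structure.ltKB))) ∧
    IsPi11UniversalOverACA0.{u}
      (fun _ Z => L2Structure.CodesMetricSpace Z)
      (fun _ Z => L2Structure.IsCompleteMetric (L2Structure.sec Z 0) (L2Structure.sec Z 1)) ∧
    (∀ 𝓜 : L2Structure.{u}, 𝓜.ModelsRCA0 →
      (𝓜.Pi11Comprehension ↔ 𝓜.ScatteredIndexSets) ∧
      (𝓜.Pi11Comprehension ↔ 𝓜.CompleteIndexSets)) := by
  refine ⟨fun 𝓜 hM T hT hTree => ?_, isPi11UniversalOverACA0_isCompleteMetric, fun 𝓜 hM => ?_⟩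
  · have : Fact 𝓜.ModelsACA0 := ⟨hM⟩
    have := isDefSet_of_mem hT
    have hL : plusTree T ∈ 𝓜.sets := mem_sets fun c => c ∈ plusTree T
    exact ⟨⟨hL, mem_sets fun c => c ∈ intervalBasis (plusTree T) ltKB, _,
      mem_sets fun c => c ∈ basisFun (plusTree T) (intervalBasis (plusTree T) ltKB),
      isCSCS_intervalBasis hL fun _ h => h.1⟩,
      isScattered_of_isWellFounded hT hTree, isWellFounded_of_isScattered hT⟩
  · have : Fact 𝓜.ModelsRCA0 := ⟨hM⟩
    exact ⟨pi11Comprehension_iff_scatteredIndexSets, pi11Comprehension_iff_completeIndexSets⟩
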